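/- Let $V(x)=-\cos x-1$ and consider the uncoupled system $\ddot x_i+\sin x_i=0$, $i=1,\dots,4$, on $\mathbb R^4$, with energies $E_i=\dot x_i^2/2+V(x_i)$ (constant along solutions). Call a pair $(\alpha,\beta)$ of reals admissible if, after applying one and the same map $x\mapsto \pm x+2\pi k$ ($k\in\mathbb Z$) to $\alpha$ and $\beta$, one of the following holds; in each case an interval $I$ is attached to the pair (and transported back by the same map): (1) $|\alpha|\le 1$, $|\beta-\pi|\le 1$, $I=[\alpha,\max\{\beta,\pi\}]$; (2) $|\alpha+\pi|\le 1$, $|\beta|\le 1$, $I=[-1-\pi,1]$; (3) $|\alpha|\le 1$, $|\beta-2\pi|\le 1$, $I=[-1,2\pi+1]$; (4) $\beta-\alpha\ge 2\pi$, $I=[\alpha,\beta]$; (5) $|\alpha-\pi|\le 1$, $|\beta-\pi|\le 1$, $I=[\pi-1,\pi+1]$. Call $(q,q')\in\mathbb R^4\times\mathbb R^4$ admissible if $(q_i,q_i')$ is admissible for every $i$. A connection from $q$ to $q'$ in time $T>0$ is a solution $X$ of the system with $X(0)=q$, $X(T)=q'$ such that, for each $i$, $X_i(t)$ stays in an interval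 $I$ attached to $(q_i,q_i')$ for $0\le t\le T$. For every admissible pair $q\ne q'$ there are exactly one $T=T(q,q')>0$ and exactly one connection $X(\cdot\,;q,q',T(q,q'))$ from $q$ to $q'$ in time $T$ whose total energy $\sum_{i=1}^4E_i$ equals $1$; let $\mathbf E(q,q')=(E_1,\dots,E_4)$ be its energy vector. There is a constant $C$ such that the following two statements hold. (i) Let $r\ge 3$ be an integer and $0<\varepsilon<1$. If $(q_1,q_1')$, $(q_2,q_2')$ are admissible, $|q_k'-q_k|\ge\varepsilon^{-2r-5}$ for $k=1,2$, and $|e_2-e_1|<\varepsilon^{2r+5}$, where $e_k=(q_k'-q_k)/|q_k'-q_k|$, then $$|\mathbf E(q_2,q_2')-\mathbf E(q_1,q_1')|<C\,\varepsilon^{2r+5}.$$ (ii) For every admissible $(q,q')$ with $|q'-q|\ge 1$ the map $q\mapsto\dot X(0;q,q',T(q,q'))$, defined on the set of all $q$ for which $(q,q')$ is admissible, is differentiable at $q$ (within that set), and $$\Bigl|\frac{d}{dq}\dot X(0;q,q',T(q,q'))\Bigr|<C.$$ -/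

import Mathlib

/-- The configuration space `ℝ⁴` of four pendula, with the Euclidean norm. -/
abbrev Config : Type := EuclideanSpace ℝ (Fin 4)

/-- The potential `V(x) = -cos x - 1` of a single pendulum (zero at the upside-down position). -/
noncomputable def pendulumPotential (x : ℝ) : ℝ := -Real.cos x - 1

/-- `X` solves the uncoupled system `ẍᵢ + sin xᵢ = 0`, `i = 1, …, 4`. -/
def IsUncoupledSolution (X : ℝ → Config) : Prop :=
  ∀ t : ℝ, HasDerivAt X (deriv X t) t ∧
    HasDerivAt (deriv X) (WithLp.toLp 2 fun i => -Real.sin (X t i)) t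

/-- The energy `ẋᵢ² / 2 + V(xᵢ)` of the `i`-th pendulum at time `t` along the curve `X`. -/
noncomputable def siteEnergy (X : ℝ → Config) (i : Fin 4) (t : ℝ) : ℝ :=
  (deriv X t i) ^ 2 / 2 + pendulumPotential (X t i)

/-- The normalized endpoint conditions on the initial position `α` and the final position `β` of
one pendulum, each with the interval to which the motion from `α` to `β` is confined:
from near the bottom to near the top, from near the top to near the bottom, from near the bottom
to near the next bottom, through at least one full turn, and staying near the top. -/
def BaseRoute (α β : ℝ) (I : Set ℝ) : Prop :=
  (|α| ≤ 1 ∧ |β - Real.pi| ≤ 1 ∧ I = Set.Icc α (max β Real.pi)) ∨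
  (|α + Real.pi| ≤ 1 ∧ |β| ≤ 1 ∧ I = Set.Icc (-1 - Real.pi) 1) ∨
  (|α| ≤ 1 ∧ |β - 2 * Real.pi| ≤ 1 ∧ I = Set.Icc (-1) (2 * Real.pi + 1)) ∨
  (2 * Real.pi ≤ β - α ∧ I = Set.Icc α β) ∨
  (|α - Real.pi| ≤ 1 ∧ |β - Real.pi| ≤ 1 ∧ I = Set.Icc (Real.pi - 1) (Real.pi + 1))

/-- The endpoint conditions up to the symmetries `x ↦ ± x + 2πk` of the pendulum equation. -/
def Route (α β : ℝ) (I : Set ℝ) : Prop :=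
  ∃ (k : ℤ) (s : ℝ) (α₀ β₀ : ℝ) (I₀ : Set ℝ), (s = 1 ∨ s = -1) ∧ BaseRoute α₀ β₀ I₀ ∧
    α = s * α₀ + 2 * Real.pi * k ∧ β = s * β₀ + 2 * Real.pi * k ∧
    I = (fun x : ℝ => s * x + 2 * Real.pi * k) '' I₀

/-- Every pair `(qᵢ, qᵢ′)` of coordinates satisfies one of the endpoint conditions. -/
def Admissible (q q' : Config) : Prop := ∀ i : Fin 4, ∃ I : Set ℝ, Route (q i) (q' i) I

/-- `X` is a solution of the uncoupled system that travels from `q` to `q'` in time `T > 0`, each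
coordinate being confined to the interval that belongs to its endpoints. -/
def IsConnection (q q' : Config) (T : ℝ) (X : ℝ → Config) : Prop :=
  0 < T ∧ IsUncoupledSolution X ∧ X 0 = q ∧ X T = q' ∧
    ∀ i : Fin 4, ∃ I : Set ℝ, Route (q i) (q' i) I ∧ ∀ t ∈ Set.Icc 0 T, X t i ∈ I

/-- `X` is a connection from `q` to `q'` in time `T` whose total energy is one. -/
def IsEnergyOneConnection (q q' : Config) (T : ℝ) (X : ℝ → Config) : Prop :=
  IsConnection q q' T X ∧ ∀ t : ℝ, ∑ i : Fin 4, siteEnergy X i t = 1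

/-- The travel time `T(q, q′)` of the energy-one connection (a junk value if there is none). -/
noncomputable def travelTime (q q' : Config) : ℝ :=
  Classical.epsilon fun T : ℝ => ∃ X : ℝ → Config, IsEnergyOneConnection q q' T X

/-- The energy-one connection `t ↦ X(t; q, q′, T(q, q′))` (a junk value if there is none). -/
noncomputable def energyOneConnection (q q' : Config) : ℝ → Config :=
  Classical.epsilon fun X : ℝ → Config => IsEnergyOneConnection q q' (travelTime q q') X

/-- The initial velocity `Ẋ(0; q, q′, T(q, q′))`. -/
noncomputable def initialVelocity (q q' : Config) : Config :=
  deriv (energyOneConnection q q') 0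

/-- The energy vector `𝐄(q, q′) = (E₁, E₂, E₃, E₄)` of the energy-one connection; the energies of
the individual pendula do not depend on time and are read off at time `0`. -/
noncomputable def energyVector (q q' : Config) : Config :=
  WithLp.toLp 2 fun i => siteEnergy (energyOneConnection q q') i 0

/-- The unit vector `(q′ - q) / |q′ - q|`. -/
noncomputable def displacementDirection (q q' : Config) : Config :=
  ‖q' - q‖⁻¹ • (q' - q)

/-!
The angle is measured from the upside-down position, so that every pendulum obeys `ÿ = sin y` and
has the energy `E = ẏ² / 2 + cos y - 1`, which vanishes at rest at the top. Let `φ` and `ψ` be the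
derivatives of the motion in its initial velocity and in its initial position. If the end points
are fixed, the energy has the derivative `-ẏ(0) ẏ(T) / φ(T)` in the travel time `T`.

Everything is deduced from a priori facts about a single confined motion, collected in `GoodPath`.
The decisive ones are `φ(T) > 0`, so that the initial velocity `connVel` is a differentiable function
of the initial position and of `T`, and the slope bounds `T ∂E/∂T ≤ -2E + 13/20` and, if `E > 0`,
`T ∂E/∂T ≤ -2E`. If the four energies add up to `1`, at least one of them is positive, so the slopes
add up to at most `-2 + 3 · 13/20 < 0`: the total energy crosses the value `1` only downwards, hence
once (`totalEnergy_time_unique`). As it tends to infinity for small times and does not exceed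
`‖q' - q‖² / (2T²)`, it takes the value `1`.

There are four kinds of confined motions. Rotations have positive energy, and `φ / ẏ` has the
derivative `ẏ(0) / ẏ²`. Near the top `cos y` is bounded below and Jacobi fields grow
(`goodPath_near_top`). The hard case is the motion from the top to the bottom that starts upwards: its
energy is negative, and the slope bound leaves little room. Here `φ` is known in closed form in terms
of the end points and of `∫ ẏ²` (`JacVel.energy_mul_eq`), and `ẏ + 2 sin (y / 2)` grows with the rate
`cos (y / 2)`, which bounds the time; the slope bound becomes a scalar inequality
(`TopDown.slope_of_neg`). Motions from the bottom to the top are the time reversals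
(`goodPath_of_rev`).

For a fixed travel time, connections are found by shooting. From the top to the bottom the function
to be matched is the maximal angle `maxPos` up to the time `T` and not the final angle, since the
former singles out the confined motions; because of `φ(T) > 0` it passes each value upwards, which
gives uniqueness (`TopDown.vel_unique`).

The derivative of the initial velocity in the initial position comes from the implicit equation for
the travel time, whose slope is at least `1 / (20T)`, and from bounds for `ψ / φ` and `T ẏ / φ`
(`exists_hasFDerivWithinAt_initialVelocity`). For long connections the distance covered is, up to one
turn, the time multiplied by a rate `turnRate` that depends on the energy alone and determines the
nonnegative energies in a Lipschitz way, while negative energies are of the size `1 / T`. So if the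
directions are close, the connection with the larger mean speed has, up to a small error, the larger
energy in every coordinate; since both total energies are `1`, the energies nearly agree
(`abs_connEnergy_sub_le`).
-/

namespace Pendula
open Real Set Filter Topology

/-! ### Second-order equations with a Lipschitz right-hand side -/

/-- Truncation of a real number to `[-R, R]`; it makes a Lipschitz field bounded. -/
def clamp (R x : ℝ) : ℝ := max (-R) (min x R)

lemma abs_clamp_le {R : ℝ} (hR : 0 ≤ R) (x : ℝ) : |clamp R x| ≤ R := by
  unfold clamp
  rw [abs_le]
  exact ⟨le_max_left _ _, max_le (by linarith) (min_le_right _ _)⟩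

lemma abs_clamp_le_abs {R : ℝ} (hR : 0 ≤ R) (x : ℝ) : |clamp R x| ≤ |x| := by
  unfold clamp
  rcases max_cases (-R) (min x R) with h | h <;> rcases min_cases x R with h' | h' <;>
    rcases abs_cases x with h3 | h3 <;> rw [abs_le] <;> constructor <;> linarith

lemma abs_clamp_sub_le (R x y : ℝ) : |clamp R x - clamp R y| ≤ |x - y| := by
  unfold clamp
  have h1 := abs_max_sub_max_le_abs (min x R) (min y R) (-R)
  have h2 := abs_min_sub_min_le_max x R y R
  rw [max_comm (-R), max_comm (-R)]
  refine h1.trans (h2.trans ?_)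
  simp

lemma clamp_eq_self {R x : ℝ} (h : |x| ≤ R) : clamp R x = x := by
  unfold clamp
  rw [abs_le] at h
  rw [min_eq_left h.2, max_eq_right h.1]

/-- On a bounded time interval a second-order equation with Lipschitz force is solvable: truncate
the field, solve by Picard-Lindelöf, and remove the truncation with Grönwall's inequality. -/
lemma exists_secondOrder_Icc {g : ℝ → ℝ → ℝ} (hc : ∀ x, Continuous fun t => g t x)
    (hL : ∀ t x y, |g t x - g t y| ≤ |x - y|) (h0 : ∀ t, |g t 0| ≤ 1) (z₀ : ℝ × ℝ) {N : ℝ}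
    (hN : 0 < N) :
    ∃ z : ℝ → ℝ × ℝ, z 0 = z₀ ∧
      ∀ t ∈ Icc (-N) N, HasDerivWithinAt z ((z t).2, g t (z t).1) (Icc (-N) N) t := by
  set R : ℝ := gronwallBound ‖z₀‖ 1 1 N with hRdef
  have hR : 0 ≤ R := by
    rw [hRdef, gronwallBound_of_K_ne_0 one_ne_zero]
    have := add_one_le_exp (1 * N)
    have h2 := mul_nonneg (norm_nonneg z₀) (exp_pos (1 * N)).le
    norm_num at *
    nlinarith
  have hg1 : ∀ t x, |g t x| ≤ |x| + 1 := fun t x => by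
    have h1 := hL t x 0
    have h2 := h0 t
    have h3 := abs_sub_abs_le_abs_sub (g t x) (g t 0)
    simp only [sub_zero] at h1
    linarith
  set F : ℝ → ℝ × ℝ → ℝ × ℝ := fun t z => (clamp R z.2, g t (clamp R z.1)) with hF
  have hFL : ∀ t, LipschitzWith 1 (F t) := fun t => by
    refine LipschitzWith.of_dist_le_mul fun z w => ?_
    simp only [hF, Prod.dist_eq, NNReal.coe_one, one_mul, Real.dist_eq]
    have h1 := abs_clamp_sub_le R z.2 w.2
    have h2 := (hL t (clamp R z.1) (clamp R w.1)).trans (abs_clamp_sub_le R z.1 w.1)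
    exact max_le (h1.trans (le_max_right _ _)) (h2.trans (le_max_left _ _))
  have hFn : ∀ t z, ‖F t z‖ ≤ R + 1 := fun t z => by
    simp only [hF, Prod.norm_def, Real.norm_eq_abs]
    exact max_le ((abs_clamp_le hR _).trans (by linarith))
      ((hg1 _ _).trans (by linarith [abs_clamp_le hR z.1]))
  have hFz : ∀ t z, ‖F t z‖ ≤ 1 * ‖z‖ + 1 := fun t z => by
    simp only [hF, Prod.norm_def, Real.norm_eq_abs, one_mul]
    refine max_le ?_ ?_
    · have h1 := abs_clamp_le_abs hR z.2
      have h2 := le_max_right |z.1| |z.2|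
      linarith
    · have h1 := hg1 t (clamp R z.1)
      have h2 := abs_clamp_le_abs hR z.1
      have h3 := le_max_left |z.1| |z.2|
      linarith
  have hmem : (0 : ℝ) ∈ Icc (-N) N := ⟨by linarith, hN.le⟩
  have hPL : IsPicardLindelof F (⟨0, hmem⟩ : Icc (-N) N) z₀ (⟨(R + 1) * N, by positivity⟩ : NNReal)
      0 (⟨R + 1, by positivity⟩ : NNReal) 1 := by
    refine ⟨fun t _ => (hFL t).lipschitzOnWith, fun x _ => ?_, fun t _ x _ => hFn t x, ?_⟩
    · exact (continuous_const.prodMk (hc _)).continuousOn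
    · simp only [sub_zero, zero_sub, neg_neg, max_self, NNReal.coe_zero]
      exact le_rfl
  obtain ⟨z, hz0, hz⟩ := hPL.exists_eq_forall_mem_Icc_hasDerivWithinAt₀
  simp only at hz0
  have hzc : ContinuousOn z (Icc (-N) N) := fun t ht => (hz t ht).continuousWithinAt
  have hb : ∀ t ∈ Icc (-N) N, ‖z t‖ ≤ R := by
    have hmono := gronwallBound_mono (norm_nonneg z₀) (zero_le_one' ℝ) (zero_le_one' ℝ)
    have fwd : ∀ t ∈ Icc 0 N, ‖z t‖ ≤ R := fun t ht => by
      have := norm_le_gronwallBound_of_norm_deriv_right_le (f := z) (f' := fun t => F t (z t))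
        (δ := ‖z₀‖) (K := 1) (ε := 1) (a := 0) (b := N)
        (hzc.mono (Icc_subset_Icc_left (by linarith)))
        (fun x hx => (hz x ⟨by linarith [hx.1], hx.2.le⟩).mono_of_mem_nhdsWithin
          (Icc_mem_nhdsGE_of_mem ⟨by linarith [hx.1], hx.2⟩))
        (by rw [hz0]) (fun x _ => hFz _ _) t ht
      refine this.trans (hmono ?_)
      simpa using ht.2
    have bwd : ∀ t ∈ Icc 0 N, ‖z (-t)‖ ≤ R := fun t ht => by
      have hd : ∀ x ∈ Icc (-N) N,
          HasDerivWithinAt (fun t => z (-t)) (-F (-x) (z (-x))) (Icc (-N) N) x := fun x hx => by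
        have h1 := hz (-x) ⟨by linarith [hx.2], by linarith [hx.1]⟩
        have h2 := h1.scomp x (hasDerivAt_neg x).hasDerivWithinAt (s := Icc (-N) N)
          (fun y hy => ⟨by linarith [hy.2], by linarith [hy.1]⟩)
        simpa [Function.comp_def] using h2
      have := norm_le_gronwallBound_of_norm_deriv_right_le (f := fun t => z (-t))
        (f' := fun t => -F (-t) (z (-t))) (δ := ‖z₀‖) (K := 1) (ε := 1) (a := 0) (b := N)
        (fun x hx => (hd x ⟨by linarith [hx.1], hx.2⟩).continuousWithinAt.mono
          (Icc_subset_Icc_left (by linarith)))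
        (fun x hx => (hd x ⟨by linarith [hx.1], hx.2.le⟩).mono_of_mem_nhdsWithin
          (Icc_mem_nhdsGE_of_mem ⟨by linarith [hx.1], hx.2⟩)) (by simp [hz0])
        (fun x _ => by rw [norm_neg]; exact hFz _ _) t ht
      refine this.trans (hmono ?_)
      simpa using ht.2
    intro t ht
    rcases le_total 0 t with h | h
    · exact fwd t ⟨h, ht.2⟩
    · simpa using bwd (-t) ⟨by linarith, by linarith [ht.1]⟩
  refine ⟨z, hz0, fun t ht => ?_⟩
  have h1 := hz t ht
  have h2 := hb t ht
  simp only [hF] at h1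
  rw [clamp_eq_self ((norm_fst_le (z t)).trans h2), clamp_eq_self ((norm_snd_le (z t)).trans h2)]
    at h1
  exact h1

lemma lipschitzWith_secondOrder {g : ℝ → ℝ → ℝ} (hL : ∀ t x y, |g t x - g t y| ≤ |x - y|) (t : ℝ) :
    LipschitzWith 1 (fun z : ℝ × ℝ => (z.2, g t z.1)) := by
  refine LipschitzWith.of_dist_le_mul fun z w => ?_
  simp only [Prod.dist_eq, NNReal.coe_one, one_mul, Real.dist_eq]
  exact max_le (le_max_right _ _) ((hL t _ _).trans (le_max_left _ _))

/-- Global existence for `ẍ = g(t, x)` with `g` Lipschitz in `x`. -/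
theorem exists_secondOrder {g : ℝ → ℝ → ℝ} (hc : ∀ x, Continuous fun t => g t x)
    (hL : ∀ t x y, |g t x - g t y| ≤ |x - y|) (h0 : ∀ t, |g t 0| ≤ 1) (a v : ℝ) :
    ∃ x p : ℝ → ℝ, x 0 = a ∧ p 0 = v ∧ (∀ t, HasDerivAt x (p t) t) ∧
      ∀ t, HasDerivAt p (g t (x t)) t := by
  have hex : ∀ n : ℕ, ∃ z : ℝ → ℝ × ℝ, z 0 = (a, v) ∧ ∀ t ∈ Ioo (-(n + 1 : ℝ)) (n + 1),
      HasDerivAt z ((z t).2, g t (z t).1) t := fun n => by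
    obtain ⟨z, h1, h2⟩ := exists_secondOrder_Icc hc hL h0 (a, v) (N := n + 1) (by positivity)
    exact ⟨z, h1, fun t ht => (h2 t (Ioo_subset_Icc_self ht)).hasDerivAt (Icc_mem_nhds ht.1 ht.2)⟩
  choose z hz0 hz using hex
  have huniq : ∀ m n : ℕ, m ≤ n → EqOn (z m) (z n) (Ioo (-(m + 1 : ℝ)) (m + 1)) := fun m n hmn => by
    have hmn' : (m : ℝ) ≤ n := by exact_mod_cast hmn
    have hm : (0 : ℝ) ≤ m := by positivity
    refine ODE_solution_unique_of_mem_Ioo (v := fun t z => (z.2, g t z.1)) (s := fun _ => univ)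
      (K := 1) (t₀ := 0) (fun t _ => (lipschitzWith_secondOrder hL t).lipschitzOnWith)
      ⟨by linarith, by linarith⟩ (fun t ht => ⟨hz m t ht, trivial⟩)
      (fun t ht => ⟨hz n t ⟨by linarith [ht.1], by linarith [ht.2]⟩, trivial⟩) ?_
    rw [hz0, hz0]
  set w : ℝ → ℝ × ℝ := fun t => z ⌈|t|⌉₊ t with hw
  have hwz : ∀ n : ℕ, ∀ t : ℝ, |t| < (n : ℝ) → w t = z n t := fun n t ht => by
    refine huniq _ _ (Nat.ceil_le.2 ht.le) ?_
    have := Nat.le_ceil |t|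
    have h1 := abs_le.1 this
    constructor <;> linarith [h1.1, h1.2]
  have hwd : ∀ t, HasDerivAt w ((w t).2, g t (w t).1) t := fun t => by
    obtain ⟨n, hn⟩ := exists_nat_gt |t|
    rw [hwz n t hn]
    have h1 := abs_lt.1 hn
    refine (hz n t ⟨by linarith [h1.1], by linarith [h1.2]⟩).congr_of_eventuallyEq ?_
    filter_upwards [(continuous_abs.tendsto t).eventually (gt_mem_nhds hn)] with s hs
    exact hwz n s hs
  refine ⟨fun t => (w t).1, fun t => (w t).2, ?_, ?_, fun t => ?_, fun t => ?_⟩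
  · simp [hw, hz0]
  · simp [hw, hz0]
  · exact (hasFDerivAt_fst.comp_hasDerivAt t (hwd t))
  · exact (hasFDerivAt_snd.comp_hasDerivAt t (hwd t))

/-- Uniqueness for `ẍ = g(t, x)` with `g` Lipschitz in `x`. -/
theorem secondOrder_unique {g : ℝ → ℝ → ℝ} (hL : ∀ t x y, |g t x - g t y| ≤ |x - y|)
    {x p x' p' : ℝ → ℝ} (hx : ∀ t, HasDerivAt x (p t) t) (hp : ∀ t, HasDerivAt p (g t (x t)) t)
    (hx' : ∀ t, HasDerivAt x' (p' t) t) (hp' : ∀ t, HasDerivAt p' (g t (x' t)) t) {t₀ : ℝ}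
    (h1 : x t₀ = x' t₀) (h2 : p t₀ = p' t₀) : x = x' ∧ p = p' := by
  have := ODE_solution_unique_univ (v := fun t z => (z.2, g t z.1)) (s := fun _ => univ)
    (K := 1) (t₀ := t₀) (f := fun t => (x t, p t)) (g := fun t => (x' t, p' t))
    (fun t => (lipschitzWith_secondOrder hL t).lipschitzOnWith)
    (fun t => ⟨(hx t).prodMk (hp t), trivial⟩) (fun t => ⟨(hx' t).prodMk (hp' t), trivial⟩)
    (by simp [h1, h2])
  constructor
  · funext t; exact congrArg Prod.fst (congrFun this t)
  · funext t; exact congrArg Prod.snd (congrFun this t)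

/-- Lipschitz dependence of solutions of `ẍ = g(t, x)` on their initial data. -/
theorem secondOrder_dist_le {g : ℝ → ℝ → ℝ} (hL : ∀ t x y, |g t x - g t y| ≤ |x - y|)
    {x p x' p' : ℝ → ℝ} (hx : ∀ t, HasDerivAt x (p t) t) (hp : ∀ t, HasDerivAt p (g t (x t)) t)
    (hx' : ∀ t, HasDerivAt x' (p' t) t) (hp' : ∀ t, HasDerivAt p' (g t (x' t)) t) {t : ℝ}
    (ht : 0 ≤ t) : |x t - x' t| ≤ max |x 0 - x' 0| |p 0 - p' 0| * exp t ∧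
      |p t - p' t| ≤ max |x 0 - x' 0| |p 0 - p' 0| * exp t := by
  have h := dist_le_of_trajectories_ODE (v := fun t z => (z.2, g t z.1)) (K := 1) (a := 0) (b := t)
    (f := fun t => (x t, p t)) (g := fun t => (x' t, p' t)) (lipschitzWith_secondOrder hL)
    (fun s _ => ((hx s).prodMk (hp s)).continuousAt.continuousWithinAt)
    (fun s _ => ((hx s).prodMk (hp s)).hasDerivWithinAt)
    (fun s _ => ((hx' s).prodMk (hp' s)).continuousAt.continuousWithinAt)
    (fun s _ => ((hx' s).prodMk (hp' s)).hasDerivWithinAt) le_rfl t ⟨ht, le_rfl⟩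
  simp only [Prod.dist_eq, Real.dist_eq, NNReal.coe_one, one_mul, sub_zero] at h
  exact ⟨(le_max_left _ _).trans h, (le_max_right _ _).trans h⟩

/-- Uniqueness for `ẍ = g(t, x)` when the equation is only known to hold on `[0, T]`. -/
lemma secondOrder_eqOn {g : ℝ → ℝ → ℝ} (hL : ∀ t x y, |g t x - g t y| ≤ |x - y|)
    {x p x' p' : ℝ → ℝ} {T : ℝ} (hx : ∀ t ∈ Icc 0 T, HasDerivAt x (p t) t)
    (hp : ∀ t ∈ Icc 0 T, HasDerivAt p (g t (x t)) t)
    (hx' : ∀ t ∈ Icc 0 T, HasDerivAt x' (p' t) t)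
    (hp' : ∀ t ∈ Icc 0 T, HasDerivAt p' (g t (x' t)) t)
    (h1 : x 0 = x' 0) (h2 : p 0 = p' 0) {t : ℝ} (ht : t ∈ Icc 0 T) : x t = x' t := by
  have h := dist_le_of_trajectories_ODE (v := fun t z => (z.2, g t z.1)) (K := 1) (a := 0) (b := T)
    (f := fun t => (x t, p t)) (g := fun t => (x' t, p' t)) (lipschitzWith_secondOrder hL)
    (fun s hs => ((hx s hs).prodMk (hp s hs)).continuousAt.continuousWithinAt)
    (fun s hs => ((hx s (Ico_subset_Icc_self hs)).prodMk
      (hp s (Ico_subset_Icc_self hs))).hasDerivWithinAt)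
    (fun s hs => ((hx' s hs).prodMk (hp' s hs)).continuousAt.continuousWithinAt)
    (fun s hs => ((hx' s (Ico_subset_Icc_self hs)).prodMk
      (hp' s (Ico_subset_Icc_self hs))).hasDerivWithinAt) le_rfl t ht
  rw [h1, h2, dist_self, zero_mul, Prod.dist_eq] at h
  exact dist_le_zero.1 ((le_max_left _ _).trans h)

/-! ### Calculus on intervals -/

lemma le_of_hasDerivAt_nonneg {f f' : ℝ → ℝ} {a b : ℝ} (hab : a ≤ b)
    (hf : ∀ t ∈ Icc a b, HasDerivAt f (f' t) t) (h : ∀ t ∈ Ioo a b, 0 ≤ f' t) : f a ≤ f b := by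
  have : MonotoneOn f (Icc a b) := by
    refine monotoneOn_of_deriv_nonneg (convex_Icc a b)
      (fun t ht => (hf t ht).continuousAt.continuousWithinAt)
      (fun t ht => ?_) (fun t ht => ?_) <;> rw [interior_Icc] at ht
    · exact (hf t (Ioo_subset_Icc_self ht)).differentiableAt.differentiableWithinAt
    · rw [(hf t (Ioo_subset_Icc_self ht)).deriv]; exact h t ht
  exact this (left_mem_Icc.2 hab) (right_mem_Icc.2 hab) hab

lemma lt_of_hasDerivAt_pos {f f' : ℝ → ℝ} {a b : ℝ} (hab : a < b)
    (hf : ∀ t ∈ Icc a b, HasDerivAt f (f' t) t) (h : ∀ t ∈ Ioo a b, 0 < f' t) : f a < f b := by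
  have : StrictMonoOn f (Icc a b) := by
    refine strictMonoOn_of_deriv_pos (convex_Icc a b)
      (fun t ht => (hf t ht).continuousAt.continuousWithinAt) (fun t ht => ?_)
    rw [interior_Icc] at ht
    rw [(hf t (Ioo_subset_Icc_self ht)).deriv]; exact h t ht
  exact this (left_mem_Icc.2 hab.le) (right_mem_Icc.2 hab.le) hab

lemma mul_sub_le_of_le_deriv {f f' : ℝ → ℝ} {a b c : ℝ} (hab : a ≤ b)
    (hf : ∀ t ∈ Icc a b, HasDerivAt f (f' t) t) (h : ∀ t ∈ Ioo a b, c ≤ f' t) :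
    c * (b - a) ≤ f b - f a := by
  have := le_of_hasDerivAt_nonneg (f := fun t => f t - c * t) (f' := fun t => f' t - c) hab
    (fun t ht => (hf t ht).sub (by simpa using (hasDerivAt_id t).const_mul c))
    (fun t ht => by linarith [h t ht])
  linarith

lemma sub_le_mul_of_deriv_le {f f' : ℝ → ℝ} {a b c : ℝ} (hab : a ≤ b)
    (hf : ∀ t ∈ Icc a b, HasDerivAt f (f' t) t) (h : ∀ t ∈ Ioo a b, f' t ≤ c) :
    f b - f a ≤ c * (b - a) := by
  have := mul_sub_le_of_le_deriv (f := fun t => -f t) (f' := fun t => -f' t) (c := -c) hab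
    (fun t ht => (hf t ht).neg) (fun t ht => by linarith [h t ht])
  linarith

lemma exists_antideriv {f : ℝ → ℝ} (hf : Continuous f) :
    ∃ F : ℝ → ℝ, F 0 = 0 ∧ ∀ t, HasDerivAt F (f t) t :=
  ⟨fun t => ∫ s in (0 : ℝ)..t, f s, by simp, fun t =>
    intervalIntegral.integral_hasDerivAt_right (hf.intervalIntegrable _ _)
      (hf.stronglyMeasurableAtFilter _ _) hf.continuousAt⟩

/-- Quadratic remainder of a function whose derivative is `1`-Lipschitz at the base point. -/
lemma abs_taylor_le {f f' : ℝ → ℝ} (hf : ∀ x, HasDerivAt f (f' x) x) {a : ℝ}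
    (hL : ∀ x, |f' x - f' a| ≤ |x - a|) (b : ℝ) :
    |f b - f a - f' a * (b - a)| ≤ (b - a) ^ 2 := by
  have h := Convex.norm_image_sub_le_of_norm_hasDerivWithin_le (f := fun x => f x - f' a * x)
    (f' := fun x => f' x - f' a) (s := uIcc a b) (C := |b - a|) (x := a) (y := b)
    (fun x _ => ((hf x).sub (by simpa using (hasDerivAt_id x).const_mul (f' a))).hasDerivWithinAt)
    (fun x hx => (hL x).trans (abs_sub_left_of_mem_uIcc hx)) (convex_uIcc a b)
    left_mem_uIcc right_mem_uIcc
  simp only [Real.norm_eq_abs] at h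
  rw [← abs_mul, ← sq, abs_of_nonneg (sq_nonneg (b - a))] at h
  convert h using 2
  ring

lemma abs_sin_sub_le (x y : ℝ) : |sin x - sin y| ≤ |x - y| := by
  have := Real.abs_sin_sub_sin_le x y
  exact this

lemma abs_cos_sub_le (x y : ℝ) : |cos x - cos y| ≤ |x - y| := by
  have := Real.abs_cos_sub_cos_le x y
  exact this

/-! ### Trajectories and Jacobi fields -/

/-- A motion of the pendulum, with its velocity; the angle is measured from the upside-down
position, so that the equation reads `ÿ = sin y`. -/
structure Traj (y p : ℝ → ℝ) : Prop where
  pos : ∀ t, HasDerivAt y (p t) t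
  vel : ∀ t, HasDerivAt p (sin (y t)) t

/-- A solution, with its derivative, of the equation linearized along `y`. -/
structure Jac (y w w₁ : ℝ → ℝ) : Prop where
  pos : ∀ t, HasDerivAt w (w₁ t) t
  vel : ∀ t, HasDerivAt w₁ (cos (y t) * w t) t

/-- The energy of a pendulum with angle `a` from the top and velocity `v`. -/
noncomputable def energy (a v : ℝ) : ℝ := v ^ 2 / 2 + cos a - 1

lemma Traj.continuous {y p : ℝ → ℝ} (h : Traj y p) : Continuous y :=
  continuous_iff_continuousAt.2 fun t => (h.pos t).continuousAt

lemma Traj.continuous_vel {y p : ℝ → ℝ} (h : Traj y p) : Continuous p :=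
  continuous_iff_continuousAt.2 fun t => (h.vel t).continuousAt

lemma Jac.continuous {y p w : ℝ → ℝ} (h : Jac y w p) : Continuous w :=
  continuous_iff_continuousAt.2 fun t => (h.pos t).continuousAt

lemma eq_of_deriv_zero {f : ℝ → ℝ} (hf : ∀ t, HasDerivAt f 0 t) (s t : ℝ) : f s = f t :=
  is_const_of_deriv_eq_zero (fun t => (hf t).differentiableAt) (fun t => (hf t).deriv) s t

lemma Traj.energy_eq {y p : ℝ → ℝ} (h : Traj y p) (s t : ℝ) :
    energy (y s) (p s) = energy (y t) (p t) := by
  refine eq_of_deriv_zero (f := fun t => energy (y t) (p t)) (fun t => ?_) s t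
  have := ((((h.vel t).pow 2).div_const 2).add ((h.pos t).cos)).sub_const 1
  exact this.congr_deriv (by simp; ring)

/-- Half-angle form of the energy identity. -/
lemma Traj.sq_vel {y p : ℝ → ℝ} (h : Traj y p) (s t : ℝ) :
    p t ^ 2 = 2 * energy (y s) (p s) + 4 * sin (y t / 2) ^ 2 := by
  rw [h.energy_eq s t, energy]
  have := Real.cos_sq' (y t / 2)
  have h2 := Real.cos_two_mul (y t / 2)
  rw [show 2 * (y t / 2) = y t by ring] at h2
  nlinarith

lemma Traj.sq_vel' {y p : ℝ → ℝ} (h : Traj y p) (s t : ℝ) :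
    p t ^ 2 = 2 * (energy (y s) (p s) + 1 - cos (y t)) := by
  rw [h.energy_eq s t, energy]
  ring

lemma Traj.unique {y p y' p' : ℝ → ℝ} (h : Traj y p) (h' : Traj y' p') {t₀ : ℝ}
    (h1 : y t₀ = y' t₀) (h2 : p t₀ = p' t₀) : y = y' ∧ p = p' :=
  secondOrder_unique (g := fun _ x => sin x) (fun _ => abs_sin_sub_le) h.pos h.vel h'.pos h'.vel
    h1 h2

lemma abs_cos_mul_sub_le (y : ℝ → ℝ) (t x x' : ℝ) :
    |cos (y t) * x - cos (y t) * x'| ≤ |x - x'| := by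
  rw [← mul_sub, abs_mul]
  exact mul_le_of_le_one_left (abs_nonneg _) (abs_cos_le_one _)

lemma Jac.unique {y w w₁ x x₁ : ℝ → ℝ} (h : Jac y w w₁) (h' : Jac y x x₁) {t₀ : ℝ}
    (h1 : w t₀ = x t₀) (h2 : w₁ t₀ = x₁ t₀) : w = x ∧ w₁ = x₁ :=
  secondOrder_unique (g := fun t x => cos (y t) * x) (abs_cos_mul_sub_le y) h.pos h.vel h'.pos
    h'.vel h1 h2

theorem exists_jac {y : ℝ → ℝ} (hy : Continuous y) (a b : ℝ) :
    ∃ w w₁, Jac y w w₁ ∧ w 0 = a ∧ w₁ 0 = b := by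
  obtain ⟨w, w₁, h1, h2, h3, h4⟩ := exists_secondOrder (g := fun t x => cos (y t) * x)
    (fun x => by fun_prop) (abs_cos_mul_sub_le y) (fun t => by simp) a b
  exact ⟨w, w₁, ⟨h3, h4⟩, h1, h2⟩

/-- The field with `φ(0) = 0`, `φ'(0) = 1`: the derivative of the motion in its initial velocity. -/
structure JacVel (y φ φ₁ : ℝ → ℝ) : Prop extends Jac y φ φ₁ where
  zero : φ 0 = 0
  one : φ₁ 0 = 1

/-- The field with `ψ(0) = 1`, `ψ'(0) = 0`: the derivative of the motion in its initial position. -/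
structure JacPos (y ψ ψ₁ : ℝ → ℝ) : Prop extends Jac y ψ ψ₁ where
  one : ψ 0 = 1
  zero : ψ₁ 0 = 0

lemma Jac.linear {y w w₁ x x₁ : ℝ → ℝ} (h : Jac y w w₁) (h' : Jac y x x₁) (c d : ℝ) :
    Jac y (fun t => c * w t + d * x t) (fun t => c * w₁ t + d * x₁ t) :=
  ⟨fun t => ((h.pos t).const_mul c).add ((h'.pos t).const_mul d), fun t =>
    (((h.vel t).const_mul c).add ((h'.vel t).const_mul d)).congr_deriv (by ring)⟩

lemma Jac.eq_comb {y w w₁ φ φ₁ ψ ψ₁ : ℝ → ℝ} (h : Jac y w w₁) (hφ : JacVel y φ φ₁)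
    (hψ : JacPos y ψ ψ₁) (t : ℝ) : w t = w 0 * ψ t + w₁ 0 * φ t := by
  have := h.unique (hψ.toJac.linear hφ.toJac (w 0) (w₁ 0)) (t₀ := 0)
    (by simp [hφ.zero, hψ.one]) (by simp [hφ.one, hψ.zero])
  exact congrFun this.1 t

lemma Jac.eq_smul {y w w₁ φ φ₁ : ℝ → ℝ} (h : Jac y w w₁) (hφ : JacVel y φ φ₁) (h0 : w 0 = 0)
    (t : ℝ) : w t = w₁ 0 * φ t := by
  have := h.unique (hφ.toJac.linear hφ.toJac (w₁ 0) 0) (t₀ := 0)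
    (by simp [hφ.zero, h0]) (by simp [hφ.one])
  simpa using congrFun this.1 t

lemma Traj.jac {y p : ℝ → ℝ} (h : Traj y p) : Jac y p (fun t => sin (y t)) :=
  ⟨h.vel, fun t => (h.pos t).sin⟩

lemma Traj.vel_eq {y p φ φ₁ ψ ψ₁ : ℝ → ℝ} (h : Traj y p) (hφ : JacVel y φ φ₁)
    (hψ : JacPos y ψ ψ₁) (t : ℝ) : p t = p 0 * ψ t + sin (y 0) * φ t :=
  h.jac.eq_comb hφ hψ t

lemma Jac.wronskian {y w w₁ x x₁ : ℝ → ℝ} (h : Jac y w w₁) (h' : Jac y x x₁) (s t : ℝ) :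
    w₁ s * x s - w s * x₁ s = w₁ t * x t - w t * x₁ t := by
  refine eq_of_deriv_zero (f := fun t => w₁ t * x t - w t * x₁ t) (fun t => ?_) s t
  exact (((h.vel t).mul (h'.pos t)).sub ((h.pos t).mul (h'.vel t))).congr_deriv (by ring)

lemma JacVel.wronskian {y p φ φ₁ : ℝ → ℝ} (hφ : JacVel y φ φ₁) (h : Traj y p) (t : ℝ) :
    φ₁ t * p t - φ t * sin (y t) = p 0 := by
  rw [hφ.toJac.wronskian h.jac t 0, hφ.zero, hφ.one]; ring

lemma JacVel.wronskian_pos {y φ φ₁ ψ ψ₁ : ℝ → ℝ} (hφ : JacVel y φ φ₁) (hψ : JacPos y ψ ψ₁)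
    (t : ℝ) : φ₁ t * ψ t - φ t * ψ₁ t = 1 := by
  rw [hφ.toJac.wronskian hψ.toJac t 0, hφ.zero, hφ.one, hψ.one]; ring

/-- The quotient `φ / p` has derivative `p(0) / p²`. -/
lemma JacVel.hasDerivAt_div_vel {y p φ φ₁ : ℝ → ℝ} (hφ : JacVel y φ φ₁) (h : Traj y p) {t : ℝ}
    (ht : p t ≠ 0) : HasDerivAt (fun t => φ t / p t) (p 0 / p t ^ 2) t := by
  have := (hφ.pos t).div (h.vel t) ht
  rwa [hφ.wronskian h t] at this

lemma JacVel.hasDerivAt_div {y φ φ₁ ψ ψ₁ : ℝ → ℝ} (hφ : JacVel y φ φ₁) (hψ : JacPos y ψ ψ₁)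
    {t : ℝ} (ht : φ t ≠ 0) : HasDerivAt (fun t => ψ t / φ t) (-(1 / φ t ^ 2)) t := by
  have := (hψ.pos t).div (hφ.pos t) ht
  have h2 := hφ.wronskian_pos hψ t
  refine this.congr_deriv ?_
  rw [← neg_div]
  congr 1
  linarith

/-! ### Symmetries -/

lemma Traj.neg {y p : ℝ → ℝ} (h : Traj y p) : Traj (fun t => -y t) (fun t => -p t) :=
  ⟨fun t => (h.pos t).neg, fun t => by rw [sin_neg]; exact (h.vel t).neg⟩

lemma Traj.shift {y p : ℝ → ℝ} (h : Traj y p) (k : ℤ) : Traj (fun t => y t + 2 * π * k) p :=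
  ⟨fun t => (h.pos t).add_const _, fun t => by
    rw [mul_comm (2 * π), sin_add_int_mul_two_pi]; exact h.vel t⟩

lemma Traj.rev {y p : ℝ → ℝ} (h : Traj y p) (T : ℝ) :
    Traj (fun t => y (T - t)) (fun t => -p (T - t)) :=
  ⟨fun t => (h.pos (T - t)).comp_const_sub T t, fun t =>
    ((h.vel (T - t)).comp_const_sub T t).neg.congr_deriv (neg_neg _)⟩

lemma JacVel.neg {y φ φ₁ : ℝ → ℝ} (h : JacVel y φ φ₁) : JacVel (fun t => -y t) φ φ₁ :=
  ⟨⟨h.pos, fun t => by rw [cos_neg]; exact h.vel t⟩, h.zero, h.one⟩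

lemma JacVel.shift {y φ φ₁ : ℝ → ℝ} (h : JacVel y φ φ₁) (k : ℤ) :
    JacVel (fun t => y t + 2 * π * k) φ φ₁ :=
  ⟨⟨h.pos, fun t => by rw [mul_comm (2 * π), cos_add_int_mul_two_pi]; exact h.vel t⟩, h.zero, h.one⟩

lemma JacPos.neg {y ψ ψ₁ : ℝ → ℝ} (h : JacPos y ψ ψ₁) : JacPos (fun t => -y t) ψ ψ₁ :=
  ⟨⟨h.pos, fun t => by rw [cos_neg]; exact h.vel t⟩, h.one, h.zero⟩

lemma JacPos.shift {y ψ ψ₁ : ℝ → ℝ} (h : JacPos y ψ ψ₁) (k : ℤ) :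
    JacPos (fun t => y t + 2 * π * k) ψ ψ₁ :=
  ⟨⟨h.pos, fun t => by rw [mul_comm (2 * π), cos_add_int_mul_two_pi]; exact h.vel t⟩, h.one, h.zero⟩

lemma exists_jacVel {y : ℝ → ℝ} (hy : Continuous y) : ∃ φ φ₁, JacVel y φ φ₁ := by
  obtain ⟨w, w₁, h, h0, h1⟩ := exists_jac hy 0 1
  exact ⟨w, w₁, h, h0, h1⟩

lemma exists_jacPos {y : ℝ → ℝ} (hy : Continuous y) : ∃ ψ ψ₁, JacPos y ψ ψ₁ := by
  obtain ⟨w, w₁, h, h0, h1⟩ := exists_jac hy 1 0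
  exact ⟨w, w₁, h, h0, h1⟩

/-- The derivative of the end position in the initial velocity is invariant under time reversal. -/
lemma JacVel.rev_eq {y φ φ₁ χ χ₁ : ℝ → ℝ} {T : ℝ} (hφ : JacVel y φ φ₁)
    (hχ : JacVel (fun t => y (T - t)) χ χ₁) : χ T = φ T := by
  have hJ : Jac y (fun t => χ (T - t)) (fun t => -χ₁ (T - t)) :=
    ⟨fun t => (hχ.pos (T - t)).comp_const_sub T t, fun t =>
      ((hχ.vel (T - t)).comp_const_sub T t).neg.congr_deriv (by simp)⟩
  have := hφ.toJac.wronskian hJ 0 T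
  simp only [hφ.zero, hφ.one, sub_zero, sub_self, hχ.zero, hχ.one] at this
  linarith

/-! ### The flow and its derivative -/

theorem exists_traj (a v : ℝ) : ∃ y p : ℝ → ℝ, Traj y p ∧ y 0 = a ∧ p 0 = v := by
  obtain ⟨y, p, h1, h2, h3, h4⟩ := exists_secondOrder (g := fun _ x => sin x)
    (fun x => continuous_const) (fun _ => abs_sin_sub_le) (fun t => by simp) a v
  exact ⟨y, p, ⟨h3, h4⟩, h1, h2⟩

/-- The position at time `t` of the pendulum started at angle `a` with velocity `v`. -/
noncomputable def flowPos (a v : ℝ) : ℝ → ℝ := (exists_traj a v).choose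

/-- The velocity at time `t` of the pendulum started at angle `a` with velocity `v`. -/
noncomputable def flowVel (a v : ℝ) : ℝ → ℝ := (exists_traj a v).choose_spec.choose

lemma traj_flow (a v : ℝ) : Traj (flowPos a v) (flowVel a v) :=
  (exists_traj a v).choose_spec.choose_spec.1

@[simp] lemma flowPos_zero (a v : ℝ) : flowPos a v 0 = a :=
  (exists_traj a v).choose_spec.choose_spec.2.1

@[simp] lemma flowVel_zero (a v : ℝ) : flowVel a v 0 = v :=
  (exists_traj a v).choose_spec.choose_spec.2.2

lemma Traj.eq_flow {y p : ℝ → ℝ} (h : Traj y p) :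
    y = flowPos (y 0) (p 0) ∧ p = flowVel (y 0) (p 0) :=
  h.unique (traj_flow _ _) (t₀ := 0) (by simp) (by simp)

lemma Traj.abs_vel_sub_le {y p : ℝ → ℝ} (h : Traj y p) (s t : ℝ) : |p s - p t| ≤ |s - t| := by
  have := Convex.norm_image_sub_le_of_norm_hasDerivWithin_le (f := p) (s := univ) (C := 1)
    (fun x _ => (h.vel x).hasDerivWithinAt) (fun x _ => by simpa using abs_sin_le_one (y x))
    convex_univ (mem_univ t) (mem_univ s)
  simpa using this

lemma Traj.dist_le {y p y' p' : ℝ → ℝ} (h : Traj y p) (h' : Traj y' p') (t : ℝ) :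
    |y t - y' t| ≤ max |y 0 - y' 0| |p 0 - p' 0| * exp |t| ∧
      |p t - p' t| ≤ max |y 0 - y' 0| |p 0 - p' 0| * exp |t| := by
  rcases le_total 0 t with ht | ht
  · rw [abs_of_nonneg ht]
    exact secondOrder_dist_le (g := fun _ x => sin x) (fun _ => abs_sin_sub_le) h.pos h.vel h'.pos
      h'.vel ht
  · rw [abs_of_nonpos ht]
    have hr := h.rev 0
    have hr' := h'.rev 0
    have := secondOrder_dist_le (g := fun _ x => sin x) (fun _ => abs_sin_sub_le) hr.pos hr.vel
      hr'.pos hr'.vel (t := -t) (by linarith)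
    simp only [zero_sub, sub_self, neg_neg, neg_sub_neg] at this
    rwa [abs_sub_comm (p' 0), abs_sub_comm (p' t)] at this

lemma continuous_of_dist_le {F : ℝ → ℝ → ℝ → ℝ} (hF : ∀ a v, Continuous (F a v))
    (h : ∀ a v a' v' t, |F a v t - F a' v' t| ≤ max |a - a'| |v - v'| * exp |t|) :
    Continuous fun z : ℝ × ℝ × ℝ => F z.1 z.2.1 z.2.2 := by
  refine continuous_iff_continuousAt.2 fun ⟨a, v, t⟩ => ?_
  rw [ContinuousAt, tendsto_iff_dist_tendsto_zero]
  have h1 : Tendsto (fun z : ℝ × ℝ × ℝ => max |z.1 - a| |z.2.1 - v| * exp |z.2.2| +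
      |F a v z.2.2 - F a v t|) (𝓝 (a, v, t)) (𝓝 0) := by
    have hc := hF a v
    have : Continuous fun z : ℝ × ℝ × ℝ => max |z.1 - a| |z.2.1 - v| * exp |z.2.2| +
      |F a v z.2.2 - F a v t| := by fun_prop
    simpa using this.tendsto (a, v, t)
  refine squeeze_zero (fun _ => dist_nonneg) (fun z => ?_) h1
  rw [Real.dist_eq]
  have h2 := h z.1 z.2.1 a v z.2.2
  have h3 := abs_sub_le (F z.1 z.2.1 z.2.2) (F a v z.2.2) (F a v t)
  linarith

theorem continuous_flowPos : Continuous fun z : ℝ × ℝ × ℝ => flowPos z.1 z.2.1 z.2.2 :=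
  continuous_of_dist_le (fun a v => (traj_flow a v).continuous) fun a v a' v' t => by
    simpa using ((traj_flow a v).dist_le (traj_flow a' v') t).1

/-- The Jacobi fields are the derivatives of the flow, with a quadratic error. -/
lemma Traj.linearization_le {y p y' p' φ φ₁ ψ ψ₁ : ℝ → ℝ} (h : Traj y p) (h' : Traj y' p')
    (hφ : JacVel y φ φ₁) (hψ : JacPos y ψ ψ₁) {T : ℝ} (hT : 0 ≤ T) :
    |y' T - y T - ((y' 0 - y 0) * ψ T + (p' 0 - p 0) * φ T)| ≤
      (max |y' 0 - y 0| |p' 0 - p 0|) ^ 2 * exp T ^ 3 := by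
  set δ := max |y' 0 - y 0| |p' 0 - p 0| with hδ
  set a := y' 0 - y 0
  set b := p' 0 - p 0
  have hδ0 : 0 ≤ δ := (abs_nonneg _).trans (le_max_left _ _)
  set r : ℝ → ℝ × ℝ := fun t =>
    (y' t - y t - (a * ψ t + b * φ t), p' t - p t - (a * ψ₁ t + b * φ₁ t)) with hr
  have hJ := hψ.toJac.linear hφ.toJac a b
  have hrd : ∀ t, HasDerivAt r (p' t - p t - (a * ψ₁ t + b * φ₁ t),
      sin (y' t) - sin (y t) - cos (y t) * (a * ψ t + b * φ t)) t := fun t =>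
    (((h'.pos t).sub (h.pos t)).sub (hJ.pos t)).prodMk (((h'.vel t).sub (h.vel t)).sub (hJ.vel t))
  have key := norm_le_gronwallBound_of_norm_deriv_right_le (f := r) (δ := 0) (K := 1)
    (ε := (δ * exp T) ^ 2) (a := 0) (b := T)
    (fun t _ => (hrd t).continuousAt.continuousWithinAt) (fun t _ => (hrd t).hasDerivWithinAt)
    (by simp [hr, a, b, hψ.one, hψ.zero, hφ.one, hφ.zero]) (fun t ht => ?_) T ⟨hT, le_rfl⟩
  · rw [gronwallBound_of_K_ne_0 one_ne_zero] at key
    have h1 : |y' T - y T - (a * ψ T + b * φ T)| ≤ ‖r T‖ := le_max_left _ _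
    refine h1.trans (key.trans ?_)
    have h2 : 0 ≤ (δ * exp T) ^ 2 := by positivity
    simp only [zero_mul, div_one, zero_add, one_mul, sub_zero]
    nlinarith
  · have hd := (h'.dist_le h t).1
    rw [abs_of_nonneg ht.1] at hd
    have he : exp t ≤ exp T := exp_le_exp.2 ht.2.le
    have hd2 : |y' t - y t| ≤ δ * exp T := hd.trans (mul_le_mul_of_nonneg_left he hδ0)
    have h3 := abs_taylor_le (f := sin) (f' := cos) (fun x => hasDerivAt_sin x) (a := y t)
      (fun x => abs_cos_sub_le x (y t)) (y' t)
    have h4 : (y' t - y t) ^ 2 ≤ (δ * exp T) ^ 2 := sq_le_sq' (by linarith [(abs_le.1 hd2).1])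
      (abs_le.1 hd2).2
    rw [one_mul, Prod.norm_def]
    refine max_le ?_ ?_
    · have : ‖p' t - p t - (a * ψ₁ t + b * φ₁ t)‖ ≤ ‖r t‖ := le_max_right _ _
      have h5 : 0 ≤ (δ * exp T) ^ 2 := by positivity
      simp only
      linarith
    · simp only [Real.norm_eq_abs]
      have h6 : |y' t - y t - (a * ψ t + b * φ t)| ≤ ‖r t‖ := le_max_left _ _
      have h7 : |cos (y t) * (y' t - y t - (a * ψ t + b * φ t))| ≤ ‖r t‖ := by
        rw [abs_mul]
        exact (mul_le_of_le_one_left (abs_nonneg _) (abs_cos_le_one _)).trans h6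
      have h8 : sin (y' t) - sin (y t) - cos (y t) * (a * ψ t + b * φ t) =
        cos (y t) * (y' t - y t - (a * ψ t + b * φ t)) +
        (sin (y' t) - sin (y t) - cos (y t) * (y' t - y t)) := by ring
      rw [h8]
      exact (abs_add_le _ _).trans (by linarith)

/-- The flow is differentiable in initial position, initial velocity and (positive) time. -/
theorem hasFDerivAt_flowPos {a v t : ℝ} (ht : 0 < t) {φ φ₁ ψ ψ₁ : ℝ → ℝ}
    (hφ : JacVel (flowPos a v) φ φ₁) (hψ : JacPos (flowPos a v) ψ ψ₁) :
    HasFDerivAt (fun z : ℝ × ℝ × ℝ => flowPos z.1 z.2.1 z.2.2)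
      (ψ t • ContinuousLinearMap.fst ℝ ℝ (ℝ × ℝ) +
        (φ t • (ContinuousLinearMap.fst ℝ ℝ ℝ).comp (ContinuousLinearMap.snd ℝ ℝ (ℝ × ℝ)) +
          flowVel a v t •
            (ContinuousLinearMap.snd ℝ ℝ ℝ).comp (ContinuousLinearMap.snd ℝ ℝ (ℝ × ℝ))))
      (a, v, t) := by
  rw [hasFDerivAt_iff_isLittleO_nhds_zero]
  refine (Asymptotics.IsBigO.of_bound (exp t ^ 3 + exp t + 1) (g := fun h : ℝ × ℝ × ℝ => ‖h‖ ^ 2)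
    (Eventually.of_forall fun h => ?_)).trans_isLittleO
      (Asymptotics.isLittleO_norm_pow_id one_lt_two)
  obtain ⟨h, k, s⟩ := h
  have hh : |h| ≤ ‖(h, k, s)‖ := le_max_left _ _
  have hk : |k| ≤ ‖(h, k, s)‖ := (le_max_left |k| |s|).trans (le_max_right _ _)
  have hs : |s| ≤ ‖(h, k, s)‖ := (le_max_right |k| |s|).trans (le_max_right _ _)
  set n := ‖(h, k, s)‖ with hn
  have hn0 : 0 ≤ n := norm_nonneg _
  set Y := flowPos (a + h) (v + k)
  set P := flowVel (a + h) (v + k)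
  have hT : Traj Y P := traj_flow _ _
  have h1 := abs_taylor_le hT.pos (a := t) (fun x => hT.abs_vel_sub_le x t) (t + s)
  have h2 := (traj_flow a v).linearization_le hT hφ hψ ht.le
  have h3 := (hT.dist_le (traj_flow a v) t).2
  have e1 : Y 0 = a + h := flowPos_zero _ _
  have e2 : P 0 = v + k := flowVel_zero _ _
  rw [e1, e2, flowPos_zero, flowVel_zero, add_sub_cancel_left, add_sub_cancel_left] at h2 h3
  rw [abs_of_pos ht] at h3
  rw [add_sub_cancel_left] at h1
  have hm : max |h| |k| ≤ n := max_le hh hk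
  have hm0 : 0 ≤ max |h| |k| := (abs_nonneg h).trans (le_max_left _ _)
  have h4 : |Y (t + s) - flowPos a v t - (ψ t * h + (φ t * k + flowVel a v t * s))| ≤
      (exp t ^ 3 + exp t + 1) * n ^ 2 := by
    have e : Y (t + s) - flowPos a v t - (ψ t * h + (φ t * k + flowVel a v t * s)) =
      (Y (t + s) - Y t - P t * s) + (Y t - flowPos a v t - (h * ψ t + k * φ t)) +
        s * (P t - flowVel a v t) := by ring
    have h5 : |s * (P t - flowVel a v t)| ≤ n * (n * exp t) := by
      rw [abs_mul]
      exact mul_le_mul hs (h3.trans (mul_le_mul_of_nonneg_right hm (exp_pos t).le)) (abs_nonneg _)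
        hn0
    have h6 : s ^ 2 ≤ n ^ 2 := by rw [← sq_abs]; gcongr
    have h7 : max |h| |k| ^ 2 * exp t ^ 3 ≤ n ^ 2 * exp t ^ 3 := by gcongr
    rw [e]
    refine (abs_add_three _ _ _).trans ?_
    linarith
  simpa [abs_of_nonneg hn0] using h4

/-! ### A priori facts about a motion -/

/-- The slowness `1 / ẏ` of a pendulum of energy `E` at the angle `x` from the top. -/
noncomputable def slowness (E x : ℝ) : ℝ := (√(2 * (E + 1 - cos x)))⁻¹

/-- The facts about a confined motion on `[0, T]` from which everything about the connections is
deduced. Here `φ T` and `ψ T` are the derivatives of the end position in the initial velocity and in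
the initial position; `-p(0) p(T) / φ(T)` is the derivative of the energy in the travel time with
fixed end points. -/
structure GoodPath (y p : ℝ → ℝ) (T : ℝ) : Prop where
  jac_pos : ∀ φ φ₁, JacVel y φ φ₁ → 0 < φ T
  energy_slope_le : ∀ φ φ₁, JacVel y φ φ₁ →
    -(T * (p 0 * p T)) ≤ (-2 * energy (y 0) (p 0) + 13 / 20) * φ T
  energy_slope_le_of_pos : 0 < energy (y 0) (p 0) → ∀ φ φ₁, JacVel y φ φ₁ →
    -(T * (p 0 * p T)) ≤ -2 * energy (y 0) (p 0) * φ T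
  energy_ge : -1 / 2 ≤ energy (y 0) (p 0)
  time_mul_vel_le : 1 / 5 ≤ T → energy (y 0) (p 0) ≤ 5 / 2 → ∀ φ φ₁, JacVel y φ φ₁ →
    T * |p T| ≤ 100 * φ T
  jacPos_le : 1 / 5 ≤ T → energy (y 0) (p 0) ≤ 5 / 2 → ∀ φ φ₁ ψ ψ₁, JacVel y φ φ₁ → JacPos y ψ ψ₁ →
    |ψ T| ≤ 100 * φ T
  time_eq : 0 < energy (y 0) (p 0) → T = |∫ x in y 0..y T, slowness (energy (y 0) (p 0)) x|
  dist_le : energy (y 0) (p 0) ≤ 0 → |y T - y 0| ≤ 2 * π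
  neg_energy_mul_le : -(energy (y 0) (p 0) * T) ≤ 100

lemma energy_neg (a v : ℝ) : energy (-a) (-v) = energy a v := by simp [energy]

lemma energy_neg_right (a v : ℝ) : energy a (-v) = energy a v := by simp [energy]

lemma energy_shift (a v : ℝ) (k : ℤ) : energy (a + 2 * π * k) v = energy a v := by
  unfold energy; rw [mul_comm (2 * π), cos_add_int_mul_two_pi]

lemma slowness_neg (E x : ℝ) : slowness E (-x) = slowness E x := by simp [slowness]

lemma slowness_periodic (E : ℝ) : Function.Periodic (slowness E) (2 * π) := fun x => by
  simp [slowness]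

lemma GoodPath.neg {y p : ℝ → ℝ} {T : ℝ} (h : GoodPath y p T) :
    GoodPath (fun t => -y t) (fun t => -p t) T := by
  have hJ : ∀ {φ φ₁ : ℝ → ℝ}, JacVel (fun t => -y t) φ φ₁ → JacVel y φ φ₁ := fun h => by
    simpa using h.neg
  have hJ' : ∀ {φ φ₁ : ℝ → ℝ}, JacPos (fun t => -y t) φ φ₁ → JacPos y φ φ₁ := fun h => by
    simpa using h.neg
  constructor <;> try simp only [energy_neg, abs_neg, neg_mul_neg]
  · exact fun φ φ₁ hφ => h.jac_pos φ φ₁ (hJ hφ)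
  · exact fun φ φ₁ hφ => h.energy_slope_le φ φ₁ (hJ hφ)
  · exact fun hE φ φ₁ hφ => h.energy_slope_le_of_pos hE φ φ₁ (hJ hφ)
  · exact h.energy_ge
  · exact fun hT hE φ φ₁ hφ => h.time_mul_vel_le hT hE φ φ₁ (hJ hφ)
  · exact fun hT hE φ φ₁ ψ ψ₁ hφ hψ => h.jacPos_le hT hE φ φ₁ ψ ψ₁ (hJ hφ) (hJ' hψ)
  · intro hE
    refine (h.time_eq hE).trans ?_
    have := intervalIntegral.integral_comp_neg (a := y 0) (b := y T)
      (slowness (energy (y 0) (p 0)))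
    simp only [slowness_neg] at this
    rw [this, intervalIntegral.integral_symm, abs_neg]
  · intro hE
    rw [neg_sub_neg, abs_sub_comm]
    exact h.dist_le hE
  · exact h.neg_energy_mul_le

lemma GoodPath.shift {y p : ℝ → ℝ} {T : ℝ} (h : GoodPath y p T) (k : ℤ) :
    GoodPath (fun t => y t + 2 * π * k) p T := by
  have hJ : ∀ {φ φ₁ : ℝ → ℝ}, JacVel (fun t => y t + 2 * π * k) φ φ₁ → JacVel y φ φ₁ := fun h => by
    simpa using h.shift (-k)
  have hJ' : ∀ {φ φ₁ : ℝ → ℝ}, JacPos (fun t => y t + 2 * π * k) φ φ₁ → JacPos y φ φ₁ :=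
    fun h => by simpa using h.shift (-k)
  constructor <;> try simp only [energy_shift]
  · exact fun φ φ₁ hφ => h.jac_pos φ φ₁ (hJ hφ)
  · exact fun φ φ₁ hφ => h.energy_slope_le φ φ₁ (hJ hφ)
  · exact fun hE φ φ₁ hφ => h.energy_slope_le_of_pos hE φ φ₁ (hJ hφ)
  · exact h.energy_ge
  · exact fun hT hE φ φ₁ hφ => h.time_mul_vel_le hT hE φ φ₁ (hJ hφ)
  · exact fun hT hE φ φ₁ ψ ψ₁ hφ hψ => h.jacPos_le hT hE φ φ₁ ψ ψ₁ (hJ hφ) (hJ' hψ)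
  · intro hE
    refine (h.time_eq hE).trans ?_
    have := intervalIntegral.integral_comp_add_right (a := y 0) (b := y T)
      (slowness (energy (y 0) (p 0))) (2 * π * k)
    rw [← this]
    congr 1
    refine intervalIntegral.integral_congr fun x _ => ?_
    simp [slowness, mul_comm (2 * π)]
  · intro hE
    simpa using h.dist_le hE
  · exact h.neg_energy_mul_le

/-- As long as `φ` stays positive, `ψ / φ` decreases; hence it is bounded by its value at a fixed
small time. -/
lemma jacPos_le_of_pos {y φ φ₁ ψ ψ₁ : ℝ → ℝ} {T : ℝ} (hT : 1 / 5 ≤ T)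
    (hφ : JacVel y φ φ₁)
    (hψ : JacPos y ψ ψ₁) (hpos : ∀ t ∈ Ioc 0 T, 0 < φ t) : ψ T ≤ 10 * φ T := by
  have h0 : Jac y (fun _ => 0) (fun _ => 0) :=
    ⟨fun t => hasDerivAt_const _ _, fun t => by simpa using hasDerivAt_const t (0 : ℝ)⟩
  have he : exp (1 / 5) ≤ 5 / 4 := by
    have := Real.exp_bound' (x := 1 / 5) (by norm_num) (by norm_num) (n := 2) (by norm_num)
    norm_num [Finset.sum_range_succ, Nat.factorial] at this ⊢
    linarith
  have hb : ∀ t ∈ Icc (0 : ℝ) (1 / 5), exp t ≤ 5 / 4 := fun t ht =>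
    (exp_le_exp.2 ht.2).trans he
  have hd := fun {w w₁ : ℝ → ℝ} (hw : Jac y w w₁) {t : ℝ} (ht : 0 ≤ t) =>
    secondOrder_dist_le (g := fun t x => cos (y t) * x) (abs_cos_mul_sub_le y) hw.pos hw.vel
      h0.pos h0.vel ht
  have hφb : ∀ t ∈ Icc (0 : ℝ) (1 / 5), |φ t| ≤ 5 / 4 := fun t ht => by
    have := (hd hφ.toJac ht.1).1
    simp only [hφ.zero, hφ.one, sub_zero] at this
    norm_num at this
    exact this.trans (hb t ht)
  have hψb : ψ (1 / 5) ≤ 5 / 4 := by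
    have := (hd hψ.toJac (t := 1 / 5) (by norm_num)).1
    simp only [hψ.zero, hψ.one, sub_zero] at this
    norm_num at this
    norm_num at he ⊢
    exact (le_abs_self _).trans (this.trans he)
  have hφ1 : ∀ t ∈ Icc (0 : ℝ) (1 / 5), 3 / 4 ≤ φ₁ t := fun t ht => by
    have := mul_sub_le_of_le_deriv (f := φ₁) (c := -(5 / 4)) ht.1 (fun s _ => hφ.vel s)
      (fun s hs => by
        have h1 := hφb s ⟨hs.1.le, hs.2.le.trans ht.2⟩
        have h2 : |cos (y s) * φ s| ≤ 5 / 4 := by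
          rw [abs_mul]
          exact (mul_le_of_le_one_left (abs_nonneg _) (abs_cos_le_one _)).trans h1
        exact (abs_le.1 h2).1)
    rw [hφ.one] at this
    linarith [ht.2]
  have hφ5 : 3 / 20 ≤ φ (1 / 5) := by
    have := mul_sub_le_of_le_deriv (f := φ) (a := 0) (b := 1 / 5) (c := 3 / 4) (by norm_num)
      (fun s _ => hφ.pos s) (fun s hs => hφ1 s (Ioo_subset_Icc_self hs))
    rw [hφ.zero] at this
    linarith
  have hm := le_of_hasDerivAt_nonneg (f := fun t => -(ψ t / φ t)) (f' := fun t => -(-(1 / φ t ^ 2)))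
    hT (fun t ht => (hφ.hasDerivAt_div hψ (hpos t ⟨by linarith [ht.1], ht.2⟩).ne').neg)
    (fun t _ => by rw [neg_neg]; positivity)
  have hTpos : 0 < φ T := hpos T ⟨by linarith, le_rfl⟩
  have h1 : ψ (1 / 5) / φ (1 / 5) ≤ 10 := by
    rw [div_le_iff₀ (by linarith)]
    linarith
  have h2 : ψ T / φ T ≤ 10 := by linarith
  rwa [div_le_iff₀ hTpos] at h2

/-! ### Rotating motions -/

section Rotation

variable {y p : ℝ → ℝ} {T : ℝ}

lemma Traj.sq_vel_ge (h : Traj y p) (t : ℝ) : 2 * energy (y 0) (p 0) ≤ p t ^ 2 := by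
  rw [h.sq_vel 0 t]
  nlinarith [sq_nonneg (sin (y t / 2))]

lemma Traj.sq_vel_le (h : Traj y p) (t : ℝ) : p t ^ 2 ≤ 2 * energy (y 0) (p 0) + 4 := by
  rw [h.sq_vel 0 t]
  nlinarith [sin_sq_le_one (y t / 2)]

lemma Traj.abs_vel_le_three (h : Traj y p) (hE : energy (y 0) (p 0) ≤ 5 / 2) (t : ℝ) :
    |p t| ≤ 3 := by
  have := h.sq_vel_le t
  exact abs_le_of_sq_le_sq (by linarith) (by norm_num)

lemma Traj.vel_pos_of_rotation (h : Traj y p) (hE : 0 < energy (y 0) (p 0)) {s : ℝ} (hs : 0 < p s)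
    (t : ℝ) : 0 < p t := by
  by_contra hc
  obtain ⟨r, -, hr⟩ := intermediate_value_uIcc (f := p) (a := t) (b := s)
    h.continuous_vel.continuousOn
    (show (0 : ℝ) ∈ uIcc (p t) (p s) from mem_uIcc_of_le (not_lt.1 hc) hs.le)
  have := h.sq_vel_ge r
  rw [hr] at this
  norm_num at this
  linarith

lemma slowness_continuous {E : ℝ} (hE : 0 < E) : Continuous (slowness E) := by
  unfold slowness
  refine Continuous.inv₀ (by fun_prop) fun x => ?_
  have := cos_le_one x
  exact (Real.sqrt_pos.2 (by linarith)).ne'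

lemma slowness_pos {E : ℝ} (hE : 0 < E) (x : ℝ) : 0 < slowness E x := by
  have := cos_le_one x
  exact inv_pos.2 (Real.sqrt_pos.2 (by linarith))

lemma slowness_le {E : ℝ} (hE : 0 < E) (x : ℝ) : slowness E x ≤ (√(2 * E))⁻¹ := by
  have := cos_le_one x
  exact inv_anti₀ (Real.sqrt_pos.2 (by linarith)) (Real.sqrt_le_sqrt (by linarith))

lemma Traj.slowness_eq (h : Traj y p) {t : ℝ} (hp : 0 < p t) :
    slowness (energy (y 0) (p 0)) (y t) = (p t)⁻¹ := by
  rw [slowness, ← h.sq_vel' 0 t, Real.sqrt_sq hp.le]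

lemma Traj.integral_slowness (h : Traj y p) (hE : 0 < energy (y 0) (p 0)) (hp : ∀ t, 0 < p t) :
    ∫ x in y 0..y T, slowness (energy (y 0) (p 0)) x = T := by
  set g := slowness (energy (y 0) (p 0))
  have hg : Continuous g := slowness_continuous hE
  have hd : ∀ t, HasDerivAt (fun t => (∫ x in y 0..y t, g x) - t) 0 t := fun t => by
    have h1 := intervalIntegral.integral_hasDerivAt_right (hg.intervalIntegrable (y 0) (y t))
      (hg.stronglyMeasurableAtFilter _ _) hg.continuousAt
    refine ((h1.comp t (h.pos t)).sub (hasDerivAt_id t)).congr_deriv ?_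
    simp only [g]
    rw [h.slowness_eq (hp t), inv_mul_cancel₀ (hp t).ne', sub_self]
  have := eq_of_deriv_zero hd T 0
  simp at this
  linarith

lemma JacVel.div_vel_eq {φ φ₁ : ℝ → ℝ} (hφ : JacVel y φ φ₁) (h : Traj y p)
    (hE : 0 < energy (y 0) (p 0)) (hp : ∀ t, 0 < p t) :
    p 0 * ∫ x in y 0..y T, slowness (energy (y 0) (p 0)) x ^ 3 = φ T / p T := by
  set g := slowness (energy (y 0) (p 0)) with hgdef
  have hg : Continuous fun x => g x ^ 3 := (slowness_continuous hE).pow 3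
  have hd : ∀ t, HasDerivAt (fun t => p 0 * (∫ x in y 0..y t, g x ^ 3) - φ t / p t) 0 t :=
      fun t => by
    have h1 := intervalIntegral.integral_hasDerivAt_right (hg.intervalIntegrable (y 0) (y t))
      (hg.stronglyMeasurableAtFilter _ _) hg.continuousAt
    refine (((h1.comp t (h.pos t)).const_mul (p 0)).sub
      (hφ.hasDerivAt_div_vel h (hp t).ne')).congr_deriv ?_
    rw [hgdef, h.slowness_eq (hp t)]
    field_simp [(hp t).ne']
    ring
  have := eq_of_deriv_zero hd T 0
  simp [hφ.zero] at this
  linarith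

lemma integral_le_of_periodic {g : ℝ → ℝ} (hg : Continuous g) (h0 : ∀ x, 0 ≤ g x)
    (hP : Function.Periodic g (2 * π)) {a b : ℝ} (n : ℕ) (hab : a ≤ b) (hb : b - a ≤ 2 * π * n) :
    ∫ x in a..b, g x ≤ n * ∫ x in (0 : ℝ)..2 * π, g x := by
  have h1 := hP.intervalIntegral_add_zsmul_eq n a (fun t₁ t₂ => hg.intervalIntegrable _ _)
  have h2 : ∫ x in a..b, g x ≤ ∫ x in a..a + (n : ℤ) • (2 * π), g x := by
    refine intervalIntegral.integral_mono_interval le_rfl hab ?_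
      (Eventually.of_forall h0) (hg.intervalIntegrable _ _)
    simp; linarith
  rw [h1, hP.intervalIntegral_add_eq a 0] at h2
  simpa using h2

lemma le_integral_of_periodic {g : ℝ → ℝ} (hg : Continuous g) (h0 : ∀ x, 0 ≤ g x)
    (hP : Function.Periodic g (2 * π)) {a b : ℝ} (n : ℕ) (hb : 2 * π * n ≤ b - a) :
    n * ∫ x in (0 : ℝ)..2 * π, g x ≤ ∫ x in a..b, g x := by
  have h1 := hP.intervalIntegral_add_zsmul_eq n a (fun t₁ t₂ => hg.intervalIntegrable _ _)
  have h2 : ∫ x in a..a + (n : ℤ) • (2 * π), g x ≤ ∫ x in a..b, g x := by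
    refine intervalIntegral.integral_mono_interval le_rfl ?_ ?_
      (Eventually.of_forall h0) (hg.intervalIntegrable _ _)
    · simp; positivity
    · simp; linarith
  rw [h1, hP.intervalIntegral_add_eq a 0] at h2
  simpa using h2

/-- After at least one full turn, `φ / ẏ` is at least proportional to the time: both the time per
turn and the gain of `φ / ẏ` per turn are governed by the passage over the top. -/
lemma time_mul_vel_le_of_turn (h : Traj y p) (hE : 0 < energy (y 0) (p 0))
    (hE' : energy (y 0) (p 0) ≤ 5 / 2)
    (hp : ∀ t, 0 < p t) (hD : 2 * π ≤ y T - y 0) {φ φ₁ : ℝ → ℝ} (hφ : JacVel y φ φ₁) :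
    T * p T ≤ 100 * φ T := by
  have hT := h.integral_slowness (T := T) hE hp
  have hJ := hφ.div_vel_eq (T := T) h hE hp
  have hp0 := h.sq_vel_ge 0
  set E := energy (y 0) (p 0) with hEdef
  set e := √(2 * E) with he
  have he0 : 0 < e := Real.sqrt_pos.2 (by linarith)
  have hesq : e ^ 2 = 2 * E := Real.sq_sqrt (by linarith)
  have he3 : e ≤ 3 := by nlinarith
  have hep : e ≤ p 0 := by
    rw [he]; exact (Real.sqrt_le_left (hp 0).le).2 hp0
  have hπ := pi_gt_three
  have hπ4 := pi_lt_d2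
  obtain ⟨n, hn1, hn2⟩ : ∃ n : ℕ, 2 * π * (n + 1 : ℕ) ≤ y T - y 0 ∧
      y T - y 0 ≤ 2 * π * (n + 2 : ℕ) := by
    have h1 : 1 ≤ (y T - y 0) / (2 * π) := by rwa [le_div_iff₀ (by positivity), one_mul]
    have h2 : 1 ≤ ⌊(y T - y 0) / (2 * π)⌋₊ := Nat.le_floor (by simpa using h1)
    obtain ⟨n, hn⟩ := Nat.exists_eq_add_of_le' h2
    refine ⟨n, ?_, ?_⟩
    · have := Nat.floor_le (show 0 ≤ (y T - y 0) / (2 * π) by linarith)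
      rw [hn, le_div_iff₀ (by positivity)] at this
      linarith
    · have := Nat.lt_floor_add_one ((y T - y 0) / (2 * π))
      rw [hn, div_lt_iff₀ (by positivity)] at this
      push_cast at this ⊢
      linarith
  have hTle := integral_le_of_periodic (slowness_continuous hE) (fun x => (slowness_pos hE x).le)
    (slowness_periodic E) (a := y 0) (b := y T) (n + 2) (by nlinarith) hn2
  have hJge := le_integral_of_periodic ((slowness_continuous hE).pow 3)
    (fun x => (pow_pos (slowness_pos hE x) 3).le) (fun x => by
      simp only [Pi.pow_apply, slowness_periodic E x]) (a := y 0) (b := y T) (n + 1) hn1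
  simp only [Pi.pow_apply] at hJge
  have hP : ∫ x in (0 : ℝ)..2 * π, slowness E x ≤ 2 * π * e⁻¹ := by
    have := intervalIntegral.integral_mono_on (μ := MeasureTheory.volume) (a := 0) (b := 2 * π)
      (by positivity) ((slowness_continuous hE).intervalIntegrable _ _) (g := fun _ => e⁻¹)
      (continuous_const.intervalIntegrable _ _)
      (fun x _ => slowness_le hE x)
    simpa using this
  have hQ : 1 / (3 * e ^ 2) ≤ ∫ x in (0 : ℝ)..2 * π, slowness E x ^ 3 := by
    have h1 : ∫ x in (0 : ℝ)..e, slowness E x ^ 3 ≤ ∫ x in (0 : ℝ)..2 * π, slowness E x ^ 3 :=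
      intervalIntegral.integral_mono_interval le_rfl he0.le (by linarith)
        (Eventually.of_forall fun x => (pow_pos (slowness_pos hE x) 3).le)
        (((slowness_continuous hE).pow 3).intervalIntegrable _ _)
    have h2 := intervalIntegral.integral_mono_on (μ := MeasureTheory.volume) (a := 0) (b := e)
      (f := fun _ => 1 / (3 * e ^ 3))
      (g := fun x => slowness E x ^ 3) he0.le
      (continuous_const.intervalIntegrable _ _)
      (((slowness_continuous hE).pow 3).intervalIntegrable _ _)
      (fun x hx => by
        have h3 : 2 * (E + 1 - cos x) ≤ 2 * e ^ 2 := by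
          have := Real.one_sub_sq_div_two_le_cos (x := x)
          nlinarith [hx.1, hx.2]
        have h4 : √(2 * (E + 1 - cos x)) ^ 2 = 2 * (E + 1 - cos x) :=
          Real.sq_sqrt (by linarith [cos_le_one x])
        have h5 : 0 < √(2 * (E + 1 - cos x)) := Real.sqrt_pos.2 (by linarith [cos_le_one x])
        have h6 : √(2 * (E + 1 - cos x)) ≤ 3 / 2 * e := by
          refine (le_abs_self _).trans (abs_le_of_sq_le_sq ?_ (by positivity))
          rw [h4]; nlinarith
        rw [slowness, inv_pow, one_div]
        refine inv_anti₀ (by positivity) ?_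
        have h7 : √(2 * (E + 1 - cos x)) ^ 3 =
            √(2 * (E + 1 - cos x)) ^ 2 * √(2 * (E + 1 - cos x)) := by
          ring
        rw [h7, h4]
        calc 2 * (E + 1 - cos x) * √(2 * (E + 1 - cos x)) ≤ 2 * e ^ 2 * (3 / 2 * e) := by
              gcongr
          _ = 3 * e ^ 3 := by ring)
    rw [intervalIntegral.integral_const, smul_eq_mul, sub_zero] at h2
    refine le_trans (le_of_eq ?_) (h2.trans h1)
    field_simp
  have hn0 : (0 : ℝ) ≤ n := Nat.cast_nonneg n
  have h1 : T ≤ (n + 2) * (2 * π * e⁻¹) := by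
    rw [hT] at hTle
    refine hTle.trans ?_
    push_cast
    gcongr
  have h2 : (n + 1) / (3 * e) ≤ φ T / p T := by
    rw [← hJ]
    have := (hp 0).le
    calc (n + 1) / (3 * e) = e * ((n + 1) * (1 / (3 * e ^ 2))) := by field_simp
      _ ≤ p 0 * ((n + 1) * ∫ x in (0 : ℝ)..2 * π, slowness E x ^ 3) := by gcongr
      _ ≤ _ := by
        refine mul_le_mul_of_nonneg_left ?_ (hp 0).le
        push_cast at hJge
        exact hJge
  rw [div_le_div_iff₀ (by positivity) (hp T)] at h2
  have h3 : T * e ≤ (n + 2) * (2 * π) := by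
    calc T * e ≤ (n + 2) * (2 * π * e⁻¹) * e := by gcongr
      _ = _ := by field_simp
  have h4 : T * p T * e ≤ (n + 2) * (2 * π) * p T := by nlinarith [hp T]
  have h5 : (n + 2) * (2 * π) * p T ≤ 100 * φ T * e := by
    have : (n + 2) * (2 * π) ≤ 33 * (n + 1 : ℝ) := by nlinarith
    nlinarith [hp T]
  have h6 : T * p T * e ≤ 100 * φ T * e := h4.trans h5
  exact le_of_mul_le_mul_right h6 he0

lemma time_mul_vel_le_of_fast (h : Traj y p) (hT : 0 ≤ T)
    (hE' : energy (y 0) (p 0) ≤ 5 / 2)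
    (hp : ∀ t, 0 < p t) (hp0 : 1 ≤ p 0) {φ φ₁ : ℝ → ℝ} (hφ : JacVel y φ φ₁) :
    T * p T ≤ 100 * φ T := by
  have := mul_sub_le_of_le_deriv (f := fun t => φ t / p t) (c := 1 / 9) hT
    (fun t _ => hφ.hasDerivAt_div_vel h (hp t).ne') (fun t _ => by
      have h1 := h.abs_vel_le_three hE' t
      rw [abs_of_pos (hp t)] at h1
      have h2 : p t ^ 2 ≤ 9 := by nlinarith [hp t]
      exact div_le_div₀ (by linarith) hp0 (pow_pos (hp t) 2) h2)
  rw [hφ.zero, zero_div, sub_zero, sub_zero] at this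
  have h3 : 1 / 9 * T * p T ≤ φ T := by
    rwa [le_div_iff₀ (hp T)] at this
  nlinarith [mul_nonneg hT (hp T).le]

lemma JacVel.pos_of_rotation {φ φ₁ : ℝ → ℝ} (hφ : JacVel y φ φ₁) (h : Traj y p)
    (hp : ∀ t, 0 < p t) {t : ℝ} (ht : 0 < t) : 0 < φ t := by
  have := lt_of_hasDerivAt_pos (f := fun t => φ t / p t) ht
    (fun t _ => hφ.hasDerivAt_div_vel h (hp t).ne') (fun t _ => by
      have := hp t
      have := hp 0
      positivity)
  rw [hφ.zero, zero_div] at this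
  exact (div_pos_iff_of_pos_right (hp t)).1 this

lemma goodPath_of_rotation_of_pos (h : Traj y p) (hT : 0 < T) (hE : 0 < energy (y 0) (p 0))
    (h0 : 0 < p 0)
    (h3 : 1 / 5 ≤ T → energy (y 0) (p 0) ≤ 5 / 2 → ∀ φ φ₁, JacVel y φ φ₁ → T * |p T| ≤ 100 * φ T) :
    GoodPath y p T := by
  have hp := h.vel_pos_of_rotation hE h0
  have hslope : ∀ φ φ₁, JacVel y φ φ₁ →
      -(T * (p 0 * p T)) ≤ -2 * energy (y 0) (p 0) * φ T := fun φ φ₁ hφ => by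
    have := sub_le_mul_of_deriv_le (f := fun t => φ t / p t)
      (c := p 0 / (2 * energy (y 0) (p 0))) hT.le
      (fun t _ => hφ.hasDerivAt_div_vel h (hp t).ne') (fun t _ =>
        div_le_div_of_nonneg_left h0.le (by linarith) (h.sq_vel_ge t))
    rw [hφ.zero, zero_div, sub_zero, sub_zero, div_le_iff₀ (hp T), div_mul_eq_mul_div,
      div_mul_eq_mul_div, le_div_iff₀ (by linarith)] at this
    linarith
  refine ⟨fun φ φ₁ hφ => hφ.pos_of_rotation h hp hT, fun φ φ₁ hφ => ?_, fun _ => hslope,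
    by linarith, h3, fun hT5 _ φ φ₁ ψ ψ₁ hφ hψ => ?_, fun _ => ?_, fun hE' => by linarith,
    by nlinarith⟩
  · have h1 := hslope φ φ₁ hφ
    have h2 := hφ.pos_of_rotation h hp hT
    linarith
  · have h1 := jacPos_le_of_pos hT5 hφ hψ
      (fun t ht => hφ.pos_of_rotation h hp ht.1)
    have h2 := hφ.pos_of_rotation h hp hT
    have h4 := h.vel_eq hφ hψ T
    -- `|sin α| ≤ 2 |sin (α / 2)| ≤ p 0`
    have h5 : |sin (y 0)| ≤ p 0 := by
      apply abs_le_of_sq_le_sq _ h0.le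
      have h6 := h.sq_vel 0 0
      have h7 := Real.sin_two_mul (y 0 / 2)
      rw [show 2 * (y 0 / 2) = y 0 by ring] at h7
      rw [h7, h6]
      nlinarith [sin_sq_add_cos_sq (y 0 / 2), sq_nonneg (sin (y 0 / 2)), sq_nonneg (cos (y 0 / 2)),
        sq_nonneg (sin (y 0 / 2) ^ 2)]
    have h8 : -(p 0 * φ T) ≤ p 0 * ψ T := by
      have := (abs_le.1 h5).2
      nlinarith [hp T]
    have h9 : -φ T ≤ ψ T := by nlinarith
    rw [abs_le]
    constructor <;> linarith
  · rw [h.integral_slowness hE hp, abs_of_pos hT]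

/-- Every motion of positive energy is good, provided the bound on `T ẏ(T) / φ(T)` is known. -/
lemma goodPath_of_rotation (h : Traj y p) (hT : 0 < T) (hE : 0 < energy (y 0) (p 0))
    (h3 : 1 / 5 ≤ T → energy (y 0) (p 0) ≤ 5 / 2 → ∀ φ φ₁, JacVel y φ φ₁ → T * |p T| ≤ 100 * φ T) :
    GoodPath y p T := by
  rcases lt_trichotomy (p 0) 0 with h0 | h0 | h0
  · have := goodPath_of_rotation_of_pos h.neg hT (by simpa [energy_neg] using hE) (by linarith)
      (fun h1 h2 φ φ₁ hφ => by
        have := h3 h1 (by simpa [energy_neg] using h2) φ φ₁ (by simpa using hφ.neg)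
        simpa using this)
    simpa using this.neg
  · have := h.sq_vel_ge 0
    rw [h0] at this hE
    norm_num at this
    linarith
  · exact goodPath_of_rotation_of_pos h hT hE h0 h3

end Rotation

/-- A motion of positive energy that makes a full turn or starts with speed at least `1` is good. -/
lemma goodPath_of_turn {y p : ℝ → ℝ} {T : ℝ} (h : Traj y p) (hT : 0 < T)
    (hE : 0 < energy (y 0) (p 0)) (hD : 2 * π ≤ |y T - y 0| ∨ 1 ≤ |p 0|) : GoodPath y p T := by
  refine goodPath_of_rotation h hT hE fun _ hE' φ φ₁ hφ => ?_
  have key : ∀ {y p : ℝ → ℝ}, Traj y p → 0 < energy (y 0) (p 0) → energy (y 0) (p 0) ≤ 5 / 2 →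
      (2 * π ≤ |y T - y 0| ∨ 1 ≤ |p 0|) → 0 < p 0 → JacVel y φ φ₁ → T * |p T| ≤ 100 * φ T := by
    intro y p h hE hE' hD h0 hφ
    have hp := h.vel_pos_of_rotation hE h0
    have hm := le_of_hasDerivAt_nonneg hT.le (fun t _ => h.pos t) (fun t _ => (hp t).le)
    rw [abs_of_pos (hp T)]
    rw [abs_of_pos h0, abs_of_nonneg (by linarith)] at hD
    rcases hD with hD | hD
    · exact time_mul_vel_le_of_turn h hE hE' hp hD hφ
    · exact time_mul_vel_le_of_fast h hT.le hE' hp hD hφ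
  rcases lt_trichotomy (p 0) 0 with h0 | h0 | h0
  · have := key h.neg (by simpa [energy_neg] using hE) (by simpa [energy_neg] using hE')
      (by rwa [neg_sub_neg, abs_neg, abs_sub_comm]) (by linarith) hφ.neg
    simpa using this
  · have := h.sq_vel_ge 0
    rw [h0] at this hE
    norm_num at this
    linarith
  · exact key h hE hE' hD h0 hφ

/-! ### Numerical bounds for sine and cosine -/

lemma sin_taylor_three {x : ℝ} (hx : 0 ≤ x) : x - x ^ 3 / 6 ≤ sin x := by
  have := le_of_hasDerivAt_nonneg (f := fun x => sin x - (x - x ^ 3 / 6))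
    (f' := fun x => cos x - (1 - x ^ 2 / 2)) hx
    (fun t _ => ((hasDerivAt_sin t).sub ((hasDerivAt_id t).sub
      ((hasDerivAt_pow 3 t).div_const 6))).congr_deriv (by simp; ring))
    (fun t _ => by linarith [Real.one_sub_sq_div_two_le_cos (x := t)])
  simp at this; linarith

lemma cos_taylor_four {x : ℝ} (hx : 0 ≤ x) : cos x ≤ 1 - x ^ 2 / 2 + x ^ 4 / 24 := by
  have := le_of_hasDerivAt_nonneg (f := fun x => (1 - x ^ 2 / 2 + x ^ 4 / 24) - cos x)
    (f' := fun x => sin x - (x - x ^ 3 / 6)) hx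
    (fun t _ => ((((hasDerivAt_const t (1 : ℝ)).sub ((hasDerivAt_pow 2 t).div_const 2)).add
      ((hasDerivAt_pow 4 t).div_const 24)).sub (hasDerivAt_cos t)).congr_deriv (by simp; ring))
    (fun t ht => by linarith [sin_taylor_three ht.1.le])
  simp at this; linarith

lemma sin_taylor_five {x : ℝ} (hx : 0 ≤ x) : sin x ≤ x - x ^ 3 / 6 + x ^ 5 / 120 := by
  have := le_of_hasDerivAt_nonneg (f := fun x => (x - x ^ 3 / 6 + x ^ 5 / 120) - sin x)
    (f' := fun x => (1 - x ^ 2 / 2 + x ^ 4 / 24) - cos x) hx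
    (fun t _ => ((((hasDerivAt_id t).sub ((hasDerivAt_pow 3 t).div_const 6)).add
      ((hasDerivAt_pow 5 t).div_const 120)).sub (hasDerivAt_sin t)).congr_deriv (by simp; ring))
    (fun t ht => by linarith [cos_taylor_four ht.1.le])
  simp at this; linarith

lemma cos_taylor_six {x : ℝ} (hx : 0 ≤ x) :
    1 - x ^ 2 / 2 + x ^ 4 / 24 - x ^ 6 / 720 ≤ cos x := by
  have := le_of_hasDerivAt_nonneg
    (f := fun x => cos x - (1 - x ^ 2 / 2 + x ^ 4 / 24 - x ^ 6 / 720))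
    (f' := fun x => (x - x ^ 3 / 6 + x ^ 5 / 120) - sin x) hx
    (fun t _ => ((hasDerivAt_cos t).sub ((((hasDerivAt_const t (1 : ℝ)).sub
      ((hasDerivAt_pow 2 t).div_const 2)).add ((hasDerivAt_pow 4 t).div_const 24)).sub
      ((hasDerivAt_pow 6 t).div_const 720))).congr_deriv (by simp; ring))
    (fun t ht => by linarith [sin_taylor_five ht.1.le])
  simp at this; linarith

lemma sin_taylor_seven {x : ℝ} (hx : 0 ≤ x) :
    x - x ^ 3 / 6 + x ^ 5 / 120 - x ^ 7 / 5040 ≤ sin x := by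
  have := le_of_hasDerivAt_nonneg
    (f := fun x => sin x - (x - x ^ 3 / 6 + x ^ 5 / 120 - x ^ 7 / 5040))
    (f' := fun x => cos x - (1 - x ^ 2 / 2 + x ^ 4 / 24 - x ^ 6 / 720)) hx
    (fun t _ => ((hasDerivAt_sin t).sub ((((hasDerivAt_id t).sub
      ((hasDerivAt_pow 3 t).div_const 6)).add ((hasDerivAt_pow 5 t).div_const 120)).sub
      ((hasDerivAt_pow 7 t).div_const 5040))).congr_deriv (by simp; ring))
    (fun t ht => by linarith [cos_taylor_six ht.1.le])
  simp at this; linarith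

lemma cos_one_ge : 0.5402 ≤ cos 1 := by
  have := cos_taylor_six (zero_le_one' ℝ); norm_num at this ⊢; linarith

lemma sin_one_ge : 0.8414 ≤ sin 1 := by
  have := sin_taylor_seven (zero_le_one' ℝ); norm_num at this ⊢; linarith

lemma sin_one_le' : sin 1 ≤ 0.8417 := by
  have := sin_taylor_five (zero_le_one' ℝ); norm_num at this ⊢; linarith

lemma cos_half_ge : 0.8775 ≤ cos (1 / 2) := by
  have := cos_taylor_six (x := 1 / 2) (by norm_num); norm_num at this ⊢; linarith

lemma sin_half_le : sin (1 / 2) ≤ 0.4795 := by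
  have := sin_taylor_five (x := 1 / 2) (by norm_num); norm_num at this ⊢; linarith

lemma cos_ge_cos_one {x : ℝ} (hx : |x| ≤ 1) : 0.5402 ≤ cos x := by
  rw [← cos_abs]
  refine cos_one_ge.trans (cos_le_cos_of_nonneg_of_le_pi (abs_nonneg x) ?_ hx)
  linarith [pi_gt_three]

lemma abs_sin_le_sin_one {x : ℝ} (hx : |x| ≤ 1) : |sin x| ≤ 0.8417 := by
  have hπ := pi_gt_three
  have h := abs_le.1 hx
  have h1 : sin x ≤ sin 1 := sin_le_sin_of_le_of_le_pi_div_two (by linarith) (by linarith) h.2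
  have h2 : sin (-1) ≤ sin x := sin_le_sin_of_le_of_le_pi_div_two (by linarith) (by linarith) h.1
  rw [sin_neg] at h2
  rw [abs_le]
  constructor <;> linarith [sin_one_le']

/-! ### Motions near the top -/

/-- Where `cos y ≥ c ≥ 0`, Jacobi fields grow at least like those of a free particle. -/
lemma JacVel.ge_of_cos_nonneg {y φ φ₁ : ℝ → ℝ} (hφ : JacVel y φ φ₁) {T c : ℝ} (hc : 0 ≤ c)
    (h : ∀ t ∈ Icc 0 T, c ≤ cos (y t)) {t : ℝ} (ht : t ∈ Icc 0 T) :
    1 ≤ φ₁ t ∧ t + c * t ^ 3 / 6 ≤ φ t := by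
  have hcos : ∀ t ∈ Icc 0 T, 0 ≤ cos (y t) := fun t ht => hc.trans (h t ht)
  have hprod : ∀ t ∈ Icc 0 T, 0 ≤ φ t * φ₁ t := fun t ht => by
    have := le_of_hasDerivAt_nonneg (f := fun t => φ t * φ₁ t)
      (f' := fun t => φ₁ t * φ₁ t + φ t * (cos (y t) * φ t)) ht.1
      (fun s _ => (hφ.pos s).mul (hφ.vel s)) (fun s hs => by
        have := hcos s ⟨hs.1.le, hs.2.le.trans ht.2⟩
        nlinarith [mul_self_nonneg (φ₁ s), mul_nonneg this (mul_self_nonneg (φ s))])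
    simpa [hφ.zero] using this
  have hsq : ∀ t ∈ Icc 0 T, 1 ≤ φ₁ t ^ 2 := fun t ht => by
    have := le_of_hasDerivAt_nonneg (f := fun t => φ₁ t ^ 2) ht.1
      (fun s _ => (hφ.vel s).pow 2) (fun s hs => by
        have h1 := hcos s ⟨hs.1.le, hs.2.le.trans ht.2⟩
        have h2 := hprod s ⟨hs.1.le, hs.2.le.trans ht.2⟩
        have := mul_nonneg h1 h2
        simp; linarith)
    simpa [hφ.one] using this
  have hφ1 : ∀ t ∈ Icc 0 T, 1 ≤ φ₁ t := fun t ht => by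
    by_contra hlt
    have hneg : φ₁ t ≤ 0 := by
      by_contra hpos
      nlinarith [hsq t ht]
    obtain ⟨r, hr, hr0⟩ := intermediate_value_Icc' (f := φ₁) ht.1
      (fun s _ => (hφ.vel s).continuousAt.continuousWithinAt)
      (show (0 : ℝ) ∈ Icc (φ₁ t) (φ₁ 0) from ⟨hneg, by rw [hφ.one]; norm_num⟩)
    have := hsq r ⟨hr.1, hr.2.trans ht.2⟩
    rw [hr0] at this
    norm_num at this
  have hφ0 : ∀ t ∈ Icc 0 T, t ≤ φ t := fun t ht => by
    have := mul_sub_le_of_le_deriv (f := φ) (c := 1) ht.1 (fun s _ => hφ.pos s)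
      (fun s hs => hφ1 s ⟨hs.1.le, hs.2.le.trans ht.2⟩)
    rw [hφ.zero] at this
    linarith
  have hφ2 : ∀ t ∈ Icc 0 T, 1 + c * t ^ 2 / 2 ≤ φ₁ t := fun t ht => by
    have := le_of_hasDerivAt_nonneg (f := fun t => φ₁ t - c * t ^ 2 / 2)
      (f' := fun t => cos (y t) * φ t - c * t) ht.1
      (fun s _ => (hφ.vel s).sub ((((hasDerivAt_pow 2 s).const_mul c).div_const 2).congr_deriv
        (by simp; ring))) (fun s hs => by
        have hs' : s ∈ Icc 0 T := ⟨hs.1.le, hs.2.le.trans ht.2⟩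
        have := mul_le_mul (h s hs') (hφ0 s hs') hs.1.le (hcos s hs')
        linarith)
    simp [hφ.one] at this
    linarith
  refine ⟨hφ1 t ht, ?_⟩
  have := le_of_hasDerivAt_nonneg (f := fun t => φ t - (t + c * t ^ 3 / 6))
    (f' := fun t => φ₁ t - (1 + c * t ^ 2 / 2)) ht.1
    (fun s _ => (hφ.pos s).sub (((hasDerivAt_id s).add
      (((hasDerivAt_pow 3 s).const_mul c).div_const 6)).congr_deriv
      (by simp; ring))) (fun s hs => by
      linarith [hφ2 s ⟨hs.1.le, hs.2.le.trans ht.2⟩])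
  simp [hφ.zero] at this
  linarith

lemma JacPos.ge_one_of_cos_nonneg {y ψ ψ₁ : ℝ → ℝ} (hψ : JacPos y ψ ψ₁) {T : ℝ}
    (h : ∀ t ∈ Icc 0 T, 0 ≤ cos (y t)) {t : ℝ} (ht : t ∈ Icc 0 T) : 1 ≤ ψ t := by
  have hprod : ∀ t ∈ Icc 0 T, 0 ≤ ψ t * ψ₁ t := fun t ht => by
    have := le_of_hasDerivAt_nonneg (f := fun t => ψ t * ψ₁ t)
      (f' := fun t => ψ₁ t * ψ₁ t + ψ t * (cos (y t) * ψ t)) ht.1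
      (fun s _ => (hψ.pos s).mul (hψ.vel s)) (fun s hs => by
        have := h s ⟨hs.1.le, hs.2.le.trans ht.2⟩
        nlinarith [mul_self_nonneg (ψ₁ s), mul_nonneg this (mul_self_nonneg (ψ s))])
    simpa [hψ.zero] using this
  have hsq : ∀ t ∈ Icc 0 T, 1 ≤ ψ t ^ 2 := fun t ht => by
    have := le_of_hasDerivAt_nonneg (f := fun t => ψ t ^ 2) ht.1
      (fun s _ => (hψ.pos s).pow 2) (fun s hs => by
        have h2 := hprod s ⟨hs.1.le, hs.2.le.trans ht.2⟩
        simp; linarith)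
    simpa [hψ.one] using this
  by_contra hlt
  have hneg : ψ t ≤ 0 := by
    by_contra hpos
    nlinarith [hsq t ht]
  obtain ⟨r, hr, hr0⟩ := intermediate_value_Icc' (f := ψ) ht.1
    (fun s _ => (hψ.pos s).continuousAt.continuousWithinAt)
    (show (0 : ℝ) ∈ Icc (ψ t) (ψ 0) from ⟨hneg, by rw [hψ.one]; norm_num⟩)
  have := hsq r ⟨hr.1, hr.2.trans ht.2⟩
  rw [hr0] at this
  norm_num at this

lemma half_sq_le_mul_sin {x : ℝ} (hx : |x| ≤ π / 2) : x ^ 2 / 2 ≤ x * sin x := by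
  have key : ∀ x : ℝ, 0 ≤ x → x ≤ π / 2 → x ^ 2 / 2 ≤ x * sin x := fun x h0 h1 => by
    have h2 := Real.mul_le_sin h0 h1
    have h3 : 1 / 2 ≤ 2 / π := by
      rw [div_le_div_iff₀ (by norm_num) pi_pos]; linarith [pi_lt_d2]
    have h4 : 1 / 2 * x ≤ sin x := (mul_le_mul_of_nonneg_right h3 h0).trans h2
    nlinarith
  have := key |x| (abs_nonneg x) hx
  rcases abs_cases x with h | h <;> rw [h.1] at this <;> simpa [sin_neg] using this

/-- A motion of nonpositive energy above the horizontal: `(y ẏ)' ≥ -E`. -/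
lemma Traj.neg_energy_mul_le {y p : ℝ → ℝ} (h : Traj y p) {T : ℝ} (hT : 0 ≤ T)
    (hy : ∀ t ∈ Icc 0 T, |y t| ≤ π / 2) :
    -(energy (y 0) (p 0) * T) ≤ y T * p T - y 0 * p 0 := by
  have := mul_sub_le_of_le_deriv (f := fun t => y t * p t) (c := -energy (y 0) (p 0)) hT
    (fun t _ => (h.pos t).mul (h.vel t)) (fun t ht => by
      have h1 := half_sq_le_mul_sin (hy t (Ioo_subset_Icc_self ht))
      have h2 := Real.one_sub_sq_div_two_le_cos (x := y t)
      have h3 := h.sq_vel' 0 t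
      nlinarith [sq_nonneg (p t)])
  linarith

theorem goodPath_near_top {y p : ℝ → ℝ} {T : ℝ} (h : Traj y p) (hT : 0 < T)
    (hy : ∀ t ∈ Icc 0 T, |y t| ≤ 1) : GoodPath y p T := by
  have hcos : ∀ t ∈ Icc 0 T, 0.5402 ≤ cos (y t) := fun t ht => cos_ge_cos_one (hy t ht)
  have h0T : (0 : ℝ) ∈ Icc 0 T := ⟨le_rfl, hT.le⟩
  have hTT : T ∈ Icc 0 T := ⟨hT.le, le_rfl⟩
  have hφT : ∀ φ φ₁, JacVel y φ φ₁ → ∀ t ∈ Icc 0 T, t + 0.5402 * t ^ 3 / 6 ≤ φ t :=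
    fun φ φ₁ hφ t ht => (hφ.ge_of_cos_nonneg (by norm_num) hcos ht).2
  have hφt : ∀ φ φ₁, JacVel y φ φ₁ → ∀ t ∈ Icc 0 T, t ≤ φ t := fun φ φ₁ hφ t ht => by
    have := hφT φ φ₁ hφ t ht
    have := pow_nonneg ht.1 3
    linarith
  have h3 : 1 / 5 ≤ T → energy (y 0) (p 0) ≤ 5 / 2 → ∀ φ φ₁, JacVel y φ φ₁ →
      T * |p T| ≤ 100 * φ T := fun _ hE φ φ₁ hφ => by
    have h1 := h.abs_vel_le_three hE T
    have h2 := hφt φ φ₁ hφ T hTT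
    nlinarith [abs_nonneg (p T)]
  rcases lt_or_ge 0 (energy (y 0) (p 0)) with hE | hE
  · exact goodPath_of_rotation h hT hE h3
  have hEge : -1 / 2 ≤ energy (y 0) (p 0) := by
    have := hcos 0 h0T
    unfold energy
    nlinarith [sq_nonneg (p 0)]
  have hsq : ∀ t ∈ Icc 0 T, p t ^ 2 ≤ 0.9196 := fun t ht => by
    rw [h.sq_vel' 0 t]
    linarith [hcos t ht]
  refine ⟨fun φ φ₁ hφ => hT.trans_le (hφt φ φ₁ hφ T hTT), fun φ φ₁ hφ => ?_,
    fun hE' => absurd hE' hE.not_gt, hEge, h3, fun hT5 _ φ φ₁ ψ ψ₁ hφ hψ => ?_,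
    fun hE' => absurd hE' hE.not_gt, fun _ => ?_, ?_⟩
  · have hφ' := hφT φ φ₁ hφ T hTT
    have hφpos := hT.trans_le (hφt φ φ₁ hφ T hTT)
    have h1 : -(p 0 * p T) ≤ 0.9196 := by
      nlinarith [hsq 0 h0T, hsq T hTT, sq_nonneg (p 0 + p T)]
    -- `p(T) - p(0)` is the integral of `sin y`
    have h2 : -(p 0 * p T) ≤ 0.1773 * T ^ 2 := by
      have ha := mul_sub_le_of_le_deriv (f := p) (c := -0.8417) hT.le (fun t _ => h.vel t)
        (fun t ht => (abs_le.1 (abs_sin_le_sin_one (hy t (Ioo_subset_Icc_self ht)))).1)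
      have hb := sub_le_mul_of_deriv_le (f := p) (c := 0.8417) hT.le (fun t _ => h.vel t)
        (fun t ht => (abs_le.1 (abs_sin_le_sin_one (hy t (Ioo_subset_Icc_self ht)))).2)
      rw [sub_zero] at ha hb
      nlinarith [sq_nonneg (p 0 + p T)]
    have h4 : -(T * (p 0 * p T)) ≤ 13 / 20 * φ T := by
      rcases le_total (T ^ 2) 4.8 with hs | hs
      · have : T * -(p 0 * p T) ≤ T * (0.1773 * T ^ 2) := mul_le_mul_of_nonneg_left h2 hT.le
        have : T * (0.1773 * T ^ 2) ≤ T * (13 / 20 * (1 + 0.09 * T ^ 2)) :=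
          mul_le_mul_of_nonneg_left (by nlinarith) hT.le
        nlinarith [pow_pos hT 3]
      · have : T * -(p 0 * p T) ≤ T * 0.9196 := mul_le_mul_of_nonneg_left h1 hT.le
        have : T * 0.9196 ≤ T * (13 / 20 * (1 + 0.09 * T ^ 2)) :=
          mul_le_mul_of_nonneg_left (by nlinarith) hT.le
        nlinarith [pow_pos hT 3]
    nlinarith
  · have h1 := jacPos_le_of_pos hT5 hφ hψ
      (fun t ht => ht.1.trans_le (hφt φ φ₁ hφ t ⟨ht.1.le, ht.2⟩))
    have h2 := hψ.ge_one_of_cos_nonneg (fun t ht => by linarith [hcos t ht]) hTT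
    have := hφt φ φ₁ hφ T hTT
    rw [abs_le]
    constructor <;> linarith
  · have h1 := abs_le.1 (hy 0 h0T)
    have h2 := abs_le.1 (hy T hTT)
    rw [abs_le]
    have := pi_gt_three
    constructor <;> linarith
  · have h1 := h.neg_energy_mul_le hT.le (fun t ht => (hy t ht).trans (by linarith [pi_gt_three]))
    have h2 : ∀ t ∈ Icc 0 T, |y t * p t| ≤ 1 := fun t ht => by
      rw [abs_mul]
      exact mul_le_one₀ (hy t ht) (abs_nonneg _) (abs_le_of_sq_le_sq (by linarith [hsq t ht])
        zero_le_one)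
    have h4 := abs_le.1 (h2 0 h0T)
    have h5 := abs_le.1 (h2 T hTT)
    linarith

/-! ### From the top to the bottom -/

lemma cos_lt_cos_one {x : ℝ} (h1 : 1 < x) (h2 : x ≤ π + 1) : cos x < cos 1 := by
  rcases le_total x π with h3 | h3
  · exact cos_lt_cos_of_nonneg_of_le_pi zero_le_one h3 h1
  · have := cos_nonpos_of_pi_div_two_le_of_le (x := x) (by linarith [pi_pos])
      (by linarith [pi_gt_three])
    linarith [cos_one_ge]

lemma cos_one_le_energy {a v : ℝ} (h0 : |a| ≤ 1) :
    cos 1 ≤ cos a ∧ cos 1 ≤ energy a v + 1 := by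
  have h1 : cos 1 ≤ cos a := by
    rw [← cos_abs a]
    exact cos_le_cos_of_nonneg_of_le_pi (abs_nonneg _) (by linarith [pi_gt_three]) h0
  refine ⟨h1, ?_⟩
  unfold energy
  nlinarith [sq_nonneg v]

/-- A motion that starts near the top has no turning point between the angles `1` and `π + 1`. -/
lemma Traj.vel_ne_zero {y p : ℝ → ℝ} (h : Traj y p) (h0 : |y 0| ≤ 1) {t : ℝ} (h1 : 1 < y t)
    (h2 : y t ≤ π + 1) : p t ≠ 0 := by
  intro hp
  have := h.sq_vel' 0 t
  rw [hp] at this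
  linarith [(cos_one_le_energy (v := p 0) h0).2, cos_lt_cos_one h1 h2]

lemma Traj.vel_nonneg_of_max {y p : ℝ → ℝ} (h : Traj y p) {t : ℝ} (ht : 0 < t)
    (hmax : ∀ x ∈ Icc 0 t, y x ≤ y t) : 0 ≤ p t := by
  by_contra! hneg
  have hev : ∀ᶠ x in 𝓝[<] t, y t < y x := by
    have h2 := (hasDerivAt_iff_tendsto_slope.1 (h.pos t)).mono_left
      (nhdsWithin_mono t fun x (hx : x < t) => hx.ne)
    have h3 := h2.eventually (gt_mem_nhds hneg)
    filter_upwards [h3, self_mem_nhdsWithin] with x hx hxt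
    rw [slope_def_field, div_lt_iff_of_neg (by simpa using hxt)] at hx
    linarith
  have hev2 : ∀ᶠ x in 𝓝[<] t, 0 ≤ x :=
    (eventually_nhdsWithin_of_eventually_nhds (lt_mem_nhds ht)).mono fun x hx => le_of_lt hx
  obtain ⟨x, ⟨hx1, hx2⟩, hx3⟩ := ((hev.and hev2).and self_mem_nhdsWithin).exists
  have : y x ≤ y t := hmax x ⟨hx2, le_of_lt hx3⟩
  linarith

/-- A motion on `[0, T]` from near the top to near the bottom `π`, confined to `[-1, π + 1]`. -/
structure TopDown (y p : ℝ → ℝ) (T : ℝ) : Prop where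
  traj : Traj y p
  time_pos : 0 < T
  start : |y 0| ≤ 1
  finish : |y T - π| ≤ 1
  mem : ∀ t ∈ Icc 0 T, y t ∈ Icc (-1) (π + 1)

namespace TopDown

variable {y p : ℝ → ℝ} {T : ℝ}

lemma cos_one_le_cos_start (h : TopDown y p T) : cos 1 ≤ cos (y 0) :=
  (cos_one_le_energy (v := 0) h.start).1

lemma cos_one_le (h : TopDown y p T) : cos 1 ≤ energy (y 0) (p 0) + 1 :=
  (cos_one_le_energy h.start).2

lemma energy_ge (h : TopDown y p T) : -0.46 ≤ energy (y 0) (p 0) := by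
  linarith [h.cos_one_le, cos_one_ge]

lemma cos_lt (h : TopDown y p T) {t : ℝ} (ht : t ∈ Icc 0 T) (h1 : 1 < y t) :
    cos (y t) < cos 1 := cos_lt_cos_one h1 (h.mem t ht).2

lemma vel_ne_zero (h : TopDown y p T) {t : ℝ} (ht : t ∈ Icc 0 T) (h1 : 1 < y t) : p t ≠ 0 :=
  h.traj.vel_ne_zero h.start h1 (h.mem t ht).2

/-- Beyond the angle `1` the velocity does not vanish, so the maximum of the angle over `[0, t]` is
attained at the end. -/
lemma isMax (h : TopDown y p T) {s t : ℝ} (hs : 0 ≤ s) (hst : s ≤ t) (ht : t ≤ T)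
    (h1 : 1 < y s) : y s ≤ y t ∧ 0 < p t := by
  have h0t : 0 ≤ t := hs.trans hst
  obtain ⟨r, hr, hmax⟩ := isCompact_Icc.exists_isMaxOn (nonempty_Icc.2 h0t)
    h.traj.continuous.continuousOn
  have hsr : y s ≤ y r := hmax ⟨hs, hst⟩
  have hr0 : 0 < r := by
    rcases hr.1.eq_or_lt with h2 | h2
    · rw [← h2] at hsr
      linarith [(abs_le.1 h.start).2]
    · exact h2
  have hrt : r = t := by
    by_contra hne
    have hlt := lt_of_le_of_ne hr.2 hne
    have hloc : IsLocalMax y r := hmax.isLocalMax (Icc_mem_nhds hr0 hlt)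
    exact h.vel_ne_zero ⟨hr0.le, hr.2.trans ht⟩ (by linarith)
      (hloc.hasDerivAt_eq_zero (h.traj.pos r))
  rw [hrt] at hsr hmax hr0
  exact ⟨hsr, lt_of_le_of_ne (h.traj.vel_nonneg_of_max hr0 fun x hx => hmax hx)
    (h.vel_ne_zero ⟨h0t, ht⟩ (by linarith)).symm⟩

lemma stop_gt (h : TopDown y p T) : 2 < y T := by
  linarith [(abs_le.1 h.finish).1, pi_gt_three]

lemma vel_pos_end (h : TopDown y p T) : 0 < p T :=
  (h.isMax h.time_pos.le le_rfl le_rfl (by linarith [h.stop_gt])).2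

lemma exists_time (h : TopDown y p T) {c : ℝ} (hc : 1 < c) (hc' : c ≤ y T) :
    ∃ s ∈ Ioc 0 T, y s = c ∧ (∀ t ∈ Icc 0 s, y t ≤ c) ∧ ∀ t ∈ Icc s T, c ≤ y t ∧ 0 < p t := by
  obtain ⟨s, hs, hys⟩ := intermediate_value_Icc h.time_pos.le h.traj.continuous.continuousOn
    (show c ∈ Icc (y 0) (y T) from ⟨by linarith [(abs_le.1 h.start).2], hc'⟩)
  refine ⟨s, ⟨lt_of_le_of_ne hs.1 ?_, hs.2⟩, hys, fun t ht => ?_, fun t ht => ?_⟩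
  · rintro rfl
    linarith [(abs_le.1 h.start).2]
  · by_contra! hlt
    have := (h.isMax ht.1 ht.2 hs.2 (by linarith)).1
    linarith
  · have := h.isMax hs.1 ht.1 ht.2 (by linarith)
    rwa [hys] at this

lemma cos_nonpos (h : TopDown y p T) {t : ℝ} (ht : t ∈ Icc 0 T) (hy : π / 2 ≤ y t) :
    cos (y t) ≤ 0 :=
  cos_nonpos_of_pi_div_two_le_of_le hy (by linarith [(h.mem t ht).2, pi_gt_three])

lemma vel_ge (h : TopDown y p T) {t : ℝ} (ht : t ∈ Icc 0 T) (hy : π / 2 ≤ y t) (hp : 0 < p t) :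
    1.03 ≤ p t := by
  have h1 := h.traj.sq_vel' 0 t
  have h2 := h.cos_nonpos ht hy
  nlinarith [h.energy_ge]

/-- The time `s` at which the motion passes the horizontal. -/
lemma exists_horizontal (h : TopDown y p T) : ∃ s ∈ Ioc 0 T, y s = π / 2 ∧
    (∀ t ∈ Icc 0 s, |y t| ≤ π / 2) ∧ (∀ t ∈ Icc s T, π / 2 ≤ y t ∧ 1.03 ≤ p t) ∧
    T - s ≤ 2.5 := by
  obtain ⟨s, hs, hys, h1, h2⟩ := h.exists_time (c := π / 2) (by linarith [pi_gt_three])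
    (by linarith [(abs_le.1 h.finish).1, pi_gt_three])
  have h3 : ∀ t ∈ Icc s T, π / 2 ≤ y t ∧ 1.03 ≤ p t := fun t ht =>
    ⟨(h2 t ht).1, h.vel_ge ⟨hs.1.le.trans ht.1, ht.2⟩ (h2 t ht).1 (h2 t ht).2⟩
  refine ⟨s, hs, hys, fun t ht => ?_, h3, ?_⟩
  · have := (h.mem t ⟨ht.1, ht.2.trans hs.2⟩).1
    exact abs_le.2 ⟨by linarith [pi_gt_three], h1 t ht⟩
  · have := mul_sub_le_of_le_deriv (f := y) (c := 1.03) hs.2 (fun t _ => h.traj.pos t)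
      (fun t ht => (h3 t (Ioo_subset_Icc_self ht)).2)
    have h4 := (h.mem T ⟨h.time_pos.le, le_rfl⟩).2
    linarith [pi_lt_d2]

lemma dist_le (h : TopDown y p T) : |y T - y 0| ≤ 2 * π := by
  have h1 := abs_le.1 h.start
  have h2 := abs_le.1 h.finish
  rw [abs_le]
  constructor <;> linarith [pi_gt_three]

lemma neg_energy_mul_le (h : TopDown y p T) (hE : energy (y 0) (p 0) ≤ 0) :
    -(energy (y 0) (p 0) * T) ≤ 100 := by
  obtain ⟨s, hs, hys, h1, h2, h3⟩ := h.exists_horizontal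
  have h4 := h.traj.neg_energy_mul_le hs.1.le h1
  have hv := fun t => abs_le.1 (h.traj.abs_vel_le_three (by linarith) t)
  have h5 : y s * p s ≤ 6 := by
    rw [hys]; nlinarith [(hv s).2, pi_lt_d2, (h2 s ⟨le_rfl, hs.2⟩).2]
  have h6 : -(y 0 * p 0) ≤ 3 := by
    have : |y 0 * p 0| ≤ 1 * 3 := by
      rw [abs_mul]
      exact mul_le_mul h.start (h.traj.abs_vel_le_three (by linarith) 0) (abs_nonneg _) zero_le_one
    linarith [(abs_le.1 this).1]
  nlinarith [h.energy_ge]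

lemma time_horizontal_ge (h : TopDown y p T) (hE : energy (y 0) (p 0) ≤ 5 / 2) {s : ℝ} (hs : 0 ≤ s)
    (hys : y s = π / 2) : 0.19 ≤ s := by
  have := sub_le_mul_of_deriv_le (f := y) (c := 3) hs (fun t _ => h.traj.pos t)
    (fun t _ => (abs_le.1 (h.traj.abs_vel_le_three hE t)).2)
  rw [hys] at this
  linarith [(abs_le.1 h.start).2, pi_gt_d2]

/-! #### Nonnegative initial velocity -/

/-- For a nonnegative initial velocity, `φ` grows at least linearly up to the horizontal position
(time `s`), and from there on `φ / ẏ` and the speed both increase. -/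
lemma jac_ge_of_nonneg (h : TopDown y p T) (hv : 0 ≤ p 0) {φ φ₁ : ℝ → ℝ} (hφ : JacVel y φ φ₁)
    {s : ℝ} (hs : s ∈ Ioc 0 T) (hys : y s = π / 2) (h1 : ∀ t ∈ Icc 0 s, |y t| ≤ π / 2)
    (h2 : ∀ t ∈ Icc s T, π / 2 ≤ y t ∧ 1.03 ≤ p t) :
    (∀ t ∈ Icc 0 s, t ≤ φ t) ∧ ∀ t ∈ Icc s T, s ≤ φ t := by
  have h3 : ∀ t ∈ Icc 0 s, t ≤ φ t := fun t ht => by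
    have := (hφ.ge_of_cos_nonneg le_rfl (fun t ht => cos_nonneg_of_mem_Icc
      ⟨(abs_le.1 (h1 t ht)).1, (abs_le.1 (h1 t ht)).2⟩) ht).2
    linarith
  refine ⟨h3, fun t ht => ?_⟩
  have h4 := le_of_hasDerivAt_nonneg (f := fun t => φ t / p t) ht.1
    (fun r hr => hφ.hasDerivAt_div_vel h.traj (by
      have := (h2 r ⟨hr.1, hr.2.trans ht.2⟩).2
      linarith)) (fun r _ => by positivity)
  have hps := (h2 s ⟨le_rfl, hs.2⟩).2
  have hpt := (h2 t ht).2
  have h5 : p s ≤ p t := by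
    have a1 := h.traj.sq_vel' 0 s
    have a2 := h.traj.sq_vel' 0 t
    rw [hys, cos_pi_div_two] at a1
    have := h.cos_nonpos ⟨hs.1.le.trans ht.1, ht.2⟩ (h2 t ht).1
    exact abs_le_of_sq_le_sq' (by linarith) (by linarith) |>.2
  have h6 := h3 s ⟨hs.1.le, le_rfl⟩
  rw [div_le_div_iff₀ (by linarith) (by linarith)] at h4
  have h7 : s * p s ≤ φ t * p s := by
    have : s * p s ≤ φ s * p t := mul_le_mul h6 h5 (by linarith) (hs.1.le.trans h6)
    linarith
  exact le_of_mul_le_mul_right h7 (by linarith)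

lemma bounds_of_nonneg (h : TopDown y p T) (hv : 0 ≤ p 0) (hE : energy (y 0) (p 0) ≤ 5 / 2)
    {φ φ₁ : ℝ → ℝ} (hφ : JacVel y φ φ₁) : T ≤ 33 * φ T ∧ 0.19 ≤ φ T := by
  obtain ⟨s, hs, hys, h1, h2, h3⟩ := h.exists_horizontal
  have h4 := h.time_horizontal_ge hE hs.1.le hys
  have h5 := (h.jac_ge_of_nonneg hv hφ hs hys h1 h2).2 T ⟨hs.2, le_rfl⟩
  constructor <;> linarith

lemma time_mul_vel_le_of_bounds (h : TopDown y p T) (hE : energy (y 0) (p 0) ≤ 5 / 2) {c : ℝ}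
    (hb : T ≤ 33 * c) : T * |p T| ≤ 100 * c := by
  have := h.traj.abs_vel_le_three hE T
  nlinarith [h.time_pos, abs_nonneg (p T)]

lemma goodPath_of_nonneg (h : TopDown y p T) (hv : 0 ≤ p 0) : GoodPath y p T := by
  have h3 : 1 / 5 ≤ T → energy (y 0) (p 0) ≤ 5 / 2 → ∀ φ φ₁, JacVel y φ φ₁ →
      T * |p T| ≤ 100 * φ T := fun _ hE φ φ₁ hφ =>
    h.time_mul_vel_le_of_bounds hE (h.bounds_of_nonneg hv hE hφ).1
  rcases lt_or_ge 0 (energy (y 0) (p 0)) with hE | hE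
  · exact goodPath_of_rotation h.traj h.time_pos hE h3
  obtain ⟨s, hs, hys, h1, h2, h4⟩ := h.exists_horizontal
  have hs19 := h.time_horizontal_ge (by linarith) hs.1.le hys
  have hpos : ∀ φ φ₁, JacVel y φ φ₁ → ∀ t ∈ Ioc 0 T, 0 < φ t := fun φ φ₁ hφ t ht => by
    have := h.jac_ge_of_nonneg hv hφ hs hys h1 h2
    rcases le_total t s with hts | hts
    · exact ht.1.trans_le (this.1 t ⟨ht.1.le, hts⟩)
    · exact hs.1.trans_le (this.2 t ⟨hts, ht.2⟩)
  have hTT : T ∈ Ioc 0 T := ⟨h.time_pos, le_rfl⟩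
  refine ⟨fun φ φ₁ hφ => hpos φ φ₁ hφ T hTT, fun φ φ₁ hφ => ?_, fun hE' => absurd hE' hE.not_gt,
    by linarith [h.energy_ge], h3, fun hT5 _ φ φ₁ ψ ψ₁ hφ hψ => ?_, fun hE' => absurd hE' hE.not_gt,
    fun _ => h.dist_le, h.neg_energy_mul_le hE⟩
  · have := mul_nonneg h.time_pos.le (mul_nonneg hv h.vel_pos_end.le)
    nlinarith [hpos φ φ₁ hφ T hTT]
  · have a1 := jacPos_le_of_pos hT5 hφ hψ (hpos φ φ₁ hφ)
    have a2 := (h.jac_ge_of_nonneg hv hφ hs hys h1 h2).2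
    have a3 := mul_sub_le_of_le_deriv (f := fun t => ψ t / φ t) (c := -(1 / s ^ 2)) hs.2
      (fun t ht => hφ.hasDerivAt_div hψ (by linarith [a2 t ht, hs.1])) (fun t ht => by
        have := a2 t (Ioo_subset_Icc_self ht)
        have h0 := hs.1
        apply neg_le_neg
        gcongr)
    have a4 : 1 ≤ ψ s := hψ.ge_one_of_cos_nonneg (T := s) (fun t ht => cos_nonneg_of_mem_Icc
      ⟨(abs_le.1 (h1 t ht)).1, (abs_le.1 (h1 t ht)).2⟩) ⟨hs.1.le, le_rfl⟩
    have a5 : 0 < ψ s / φ s := div_pos (by linarith) (hpos φ φ₁ hφ s hs)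
    have a6 : 1 / s ^ 2 ≤ 28 := by
      rw [div_le_iff₀ (by positivity)]; nlinarith
    have a7 : -70 ≤ ψ T / φ T := by nlinarith [hs.2]
    have a8 := hpos φ φ₁ hφ T hTT
    rw [le_div_iff₀ a8] at a7
    rw [abs_le]
    constructor <;> linarith

end TopDown

/-! ### From the top to the bottom, starting upwards -/

/-- The derivative of the motion in its initial velocity, in closed form: `A` is the integral of
the square of the velocity. -/
lemma JacVel.energy_mul_eq {y p φ φ₁ A : ℝ → ℝ} (hφ : JacVel y φ φ₁) (h : Traj y p) (hA0 : A 0 = 0)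
    (hA : ∀ t, HasDerivAt A (p t ^ 2) t) (t : ℝ) :
    energy (y 0) (p 0) * (1 + energy (y 0) (p 0) / 2) * φ t =
      p 0 * (p t * A t / 8 + sin (y t) / 2) - p t * sin (y 0) / 2 := by
  have hJ : Jac y (fun t => p 0 * (p t * A t / 8 + sin (y t) / 2) - p t * sin (y 0) / 2)
      (fun t => p 0 * (sin (y t) * A t / 8 + p t ^ 3 / 8 + cos (y t) * p t / 2) -
        sin (y t) * sin (y 0) / 2) := by
    refine ⟨fun t => ?_, fun t => ?_⟩
    · exact ((((((h.vel t).mul (hA t)).div_const 8).add ((h.pos t).sin.div_const 2)).const_mul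
        (p 0)).sub (((h.vel t).mul_const (sin (y 0))).div_const 2)).congr_deriv (by ring)
    · exact (((((((h.pos t).sin.mul (hA t)).div_const 8).add (((h.vel t).pow 3).div_const 8)).add
        (((h.pos t).cos.mul (h.vel t)).div_const 2)).const_mul (p 0)).sub
        (((h.pos t).sin.mul_const (sin (y 0))).div_const 2)).congr_deriv (by
          simp only [Nat.cast_ofNat, Nat.add_one_sub_one]; ring)
  have := hJ.eq_smul hφ (by simp only [hA0]; ring) t
  rw [this]
  congr 1
  rw [hA0]
  unfold energy
  have := sin_sq_add_cos_sq (y 0)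
  linear_combination (1 / 2) * this

/-- The derivative of the motion in its initial position, in closed form. -/
lemma JacPos.energy_mul_eq {y p ψ ψ₁ A : ℝ → ℝ} (hψ : JacPos y ψ ψ₁) (h : Traj y p) (hA0 : A 0 = 0)
    (hA : ∀ t, HasDerivAt A (p t ^ 2) t) (t : ℝ) :
    -(energy (y 0) (p 0) * (1 + energy (y 0) (p 0) / 2)) * ψ t =
      (p t * A t / 8 + sin (y t) / 2) * sin (y 0) -
        p t * (p 0 ^ 3 / 8 + cos (y 0) * p 0 / 2) := by
  obtain ⟨φ, φ₁, hφ⟩ := exists_jacVel h.continuous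
  set d := p 0 ^ 3 / 8 + cos (y 0) * p 0 / 2 with hd
  have hJ : Jac y (fun t => (p t * A t / 8 + sin (y t) / 2) * sin (y 0) - p t * d)
      (fun t => (sin (y t) * A t / 8 + p t ^ 3 / 8 + cos (y t) * p t / 2) * sin (y 0) -
        sin (y t) * d) := by
    refine ⟨fun t => ?_, fun t => ?_⟩
    · exact ((((((h.vel t).mul (hA t)).div_const 8).add ((h.pos t).sin.div_const 2)).mul_const
        (sin (y 0))).sub ((h.vel t).mul_const d)).congr_deriv (by ring)
    · exact (((((((h.pos t).sin.mul (hA t)).div_const 8).add (((h.vel t).pow 3).div_const 8)).add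
        (((h.pos t).cos.mul (h.vel t)).div_const 2)).mul_const (sin (y 0))).sub
        ((h.pos t).sin.mul_const d)).congr_deriv (by
          simp only [Nat.cast_ofNat, Nat.add_one_sub_one]; ring)
  have := hJ.eq_comb hφ hψ t
  rw [this]
  rw [hA0, hd]
  unfold energy
  have := sin_sq_add_cos_sq (y 0)
  linear_combination (-(1 / 2) * ψ t) * this

/-! #### The scalar inequalities -/

/-- The elementary inequality behind the bound on the energy slope, for final angles up to the
bottom: `k = 2 sin (α / 2)`, `θk` is the initial upward speed and `-e` the energy. -/
lemma slope_slack_nonneg {k θ e : ℝ} (hk : 0 < k) (hk' : k ≤ 0.96) (hθ : 0 < θ) (hθ' : θ ≤ 1)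
    (he : e = (k ^ 2 - (θ * k) ^ 2) / 2) :
    0 ≤ (2 * e + 0.65) * 0.4387 - θ * ((k + θ * k) / 8 + 1.7727 * e) := by
  have he1 : e = k ^ 2 * (1 - θ ^ 2) / 2 := by rw [he]; ring
  have hθ2 : 0 ≤ 1 - θ ^ 2 := by nlinarith
  have he0 : 0 ≤ e := by rw [he1]; positivity
  have hk2 : k ^ 2 ≤ 0.9216 := by nlinarith
  have he2 : e ≤ 0.4608 * (1 - θ ^ 2) := by
    rw [he1]; linarith [mul_le_mul_of_nonneg_right hk2 hθ2]
  have h1 : θ * (k + θ * k) ≤ 0.96 * (θ + θ ^ 2) := by nlinarith [mul_pos hθ hθ]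
  rcases le_total θ 0.49 with h | h
  · nlinarith
  · have h2 : e * (0.8774 - 1.7727 * θ) ≥ 0.4608 * (1 - θ ^ 2) * (0.8774 - 1.7727 * θ) - 0.01 := by
      rcases le_total θ 0.4949 with h3 | h3
      · nlinarith
      · nlinarith
    nlinarith [mul_nonneg hθ.le (sq_nonneg (θ - 0.875)), sq_nonneg (θ - 0.863)]

/-- The inequality of `slope_slack_nonneg` with the contribution of the largest overshoot added;
since the contribution is estimated linearly in the overshoot, the two cases suffice. -/
lemma slope_slack_add_nonneg {k θ e : ℝ} (hk : 0 < k) (hk' : k ≤ 0.96) (hθ : 0 < θ) (hθ' : θ ≤ 1)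
    (he : e = (k ^ 2 - (θ * k) ^ 2) / 2) :
    0 ≤ (2 * e + 0.65) * 0.4387 - θ * ((k + θ * k) / 8 + 1.7727 * e) +
      θ * (0.08125 * (4.8 - 3.12 * e + 0.47 * (θ * k)) - (0.65 + 2 * e) * (0.285 + 0.121 * e)
        - 0.255 * e) := by
  have he1 : e = k ^ 2 * (1 - θ ^ 2) / 2 := by rw [he]; ring
  have hθ2 : 0 ≤ 1 - θ ^ 2 := by nlinarith
  have he0 : 0 ≤ e := by rw [he1]; positivity
  have hk2 : k ^ 2 ≤ 0.9216 := by nlinarith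
  have he2 : e ≤ 0.4608 * (1 - θ ^ 2) := by
    rw [he1]; linarith [mul_le_mul_of_nonneg_right hk2 hθ2]
  have he3 : e ^ 2 ≤ 0.461 * e := by nlinarith [sq_nonneg θ]
  have h0 : θ * e ^ 2 ≤ θ * (0.461 * e) := mul_le_mul_of_nonneg_left he3 hθ.le
  have h1 : 0.125 * (k * θ) + 0.0869 * (k * θ ^ 2) ≤ 0.12 * θ + 0.08343 * θ ^ 2 := by
    nlinarith [mul_pos hθ hθ]
  suffices h : 0 ≤ 0.28515 + 0.2047 * θ + e * (0.8774 - 3.0415 * θ)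
      - (0.125 * (k * θ) + 0.0869 * (k * θ ^ 2)) by
    nlinarith [mul_nonneg he0 hθ.le, mul_nonneg hk.le (sq_nonneg θ)]
  rcases le_total θ 0.288 with h | h
  · nlinarith
  · have h2 : e * (0.8774 - 3.0415 * θ) ≥ 0.4608 * (1 - θ ^ 2) * (0.8774 - 3.0415 * θ) - 0.003 := by
      rcases le_total θ 0.2885 with h3 | h3
      · nlinarith
      · nlinarith
    nlinarith [mul_nonneg hθ.le (sq_nonneg (θ - 0.6875)), sq_nonneg (θ - 0.6875)]

lemma slope_scalar {k w e : ℝ} (hw : 0 < w) (hwk : w ≤ k) (hk : k ≤ 0.96)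
    (he : e = (k ^ 2 - w ^ 2) / 2) :
    (k + w) / 8 + 1.7727 * e ≤ (2 * e + 0.65) * (0.4387 * k / w) := by
  have hk0 : 0 < k := hw.trans_le hwk
  have h := slope_slack_nonneg (k := k) (θ := w / k) (e := e) hk0 hk (div_pos hw hk0)
    ((div_le_one hk0).2 hwk) (by rw [div_mul_cancel₀ _ hk0.ne', he])
  rw [div_mul_cancel₀ _ hk0.ne'] at h
  rw [← mul_div_assoc, le_div_iff₀ hw]
  have h2 := mul_nonneg h hk0.le
  have : (2 * e + 0.65) * (0.4387 * k) - ((k + w) / 8 + 1.7727 * e) * w =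
    ((2 * e + 0.65) * 0.4387 - w / k * ((k + w) / 8 + 1.7727 * e)) * k := by
    field_simp
  linarith

/-- The version beyond the bottom: `β` is the overshoot, `s` its sine, `a` the integral of the
squared velocity and `r` half the inverse of the final velocity. -/
lemma slope_scalar_of_overshoot {k w e β s a r : ℝ} (hw : 0 < w) (hwk : w ≤ k) (hk : k ≤ 0.96)
    (he : e = (k ^ 2 - w ^ 2) / 2) (hβ : 0 ≤ β) (hβ' : β ≤ 1) (hs : 0.84 * β ≤ s) (hs' : s ≤ β)
    (ha : 2 * (1 - e + w) * (π + β - 1.02) + 1.682 + 2 * s ≤ (2 + w) * a)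
    (hr : r ≤ 0.285 + 0.121 * e) :
    (k + w) / 8 + 1.7727 * e + 0.255 * β ^ 2 * e ≤
      0.65 / 8 * a + (2 * e + 0.65) * (0.4387 * k / w - s * r) := by
  have hk0 : 0 < k := hw.trans_le hwk
  have he0 : 0 ≤ e := by rw [he]; nlinarith
  have he1 : e ≤ 0.461 := by rw [he]; nlinarith
  have h1 := slope_scalar hw hwk hk he
  have h2 := slope_slack_add_nonneg (k := k) (θ := w / k) (e := e) hk0 hk (div_pos hw hk0)
    ((div_le_one hk0).2 hwk) (by rw [div_mul_cancel₀ _ hk0.ne', he])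
  rw [div_mul_cancel₀ _ hk0.ne'] at h2
  set l := 0.08125 * (4.8 - 3.12 * e + 0.47 * w) - (0.65 + 2 * e) * (0.285 + 0.121 * e)
        - 0.255 * e with hl
  have h3 : (k + w) / 8 + 1.7727 * e ≤ (2 * e + 0.65) * (0.4387 * k / w) + l := by
    have h4 := mul_nonneg h2 (div_pos hk0 hw).le
    have : ((2 * e + 0.65) * 0.4387 - w / k * ((k + w) / 8 + 1.7727 * e) + w / k * l) * (k / w) =
      (2 * e + 0.65) * (0.4387 * k / w) + l - ((k + w) / 8 + 1.7727 * e) := by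
      field_simp
      ring
    linarith
  have ha' : β * (4.8 - 3.12 * e + 0.47 * w) ≤ a := by
    have h4 : (2 + w) * (β * (4.8 - 3.12 * e + 0.47 * w)) ≤ (2 + w) * a := by
      refine le_trans ?_ ha
      have h5 : 2 * (1 - e + w) * (2.12 + β) ≤ 2 * (1 - e + w) * (π + β - 1.02) :=
        mul_le_mul_of_nonneg_left (by linarith [pi_gt_d2]) (by linarith)
      have h6 : (2 + w) * (4.8 - 3.12 * e + 0.47 * w) ≤ 6.24 * (1 - e + w) + 3.362 := by
        nlinarith
      nlinarith [mul_le_mul_of_nonneg_left h6 hβ]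
    exact le_of_mul_le_mul_left h4 (by linarith)
  have hr' : s * r ≤ β * (0.285 + 0.121 * e) := by
    calc s * r ≤ s * (0.285 + 0.121 * e) := mul_le_mul_of_nonneg_left hr (by linarith)
      _ ≤ _ := mul_le_mul_of_nonneg_right hs' (by linarith)
  have h7 : (2 * e + 0.65) * (s * r) ≤ (2 * e + 0.65) * (β * (0.285 + 0.121 * e)) :=
    mul_le_mul_of_nonneg_left hr' (by linarith)
  have h8 : 0.255 * β ^ 2 * e ≤ β * (0.255 * e) := by nlinarith [mul_nonneg hβ he0]
  have h9 := mul_le_mul_of_nonneg_left h1 (sub_nonneg.2 hβ')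
  have h10 := mul_le_mul_of_nonneg_left h3 hβ
  rw [hl] at h10
  linarith

/-- A logarithm bounded by its tangent at `16`. -/
lemma le_of_exp_le {x d : ℝ} (hd : 0 < d) (h : exp x ≤ 4 / d) : x ≤ 1 / (4 * d) + 1.7727 := by
  have h1 := Real.add_one_le_exp (x - 4 * log 2)
  rw [exp_sub, show (4 : ℝ) * log 2 = log (2 ^ 4) by rw [log_pow]; norm_num,
    exp_log (by norm_num)] at h1
  rw [show log ((2 : ℝ) ^ 4) = 4 * log 2 by rw [log_pow]; norm_num] at h1
  have h2 := Real.log_two_lt_d9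
  have h3 : exp x / 2 ^ 4 ≤ 4 / d / 2 ^ 4 := by gcongr
  have h4 : 4 / d / 2 ^ 4 = 1 / (4 * d) := by field_simp; norm_num
  linarith

lemma one_div_two_mul_le {e P : ℝ} (he : 0 ≤ e) (he' : e ≤ 0.46) (hP : 0 < P)
    (h : 3.0804 - 2 * e ≤ P ^ 2) : 1 / (2 * P) ≤ 0.285 + 0.121 * e := by
  rw [div_le_iff₀ (by positivity)]
  have h1 : 0 ≤ 0.46 - e := by linarith
  have h3 : (0.285 + 0.121 * e) ^ 2 * (4 * (3.0804 - 2 * e)) ≤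
      (0.285 + 0.121 * e) ^ 2 * (4 * P ^ 2) := by gcongr
  have h4 : 1 ≤ (0.285 + 0.121 * e) ^ 2 * (4 * (3.0804 - 2 * e)) := by
    nlinarith [mul_nonneg he h1, mul_nonneg (mul_nonneg he h1) he]
  have h5 : 1 ≤ ((0.285 + 0.121 * e) * (2 * P)) ^ 2 := by linarith
  exact (one_le_sq_iff₀ (by positivity)).1 h5

/-! #### The motion -/

/-- The field `ẏ + 2 sin (y / 2)` grows exponentially with rate `cos (y / 2)`. -/
lemma Traj.exp_eq {y p : ℝ → ℝ} (h : Traj y p) {I : ℝ → ℝ} (hI0 : I 0 = 0)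
    (hI : ∀ t, HasDerivAt I (cos (y t / 2)) t) (t : ℝ) :
    p t + 2 * sin (y t / 2) = (p 0 + 2 * sin (y 0 / 2)) * exp (I t) := by
  have h1 : ∀ t, HasDerivAt (fun t => (p t + 2 * sin (y t / 2)) * exp (-I t)) 0 t := fun t => by
    have h2 := ((h.vel t).add ((((h.pos t).div_const 2).sin).const_mul 2)).mul
      (hI t).neg.exp
    refine h2.congr_deriv ?_
    have h3 := Real.sin_two_mul (y t / 2)
    rw [show 2 * (y t / 2) = y t by ring] at h3
    simp only [Pi.add_apply, h3]
    ring
  have h2 := eq_of_deriv_zero h1 t 0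
  simp only [hI0, neg_zero, exp_zero, mul_one] at h2
  rw [← h2, mul_assoc, ← exp_add, neg_add_cancel, exp_zero, mul_one]

namespace TopDown

variable {y p : ℝ → ℝ} {T : ℝ}

lemma sin_half_end_pos (h : TopDown y p T) : 0 < sin (y T / 2) :=
  sin_pos_of_pos_of_lt_pi (by linarith [h.stop_gt]) (by
    linarith [(h.mem T ⟨h.time_pos.le, le_rfl⟩).2, pi_gt_three])

lemma neg_vel_lt (h : TopDown y p T) : -p 0 < 2 * sin (y 0 / 2) := by
  obtain ⟨I, hI0, hI⟩ := exists_antideriv (f := fun t => cos (y t / 2))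
    (continuous_cos.comp (h.traj.continuous.div_const 2))
  have h1 := h.traj.exp_eq hI0 hI T
  have h2 : 0 < p T + 2 * sin (y T / 2) := by linarith [h.vel_pos_end, h.sin_half_end_pos]
  rw [h1] at h2
  have := (pos_iff_pos_of_mul_pos h2).2 (exp_pos _)
  linarith

lemma two_sin_half_le (h : TopDown y p T) : 2 * sin (y 0 / 2) ≤ 0.96 := by
  have h0 := abs_le.1 h.start
  have := sin_le_sin_of_le_of_le_pi_div_two (x := y 0 / 2) (y := 1 / 2) (by linarith [pi_gt_three])
    (by linarith [pi_gt_three]) (by linarith)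
  linarith [sin_half_le]

lemma sin_start_eq (h : TopDown y p T) (hk : 0 < 2 * sin (y 0 / 2)) :
    0.8775 * (2 * sin (y 0 / 2)) ≤ sin (y 0) ∧ sin (y 0) ≤ 2 * sin (y 0 / 2) := by
  have h0 := abs_le.1 h.start
  have h1 : cos (1 / 2) ≤ cos (y 0 / 2) := by
    rw [← cos_abs (y 0 / 2)]
    refine cos_le_cos_of_nonneg_of_le_pi (abs_nonneg _) (by linarith [pi_gt_three]) ?_
    rw [abs_le]; constructor <;> linarith
  have h2 := Real.sin_two_mul (y 0 / 2)
  rw [show 2 * (y 0 / 2) = y 0 by ring] at h2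
  have h3 := cos_half_ge
  have h4 := cos_le_one (y 0 / 2)
  constructor <;> nlinarith

/-- Beyond the bottom the speed is bounded below, and the force is nearly linear. -/
lemma sin_ge (h : TopDown y p T) {t : ℝ} (ht : t ∈ Icc 0 T) (hy : π < y t) :
    -(y t - π) ≤ sin (y t) ∧ sin (y t) ≤ -(0.84 * (y t - π)) ∧ 1.469 ≤ |p t| ∧
      1.0802 + (energy (y 0) (p 0) + 0.46) ≤ p t ^ 2 / 2 := by
  have h1 := (h.mem t ht).2
  have h2 : sin (y t) = -sin (y t - π) := by rw [sin_sub_pi, neg_neg]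
  have h3 : cos (y t) = -cos (y t - π) := by rw [cos_sub_pi, neg_neg]
  have h4 := cos_ge_cos_one (x := y t - π) (by rw [abs_le]; constructor <;> linarith)
  have h5 := Real.sin_le (x := y t - π) (by linarith)
  have h6 : 0.84 * (y t - π) ≤ sin (y t - π) := by
    -- concavity of the sine
    have hc := strictConcaveOn_sin_Icc.concaveOn.2
      (show (0 : ℝ) ∈ Icc 0 π from ⟨le_rfl, pi_pos.le⟩)
      (show (1 : ℝ) ∈ Icc 0 π from ⟨zero_le_one, by linarith [pi_gt_three]⟩)
      (show 0 ≤ 1 - (y t - π) by linarith) (show 0 ≤ y t - π by linarith) (by ring)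
    simp only [smul_eq_mul, sin_zero, mul_zero, zero_add, mul_one] at hc
    nlinarith [sin_one_ge]
  have h7 := h.traj.sq_vel' 0 t
  have h8 := h.energy_ge
  refine ⟨by linarith, by linarith, ?_, by linarith⟩
  refine abs_le_of_sq_le_sq' (a := 1.469) (b := |p t|) ?_ (abs_nonneg _) |>.2
  rw [sq_abs]
  nlinarith

lemma energy_neg_of_neg (h : TopDown y p T) (hv : p 0 < 0) :
    energy (y 0) (p 0) < 0 ∧ -energy (y 0) (p 0) = ((2 * sin (y 0 / 2)) ^ 2 - (-p 0) ^ 2) / 2 := by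
  have h1 := h.traj.sq_vel 0 0
  have h2 := h.neg_vel_lt
  have h3 : -energy (y 0) (p 0) = ((2 * sin (y 0 / 2)) ^ 2 - (-p 0) ^ 2) / 2 := by nlinarith
  exact ⟨by nlinarith, h3⟩

/-- In the closed form `JacVel.energy_mul_eq` all terms but `sin y(t)` have the good sign below the
horizontal. -/
lemma jac_ge_of_neg (h : TopDown y p T) (hv : p 0 < 0) {φ φ₁ : ℝ → ℝ} (hφ : JacVel y φ φ₁)
    {t : ℝ} (ht : t ∈ Icc 0 T)
    (hy : π / 2 ≤ y t) (hpt : 1.03 ≤ p t) :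
    0.21 * (2 * sin (y 0 / 2)) ≤
      -energy (y 0) (p 0) * (1 - (-energy (y 0) (p 0)) / 2) * φ t := by
  obtain ⟨A, hA0, hA⟩ := exists_antideriv (f := fun t => p t ^ 2) (h.traj.continuous_vel.pow 2)
  have hA1 : 0 ≤ A t := by
    have := le_of_hasDerivAt_nonneg ht.1 (fun t _ => hA t) (fun t _ => by positivity)
    rwa [hA0] at this
  have h1 := hφ.energy_mul_eq h.traj hA0 hA t
  have h2 := h.neg_vel_lt
  have h3 := h.sin_start_eq (by linarith)
  set k := 2 * sin (y 0 / 2)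
  have h4 : 0 ≤ p t * A t := by positivity
  have h5 : 0 ≤ -p 0 * (p t * A t) := mul_nonneg (by linarith) h4
  have h6 : 0.21 * k ≤ -p 0 * sin (y t) / 2 + p t * sin (y 0) / 2 := by
    rcases le_or_gt (y t) π with h7 | h7
    · have := sin_nonneg_of_nonneg_of_le_pi (by linarith [pi_pos]) h7
      have := mul_nonneg (neg_nonneg.2 hv.le) this
      nlinarith
    · obtain ⟨a1, -, a3, -⟩ := h.sin_ge ht h7
      rw [abs_of_pos (by linarith)] at a3
      have a4 : -0.8417 ≤ sin (y t) := by
        have h2 : sin (y t) = -sin (y t - π) := by rw [sin_sub_pi, neg_neg]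
        have := abs_sin_le_sin_one (x := y t - π)
          (by rw [abs_le]; constructor <;> linarith [(h.mem t ht).2])
        rw [h2]; linarith [(abs_le.1 this).2]
      have a5 : -0.8417 * k ≤ -p 0 * sin (y t) := by nlinarith
      nlinarith
  nlinarith

lemma jac_pos_of_neg (h : TopDown y p T) (hv : p 0 < 0) {φ φ₁ : ℝ → ℝ} (hφ : JacVel y φ φ₁) :
    ∀ t ∈ Ioc 0 T, 0 < φ t := fun t ht => by
  obtain ⟨s, hs, hys, h1, h2, -⟩ := h.exists_horizontal
  rcases le_total t s with hts | hts
  · have := (hφ.ge_of_cos_nonneg le_rfl (fun t ht => cos_nonneg_of_mem_Icc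
      ⟨(abs_le.1 (h1 t ht)).1, (abs_le.1 (h1 t ht)).2⟩) ⟨ht.1.le, hts⟩).2
    linarith [ht.1]
  · have h3 := h2 t ⟨hts, ht.2⟩
    have h4 := h.jac_ge_of_neg hv hφ ⟨ht.1.le, ht.2⟩ h3.1 h3.2
    have h5 := h.neg_vel_lt
    have h6 := h.energy_neg_of_neg hv
    have h7 := h.energy_ge
    exact (pos_iff_pos_of_mul_pos (lt_of_lt_of_le (by linarith) h4)).1
      (mul_pos (by linarith) (by linarith))

lemma bounds_of_neg (h : TopDown y p T) (hv : p 0 < 0) {φ φ₁ : ℝ → ℝ} (hφ : JacVel y φ φ₁) :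
    T ≤ 33 * φ T ∧ 0.19 ≤ φ T := by
  obtain ⟨s, hs, hys, h1, h2, h3⟩ := h.exists_horizontal
  have hTT : T ∈ Icc 0 T := ⟨h.time_pos.le, le_rfl⟩
  have h4 := h2 T ⟨hs.2, le_rfl⟩
  have h5 := h.jac_ge_of_neg hv hφ hTT h4.1 h4.2
  have h6 := h.neg_vel_lt
  have h7 := h.two_sin_half_le
  have h8 := h.energy_neg_of_neg hv
  have h9 := h.jac_pos_of_neg hv hφ T ⟨h.time_pos, le_rfl⟩
  obtain ⟨I, hI0, hI⟩ := exists_antideriv (f := fun t => cos (y t / 2))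
    (continuous_cos.comp (h.traj.continuous.div_const 2))
  have h10 := h.traj.exp_eq hI0 hI s
  have h11 : p s + 2 * sin (y s / 2) ≤ 4 := by
    have := h.traj.sq_vel_le s
    have := sin_le_one (y s / 2)
    have : p s ≤ 2 := abs_le_of_sq_le_sq' (b := 2) (by linarith) (by norm_num) |>.2
    linarith
  set k := 2 * sin (y 0 / 2)
  set w := -p 0 with hw
  have hkw : 0 < k - w := by linarith
  have h12 : 0.21 ≤ (k - w) * φ T := by
    rw [h8.2] at h5
    have a1 : 0 ≤ ((k ^ 2 - w ^ 2) / 2) * φ T := mul_nonneg (by nlinarith) h9.le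
    have a2 : 0.21 * k ≤ (k ^ 2 - w ^ 2) / 2 * φ T := by nlinarith
    have a3 : 0 ≤ (k - w) * φ T := by positivity
    have a4 : (k ^ 2 - w ^ 2) / 2 * φ T ≤ k * ((k - w) * φ T) := by nlinarith
    exact le_of_mul_le_mul_left (a := k) (by linarith) (by linarith)
  have h13 : 0.7 * s ≤ I s := by
    have := mul_sub_le_of_le_deriv (f := I) (c := 0.7) hs.1.le (fun t _ => hI t) (fun t ht => by
      have a1 := h1 t (Ioo_subset_Icc_self ht)
      have a2 : cos (π / 4) ≤ cos (y t / 2) := by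
        rw [← cos_abs (y t / 2)]
        refine cos_le_cos_of_nonneg_of_le_pi (abs_nonneg _) (by linarith [pi_gt_three]) ?_
        rw [abs_div, abs_two]; linarith
      rw [cos_pi_div_four] at a2
      have a3 : (1.4 : ℝ) ≤ √2 := Real.le_sqrt_of_sq_le (by norm_num)
      linarith)
    rw [hI0] at this
    linarith
  have h14 : (k - w) * (1 + I s) ≤ 4 := by
    have a1 := Real.add_one_le_exp (I s)
    have a2 := mul_le_mul_of_nonneg_left a1 hkw.le
    have a3 : p 0 + k = k - w := by rw [hw]; ring
    rw [a3] at h10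
    linarith
  constructor
  · have h15 : (k - w) * T ≤ 6.8 := by nlinarith
    have h16 : (k - w) * T ≤ (k - w) * (33 * φ T) := by nlinarith
    exact le_of_mul_le_mul_left h16 hkw
  · nlinarith

lemma jacPos_ge_of_neg (h : TopDown y p T) (hv : p 0 < 0) {φ φ₁ ψ ψ₁ : ℝ → ℝ}
    (hφ : JacVel y φ φ₁) (hψ : JacPos y ψ ψ₁) :
    -(100 * φ T) ≤ ψ T := by
  obtain ⟨A, hA0, hA⟩ := exists_antideriv (f := fun t => p t ^ 2) (h.traj.continuous_vel.pow 2)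
  have hTT : T ∈ Icc 0 T := ⟨h.time_pos.le, le_rfl⟩
  have hA1 : 0 ≤ A T := by
    have := le_of_hasDerivAt_nonneg h.time_pos.le (fun t _ => hA t) (fun t _ => by positivity)
    rwa [hA0] at this
  obtain ⟨s, hs, -, -, h2, -⟩ := h.exists_horizontal
  have h4 := h2 T ⟨hs.2, le_rfl⟩
  have h5 := h.jac_ge_of_neg hv hφ hTT h4.1 h4.2
  have h1 := hψ.energy_mul_eq h.traj hA0 hA T
  have h6 := h.neg_vel_lt
  have h7 := h.sin_start_eq (by linarith)
  have h8 := h.energy_neg_of_neg hv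
  have h9 := h.energy_ge
  have h10 : 0 ≤ cos (y 0) := by linarith [h.cos_one_le_cos_start, cos_one_ge]
  set k := 2 * sin (y 0 / 2)
  set ε := -energy (y 0) (p 0) with hε
  have hε0 : 0 < ε * (1 - ε / 2) := mul_pos (by linarith) (by linarith)
  have h11 : 0 ≤ -(p T * (p 0 ^ 3 / 8 + cos (y 0) * p 0 / 2)) := by
    have a1 : p 0 ^ 3 ≤ 0 := by
      have : p 0 ^ 3 = p 0 ^ 2 * p 0 := by ring
      rw [this]; exact mul_nonpos_of_nonneg_of_nonpos (sq_nonneg _) hv.le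
    have a2 : cos (y 0) * p 0 ≤ 0 := mul_nonpos_of_nonneg_of_nonpos h10 hv.le
    nlinarith
  have h12 : -k ≤ (p T * A T / 8 + sin (y T) / 2) * sin (y 0) := by
    have a1 : 0 ≤ p T * A T := mul_nonneg (by linarith) hA1
    have a2 := neg_one_le_sin (y T)
    nlinarith
  have h13 : ε * (1 - ε / 2) * (-(100 * φ T)) ≤ ε * (1 - ε / 2) * ψ T := by
    have : ε * (1 - ε / 2) * ψ T = -(energy (y 0) (p 0) * (1 + energy (y 0) (p 0) / 2)) * ψ T := by
      rw [hε]; ring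
    rw [this, h1]
    linarith
  exact le_of_mul_le_mul_left h13 hε0

/-- An upper bound for the time. With `c = cos (y / 2)` and the energy `-ε`, the constant
`1 - ε / 2` is `c² + ẏ² / 4`, and `c² ≤ c` as long as `c ≥ 0`; the last term takes care of
the part beyond the bottom. -/
lemma one_sub_mul_time_le (h : TopDown y p T) {I A : ℝ → ℝ} (hI0 : I 0 = 0)
    (hI : ∀ t, HasDerivAt I (cos (y t / 2)) t) (hA0 : A 0 = 0)
    (hA : ∀ t, HasDerivAt A (p t ^ 2) t) :
    (1 - -energy (y 0) (p 0) / 2) * T ≤ I T + A T / 4 + 0.255 * (max (y T - π) 0) ^ 2 := by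
  set ε := -energy (y 0) (p 0) with hε
  have hsq : ∀ t, p t ^ 2 = -2 * ε + 4 * (1 - cos (y t / 2) ^ 2) := fun t => by
    rw [h.traj.sq_vel 0 t, ← sin_sq]; rw [hε]; ring
  -- before the bottom the half angle has nonnegative cosine
  have key : ∀ s ∈ Icc 0 T, (∀ t ∈ Icc 0 s, y t ≤ π) → (1 - ε / 2) * s ≤ I s + A s / 4 :=
    fun s hs hys => by
    have := mul_sub_le_of_le_deriv (f := fun t => I t + A t / 4) (c := 1 - ε / 2) hs.1
      (fun t _ => (hI t).add ((hA t).div_const 4)) (fun t ht => by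
        have a1 := h.mem t ⟨ht.1.le, ht.2.le.trans hs.2⟩
        have a2 := hys t (Ioo_subset_Icc_self ht)
        have a3 : 0 ≤ cos (y t / 2) := cos_nonneg_of_mem_Icc
          ⟨by linarith [a1.1, pi_gt_three], by linarith⟩
        have a4 := cos_le_one (y t / 2)
        rw [hsq]
        nlinarith)
    rw [hI0, hA0] at this
    linarith
  have hTT : T ∈ Icc 0 T := ⟨h.time_pos.le, le_rfl⟩
  rcases le_or_gt (y T) π with hT | hT
  · rw [max_eq_right (by linarith)]
    have := key T hTT fun t ht => by
      by_contra! hlt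
      have := (h.isMax ht.1 ht.2 le_rfl (by linarith [pi_gt_three])).1
      linarith
    linarith
  · rw [max_eq_left (by linarith)]
    obtain ⟨s, hs, hys, b1, b2⟩ := h.exists_time (c := π) (by linarith [pi_gt_three]) hT.le
    have b3 := key s ⟨hs.1.le, hs.2⟩ b1
    have := le_of_hasDerivAt_nonneg
      (f := fun t => I t + A t / 4 + 0.255 * (y t - π) ^ 2 - (1 - ε / 2) * t) hs.2
      (fun t _ => (((hI t).add ((hA t).div_const 4)).add
        ((((h.traj.pos t).sub_const π).pow 2).const_mul 0.255)).sub
        ((hasDerivAt_id t).const_mul (1 - ε / 2))) (fun t ht => by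
        have ht' : t ∈ Icc 0 T := ⟨hs.1.le.trans ht.1.le, ht.2.le⟩
        have c1 := h.mem t ht'
        have c2 := b2 t (Ioo_subset_Icc_self ht)
        have c3 : 0.51 * 1.469 * (y t - π) ≤ 0.51 * (y t - π) * p t := by
          rcases c2.1.eq_or_lt with c4 | c4
          · rw [← c4]; simp
          · have := (h.sin_ge ht' c4).2.2.1
            rw [abs_of_pos c2.2] at this
            nlinarith
        have c5 : cos (y t / 2) = -sin ((y t - π) / 2) := by
          rw [show y t / 2 = (y t - π) / 2 + π / 2 by ring, cos_add_pi_div_two]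
        have c6 := Real.sin_le (x := (y t - π) / 2) (by linarith)
        have c7 := sin_nonneg_of_nonneg_of_le_pi (x := (y t - π) / 2) (by linarith)
          (by linarith [pi_gt_three, c1.2])
        have c8 := sin_le_sin_of_le_of_le_pi_div_two (x := (y t - π) / 2) (y := 1 / 2)
          (by linarith [pi_gt_three]) (by linarith [pi_gt_three]) (by linarith [c1.2])
        have c9 := sin_half_le
        rw [hsq, c5]
        simp only [Nat.cast_ofNat, Nat.add_one_sub_one, pow_one]
        nlinarith)
    simp only [hys, sub_self] at this
    norm_num at this ⊢
    linarith

/-- A lower bound for the integral of `ẏ² = ẏ · ẏ`, from the chord `(2 + w) ẏ ≥ ẏ² + 2w` of the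
square root on `[w, 2]`. -/
lemma integral_sq_ge_of_neg (h : TopDown y p T) (hv : p 0 < 0) {A : ℝ → ℝ}
    (hA0 : A 0 = 0) (hA : ∀ t, HasDerivAt A (p t ^ 2) t) :
    2 * (1 - -energy (y 0) (p 0) + -p 0) * (y T - 1.02) + 1.682 - 2 * sin (y T) ≤
      (2 + -p 0) * A T := by
  obtain ⟨s, hs, hys, -, b2⟩ := h.exists_time (c := 1.02) (by norm_num) (by linarith [h.stop_gt])
  have hAs : 0 ≤ A s := by
    have := le_of_hasDerivAt_nonneg hs.1.le (fun t _ => hA t) (fun t _ => by positivity)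
    rwa [hA0] at this
  set ε := -energy (y 0) (p 0) with hε
  set w := -p 0 with hw
  have hw0 : 0 < w := by linarith
  have := le_of_hasDerivAt_nonneg
    (f := fun t => (2 + w) * A t - (2 * (1 - ε + w) * y t - 2 * sin (y t))) hs.2
    (fun t _ => ((hA t).const_mul (2 + w)).sub
      (((h.traj.pos t).const_mul (2 * (1 - ε + w))).sub ((h.traj.pos t).sin.const_mul 2)))
    (fun t ht => by
      have ht' : t ∈ Icc 0 T := ⟨hs.1.le.trans ht.1.le, ht.2.le⟩
      obtain ⟨c1, c2⟩ := b2 t (Ioo_subset_Icc_self ht)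
      have c3 := h.traj.sq_vel' 0 t
      have c4 := h.traj.sq_vel' 0 0
      have c5 := h.cos_lt ht' (by linarith)
      have c6 := h.cos_one_le_cos_start
      have c7 : w ≤ p t := abs_le_of_sq_le_sq' (by rw [hw, neg_sq]; linarith) c2.le |>.2
      have c8 := h.traj.sq_vel_le t
      have c9 := (h.energy_neg_of_neg hv).1
      have c10 : p t ≤ 2 := abs_le_of_sq_le_sq' (b := 2) (by linarith) (by norm_num) |>.2
      have c11 : 0 ≤ p t * ((p t - w) * (2 - p t)) :=
        mul_nonneg c2.le (mul_nonneg (by linarith) (by linarith))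
      have c12 : 2 * cos (y t) = 2 * (1 - ε) - p t ^ 2 := by rw [c3, hε]; ring
      have : (2 + w) * p t ^ 2 - (2 * (1 - ε + w) * p t - 2 * (cos (y t) * p t)) =
        p t * ((p t - w) * (2 - p t)) := by
        linear_combination (p t) * c12
      rw [this]; exact c11)
  simp only [hys] at this
  have hsin : 0.841 ≤ sin 1.02 := by
    have := sin_le_sin_of_le_of_le_pi_div_two (x := 1) (y := 1.02) (by linarith [pi_gt_three])
      (by linarith [pi_gt_d2]) (by norm_num)
    linarith [sin_one_ge]
  have := mul_nonneg (show 0 ≤ 2 + w by linarith) hAs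
  linarith

/-- The bound on the energy slope. By the closed form of `φ` it amounts to
`ε (1 - ε / 2) T ≤ (2ε + 13 / 20) B` with an explicit `B`; the time is at most the logarithm of an
exponential growth factor plus a multiple of `∫ ẏ²`, and what is left is a scalar inequality. -/
lemma slope_of_neg (h : TopDown y p T) (hv : p 0 < 0) {φ φ₁ : ℝ → ℝ} (hφ : JacVel y φ φ₁) :
    -(T * (p 0 * p T)) ≤ (-2 * energy (y 0) (p 0) + 13 / 20) * φ T := by
  obtain ⟨A, hA0, hA⟩ := exists_antideriv (f := fun t => p t ^ 2) (h.traj.continuous_vel.pow 2)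
  obtain ⟨I, hI0, hI⟩ := exists_antideriv (f := fun t => cos (y t / 2))
    (continuous_cos.comp (h.traj.continuous.div_const 2))
  have hTT : T ∈ Icc 0 T := ⟨h.time_pos.le, le_rfl⟩
  have hA1 : 0 ≤ A T := by
    have := le_of_hasDerivAt_nonneg h.time_pos.le (fun t _ => hA t) (fun t _ => by positivity)
    rwa [hA0] at this
  have a1 := h.one_sub_mul_time_le hI0 hI hA0 hA
  have a2 := h.integral_sq_ge_of_neg hv hA0 hA
  have a3 := hφ.energy_mul_eq h.traj hA0 hA T
  have a4 := h.traj.exp_eq hI0 hI T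
  have a5 := h.energy_neg_of_neg hv
  have a6 := h.energy_ge
  have a7 := h.neg_vel_lt
  have a8 := h.two_sin_half_le
  have a9 := h.sin_start_eq (by linarith)
  have a10 := h.vel_pos_end
  have a11 : p T + 2 * sin (y T / 2) ≤ 4 := by
    have := h.traj.sq_vel_le T
    have := sin_le_one (y T / 2)
    have : p T ≤ 2 := abs_le_of_sq_le_sq' (b := 2) (by linarith) (by norm_num) |>.2
    linarith
  have hp0 : p 0 = -(-p 0) := (neg_neg _).symm
  set E := energy (y 0) (p 0) with hE
  set ε := -E with hε
  set w := -p 0 with hw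
  set k := 2 * sin (y 0 / 2) with hk
  set P := p T
  set b := y T with hb
  have hw0 : 0 < w := by linarith
  have hkw : 0 < k - w := by linarith
  have hε0 : 0 < ε := by linarith
  have hε1 : 0 < 1 - ε / 2 := by linarith
  -- the exponential growth gives a logarithmic bound, linearized at `16`
  have b1 : ε * I T ≤ (k + w) / 8 + 1.7727 * ε := by
    have c0 : p 0 + k = k - w := by rw [hw]; ring
    rw [c0] at a4
    have c1 : exp (I T) ≤ 4 / (k - w) := by
      rw [le_div_iff₀ hkw]; linarith
    have c2 := le_of_exp_le hkw c1
    have c3 := mul_le_mul_of_nonneg_left c2 hε0.le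
    have c4 : ε * (1 / (4 * (k - w)) + 1.7727) = (k + w) / 8 + 1.7727 * ε := by
      rw [mul_add]
      congr 1
      · rw [a5.2]; field_simp; ring
      · ring
    linarith
  have b2 : (k + w) / 8 + 1.7727 * ε + 0.255 * (max (b - π) 0) ^ 2 * ε ≤
      0.65 / 8 * A T + (2 * ε + 0.65) * (sin b / (2 * P) + 0.4387 * k / w) := by
    rcases le_or_gt b π with hbπ | hbπ
    · rw [max_eq_right (by linarith)]
      have c1 := slope_scalar hw0 (by linarith) a8 a5.2
      have c2 := sin_nonneg_of_nonneg_of_le_pi (x := b) (by linarith [h.stop_gt]) hbπ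
      have c3 : 0 ≤ sin b / (2 * P) := by positivity
      have c4 : 0 ≤ (2 * ε + 0.65) * (sin b / (2 * P)) := mul_nonneg (by linarith) c3
      linarith
    · rw [max_eq_left (by linarith)]
      obtain ⟨c1, c2, c3, c4⟩ := h.sin_ge hTT hbπ
      have c5 := one_div_two_mul_le hε0.le (by linarith) a10
        (show 3.0804 - 2 * ε ≤ P ^ 2 by linarith)
      have c6 := slope_scalar_of_overshoot (β := b - π) (s := -sin b) (a := A T)
        (r := 1 / (2 * P)) hw0 (by linarith) a8 a5.2 (by linarith)
        (by linarith [(h.mem T hTT).2]) (by linarith) (by linarith)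
        (by
          have : π + (b - π) - 1.02 = b - 1.02 := by ring
          rw [this]; linarith) c5
      have : -sin b * (1 / (2 * P)) = -(sin b / (2 * P)) := by ring
      rw [this] at c6
      linarith
  have b3 : (2 * ε + 0.65) * (0.4387 * k / w) ≤ (2 * ε + 0.65) * (sin (y 0) / (2 * w)) := by
    refine mul_le_mul_of_nonneg_left ?_ (by linarith)
    rw [div_le_div_iff₀ hw0 (by linarith)]
    have c1 := mul_le_mul_of_nonneg_right a9.1 hw0.le
    have c2 := mul_pos (hw0.trans (sub_pos.1 hkw)) hw0
    linarith
  have b4 : ε * (1 - ε / 2) * φ T = w * P * (A T / 8 + sin b / (2 * P) + sin (y 0) / (2 * w)) := by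
    have : ε * (1 - ε / 2) * φ T = -(E * (1 + E / 2) * φ T) := by rw [hε]; ring
    rw [this, a3]
    rw [hp0]
    field_simp
    ring
  have b5 : ε * ((1 - ε / 2) * T) ≤
      (2 * ε + 0.65) * (A T / 8 + sin b / (2 * P) + sin (y 0) / (2 * w)) := by
    have := mul_le_mul_of_nonneg_left a1 hε0.le
    linarith
  have b6 : ε * (1 - ε / 2) * (T * (w * P)) ≤ ε * (1 - ε / 2) * ((2 * ε + 0.65) * φ T) :=
    calc ε * (1 - ε / 2) * (T * (w * P)) = w * P * (ε * ((1 - ε / 2) * T)) := by ring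
      _ ≤ w * P * ((2 * ε + 0.65) * (A T / 8 + sin b / (2 * P) + sin (y 0) / (2 * w))) :=
        mul_le_mul_of_nonneg_left b5 (mul_pos hw0 a10).le
      _ = (2 * ε + 0.65) * (ε * (1 - ε / 2) * φ T) := by rw [b4]; ring
      _ = _ := by ring
  have b7 := le_of_mul_le_mul_left b6 (mul_pos hε0 hε1)
  have b8 : -2 * E + 13 / 20 = 2 * ε + 0.65 := by rw [hε]; ring
  have b9 : -(T * (p 0 * P)) = T * (w * P) := by rw [hw]; ring
  rw [b8, b9]
  exact b7

lemma goodPath_of_neg (h : TopDown y p T) (hv : p 0 < 0) : GoodPath y p T := by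
  have hE := (h.energy_neg_of_neg hv).1
  refine ⟨fun φ φ₁ hφ => h.jac_pos_of_neg hv hφ T ⟨h.time_pos, le_rfl⟩,
    fun φ φ₁ hφ => h.slope_of_neg hv hφ, fun hE' => absurd hE' hE.le.not_gt,
    by linarith [h.energy_ge], fun _ hE φ φ₁ hφ =>
    h.time_mul_vel_le_of_bounds hE (h.bounds_of_neg hv hφ).1, fun hT5 _ φ φ₁ ψ ψ₁ hφ hψ => ?_,
    fun hE' => absurd hE' hE.le.not_gt, fun _ => h.dist_le, h.neg_energy_mul_le hE.le⟩
  have h1 := jacPos_le_of_pos hT5 hφ hψ (h.jac_pos_of_neg hv hφ)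
  have h2 := h.jac_pos_of_neg hv hφ T ⟨h.time_pos, le_rfl⟩
  have h3 := h.jacPos_ge_of_neg hv hφ hψ
  exact abs_le.2 ⟨h3, by linarith⟩

/-- Every confined motion from near the top to near the bottom is good. -/
theorem goodPath (h : TopDown y p T) : GoodPath y p T :=
  (lt_or_ge (p 0) 0).elim h.goodPath_of_neg h.goodPath_of_nonneg

/-- Bounds at the end point, which the time reversal turns into bounds at the starting point. -/
lemma bounds (h : TopDown y p T) (hE : energy (y 0) (p 0) ≤ 5 / 2)
    {φ φ₁ : ℝ → ℝ} (hφ : JacVel y φ φ₁) :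
    T ≤ 33 * φ T ∧ 0.19 ≤ φ T :=
  (lt_or_ge (p 0) 0).elim (fun hv => h.bounds_of_neg hv hφ) fun hv => h.bounds_of_nonneg hv hE hφ

end TopDown

/-! ### From the bottom to the top -/

/-- The time reversal of a motion from the top to the bottom is good. -/
theorem goodPath_of_rev {y p : ℝ → ℝ} {T : ℝ} (hy : Traj y p)
    (h : TopDown (fun t => y (T - t)) (fun t => -p (T - t)) T) : GoodPath y p T := by
  have hg := h.goodPath
  have hE : energy (y T) (-p T) = energy (y 0) (p 0) := by
    rw [energy_neg_right, hy.energy_eq T 0]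
  have hrev : ∀ φ φ₁, JacVel y φ φ₁ → ∃ χ χ₁, JacVel (fun t => y (T - t)) χ χ₁ ∧ χ T = φ T :=
    fun φ φ₁ hφ => by
    obtain ⟨χ, χ₁, hχ⟩ := exists_jacVel h.traj.continuous
    exact ⟨χ, χ₁, hχ, hφ.rev_eq hχ⟩
  have hb := fun hE => @TopDown.bounds _ _ _ h hE
  have hslope := hg.energy_slope_le
  have hslope' := hg.energy_slope_le_of_pos
  have hge := hg.energy_ge
  have hpos := hg.jac_pos
  have htime := hg.time_eq
  have hdist := hg.dist_le
  have hneg := hg.neg_energy_mul_le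
  have hp0 := h.vel_ge ⟨h.time_pos.le, le_rfl⟩ (by linarith [(abs_le.1 h.finish).1, pi_gt_three])
    h.vel_pos_end
  simp only [sub_zero, sub_self, hE, neg_mul_neg] at hb hslope hslope' hge hpos htime hdist hneg hp0
  constructor
  · intro φ φ₁ hφ
    obtain ⟨χ, χ₁, hχ, h1⟩ := hrev φ φ₁ hφ
    rw [← h1]
    exact hpos χ χ₁ hχ
  · intro φ φ₁ hφ
    obtain ⟨χ, χ₁, hχ, h1⟩ := hrev φ φ₁ hφ
    rw [← h1, mul_comm (p 0)]
    exact hslope χ χ₁ hχ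
  · intro hE φ φ₁ hφ
    obtain ⟨χ, χ₁, hχ, h1⟩ := hrev φ φ₁ hφ
    rw [← h1, mul_comm (p 0)]
    exact hslope' hE χ χ₁ hχ
  · exact hge
  · intro hT hE φ φ₁ hφ
    obtain ⟨χ, χ₁, hχ, h1⟩ := hrev φ φ₁ hφ
    have h2 := (hb hE hχ).1
    rw [h1] at h2
    have := hy.abs_vel_le_three hE T
    nlinarith [h.time_pos, abs_nonneg (p T)]
  · intro hT hE φ φ₁ ψ ψ₁ hφ hψ
    obtain ⟨χ, χ₁, hχ, h1⟩ := hrev φ φ₁ hφ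
    have h2 := (hb hE hχ).2
    rw [h1] at h2
    have h3 := hy.abs_vel_le_three hE T
    have h4 := hy.vel_eq hφ hψ T
    have h5 : |p 0 * ψ T| ≤ 3 + φ T := by
      have : p 0 * ψ T = p T - sin (y 0) * φ T := by linarith
      rw [this]
      refine (abs_sub _ _).trans (add_le_add h3 ?_)
      rw [abs_mul, abs_of_pos (show 0 < φ T by linarith)]
      exact mul_le_of_le_one_left (by linarith) (abs_sin_le_one _)
    rw [abs_mul, abs_of_neg (by linarith : p 0 < 0)] at h5
    nlinarith [abs_nonneg (ψ T)]
  · intro hE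
    have := htime hE
    rw [intervalIntegral.integral_symm, abs_neg] at this
    exact this
  · intro hE
    have := hdist hE
    rwa [abs_sub_comm] at this
  · exact hneg

/-! ### Shooting: one connection for each travel time -/

/-- A continuous function all of whose zeros are up-crossings has at most one zero. -/
lemma no_two_upcrossings {g : ℝ → ℝ} {a b : ℝ} (hab : a < b) (hg : ContinuousOn g (Icc a b))
    (ha : g a = 0) (hb : g b = 0)
    (hz : ∀ x ∈ Icc a b, g x = 0 → (∀ᶠ z in 𝓝[>] x, 0 < g z) ∧ ∀ᶠ z in 𝓝[<] x, g z < 0) :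
    False := by
  have h1 := (hz a ⟨le_rfl, hab.le⟩ ha).1
  obtain ⟨c, hc1, hc2⟩ := (h1.and (Ioo_mem_nhdsGT hab)).exists
  have hcb : Icc c b ⊆ Icc a b := Icc_subset_Icc_left hc2.1.le
  have hcl := (hg.mono hcb).preimage_isClosed_of_isClosed isClosed_Icc isClosed_Iic (t := Iic 0)
  obtain ⟨x, ⟨hx1, hx2⟩, hx3⟩ := (isCompact_Icc.of_isClosed_subset hcl
    inter_subset_left).exists_isLeast ⟨b, ⟨hc2.2.le, le_rfl⟩, hb.le⟩
  have hx2 : g x ≤ 0 := hx2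
  have hcx : c < x := lt_of_le_of_ne hx1.1 (by rintro rfl; linarith)
  have hpos : ∀ z ∈ Ico c x, 0 < g z := fun z hz => by
    by_contra! hle
    exact absurd (hx3 ⟨⟨hz.1, hz.2.le.trans hx1.2⟩, hle⟩) (not_le.2 hz.2)
  have hx0 : g x = 0 := by
    refine le_antisymm hx2 ?_
    by_contra! hlt
    obtain ⟨z, hz1, hz2⟩ := intermediate_value_Icc' hcx.le
      (hg.mono ((Icc_subset_Icc_right hx1.2).trans hcb)) (show (0 : ℝ) ∈ Icc (g x) (g c) from
        ⟨hlt.le, hc1.le⟩)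
    rcases hz1.2.eq_or_lt with h | h
    · rw [h] at hz2; linarith
    · have := hpos z ⟨hz1.1, h⟩
      linarith
  obtain ⟨z, hz1, hz2⟩ := ((hz x (hcb hx1) hx0).2.and (Ioo_mem_nhdsLT hcx)).exists
  have := hpos z ⟨hz2.1.le, hz2.2⟩
  linarith

lemma upcrossing_of_hasDerivAt {g : ℝ → ℝ} {x d : ℝ} (h : HasDerivAt g d x) (hd : 0 < d)
    (hx : g x = 0) : (∀ᶠ z in 𝓝[>] x, 0 < g z) ∧ ∀ᶠ z in 𝓝[<] x, g z < 0 := by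
  have h2 := (hasDerivAt_iff_tendsto_slope.1 h).eventually (lt_mem_nhds hd)
  constructor
  · filter_upwards [h2.filter_mono (nhdsWithin_mono x fun z (hz : x < z) => hz.ne'),
      self_mem_nhdsWithin] with z hz hzx
    rw [slope_def_field, hx, sub_zero] at hz
    exact (div_pos_iff_of_pos_right (sub_pos.2 hzx)).1 hz
  · filter_upwards [h2.filter_mono (nhdsWithin_mono x fun z (hz : z < x) => hz.ne),
      self_mem_nhdsWithin] with z hz hzx
    rw [slope_def_field, hx, sub_zero] at hz
    have hzx : z < x := hzx
    rcases div_pos_iff.1 hz with h | h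
    · linarith [h.2]
    · exact h.1

lemma hasDerivAt_flowPos_vel {a v t : ℝ} (ht : 0 < t) {φ φ₁ : ℝ → ℝ}
    (hφ : JacVel (flowPos a v) φ φ₁) : HasDerivAt (fun v => flowPos a v t) (φ t) v := by
  obtain ⟨ψ, ψ₁, hψ⟩ := exists_jacPos (traj_flow a v).continuous
  have h1 := hasFDerivAt_flowPos ht hφ hψ
  have h2 : HasDerivAt (fun v : ℝ => ((a, v, t) : ℝ × ℝ × ℝ)) (0, 1, 0) v :=
    (hasDerivAt_const v a).prodMk ((hasDerivAt_id v).prodMk (hasDerivAt_const v t))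
  have h3 := h1.comp_hasDerivAt v h2
  refine h3.congr_deriv ?_
  simp

lemma Traj.pos_ge {y p : ℝ → ℝ} (h : Traj y p) {t : ℝ} (ht : 0 ≤ t) :
    y 0 + p 0 * t - t ^ 2 ≤ y t ∧ y t ≤ y 0 + p 0 * t + t ^ 2 := by
  have h1 := mul_sub_le_of_le_deriv (f := y) (c := p 0 - t) ht (fun s _ => h.pos s) (fun s hs => by
    have := abs_le.1 (h.abs_vel_sub_le s 0)
    rw [sub_zero, abs_of_pos hs.1] at this
    linarith [hs.2])
  have h2 := sub_le_mul_of_deriv_le (f := y) (c := p 0 + t) ht (fun s _ => h.pos s) (fun s hs => by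
    have := abs_le.1 (h.abs_vel_sub_le s 0)
    rw [sub_zero, abs_of_pos hs.1] at this
    linarith [hs.2])
  constructor <;> nlinarith

lemma continuous_flowPos_vel (a t : ℝ) : Continuous fun v => flowPos a v t :=
  continuous_flowPos.comp (f := fun v : ℝ => ((a, v, t) : ℝ × ℝ × ℝ)) (by fun_prop)

/-- Some initial velocity leads from `a` to `b` in time `T`. -/
lemma exists_flowPos_eq (a b : ℝ) {T : ℝ} (hT : 0 < T) : ∃ v, flowPos a v T = b := by
  have h1 : flowPos a ((b - a - T ^ 2) / T) T ≤ b := by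
    have := ((traj_flow a ((b - a - T ^ 2) / T)).pos_ge hT.le).2
    rw [flowPos_zero, flowVel_zero, div_mul_cancel₀ _ hT.ne'] at this
    linarith
  have h2 : b ≤ flowPos a ((b - a + T ^ 2) / T) T := by
    have := ((traj_flow a ((b - a + T ^ 2) / T)).pos_ge hT.le).1
    rw [flowPos_zero, flowVel_zero, div_mul_cancel₀ _ hT.ne'] at this
    linarith
  obtain ⟨v, -, hv⟩ := intermediate_value_Icc (α := ℝ)
    (div_le_div_of_nonneg_right (by nlinarith) hT.le)
    (continuous_flowPos_vel a T).continuousOn ⟨h1, h2⟩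
  exact ⟨v, hv⟩

/-! #### Rotations -/

/-- A motion that is not at rest and passes over the top has positive energy. -/
lemma Traj.energy_pos_of_mem {y p : ℝ → ℝ} (h : Traj y p) {s t : ℝ} (hst : y s ≠ y t) {r : ℝ}
    (hr : cos (y r) = 1) : 0 < energy (y 0) (p 0) := by
  rw [h.energy_eq 0 r, energy, hr]
  have : p r ≠ 0 := fun h0 => hst <| by
    -- otherwise the motion rests at the top
    have hs : sin (y r) = 0 := by
      have := sin_sq_add_cos_sq (y r)
      rw [hr] at this
      nlinarith
    have hc : Traj (fun _ => y r) (fun _ => 0) :=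
      ⟨fun t => hasDerivAt_const _ _, fun t => by rw [hs]; exact hasDerivAt_const _ _⟩
    rw [(h.unique hc (t₀ := r) rfl h0).1]
  have : 0 < p r ^ 2 := by positivity
  linarith

lemma Traj.exists_mem {y p : ℝ → ℝ} (h : Traj y p) {s t c : ℝ} (hc : c ∈ uIcc (y s) (y t)) :
    ∃ r, y r = c := by
  obtain ⟨r, -, hr⟩ := intermediate_value_uIcc (h.continuous.continuousOn (s := uIcc s t)) hc
  exact ⟨r, hr⟩

lemma Traj.energy_pos_of_turn {y p : ℝ → ℝ} (h : Traj y p) {s t : ℝ}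
    (hD : 2 * π ≤ |y t - y s|) : 0 < energy (y 0) (p 0) := by
  have key : ∀ s t : ℝ, 2 * π ≤ y t - y s → 0 < energy (y 0) (p 0) := fun s t hD => by
    set k : ℤ := ⌈y s / (2 * π)⌉
    have h1 := Int.le_ceil (y s / (2 * π))
    have h2 := Int.ceil_lt_add_one (y s / (2 * π))
    have hπ := pi_pos
    rw [div_le_iff₀ (by positivity)] at h1
    have h3 : (k : ℝ) * (2 * π) < y s + 2 * π := by
      have := mul_lt_mul_of_pos_right h2 (show 0 < 2 * π by positivity)
      rwa [add_mul, div_mul_cancel₀ _ (by positivity), one_mul] at this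
    obtain ⟨r, hr⟩ := h.exists_mem (s := s) (t := t) (c := k * (2 * π))
      (mem_uIcc.2 (Or.inl ⟨h1, by linarith⟩))
    refine h.energy_pos_of_mem (s := s) (t := t) (r := r) (fun he => by linarith) ?_
    rw [hr, cos_int_mul_two_pi]
  rcases le_abs.1 hD with h' | h'
  · exact key s t h'
  · exact key t s (by linarith)

/-- If every motion from `a` to `b` in time `T` is good, then there is only one. -/
lemma vel_unique_of_goodPath {a b T : ℝ} (hT : 0 < T)
    (hg : ∀ v, flowPos a v T = b → GoodPath (flowPos a v) (flowVel a v) T) {v v' : ℝ}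
    (hv : flowPos a v T = b) (hv' : flowPos a v' T = b) : v = v' := by
  have key : ∀ v v', flowPos a v T = b → flowPos a v' T = b → ¬v < v' := fun v v' hv hv' hlt => by
    refine no_two_upcrossings (g := fun v => flowPos a v T - b) hlt
      ((continuous_flowPos_vel a T).sub continuous_const).continuousOn (by simp [hv])
      (by simp [hv']) fun x _ hx => ?_
    obtain ⟨φ, φ₁, hφ⟩ := exists_jacVel (traj_flow a x).continuous
    exact upcrossing_of_hasDerivAt ((hasDerivAt_flowPos_vel hT hφ).sub_const b)
      ((hg x (by linarith)).jac_pos φ φ₁ hφ) hx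
  exact le_antisymm (not_lt.1 (key _ _ hv' hv)) (not_lt.1 (key _ _ hv hv'))

/-- A motion of positive energy is monotone. -/
lemma Traj.mem_of_energy_pos {y p : ℝ → ℝ} (h : Traj y p) (hE : 0 < energy (y 0) (p 0)) {T : ℝ}
    (hab : y 0 ≤ y T) (hT : 0 < T) : ∀ t ∈ Icc 0 T, y t ∈ Icc (y 0) (y T) := by
  have h0 : 0 ≤ p 0 := by
    by_contra! hneg
    have hp := h.neg.vel_pos_of_rotation (s := 0) (by simpa [energy_neg] using hE) (by linarith)
    have := lt_of_hasDerivAt_pos (f := fun t => -y t) hT (fun t _ => h.neg.pos t)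
      (fun t _ => hp t)
    linarith
  have h1 : p 0 ≠ 0 := fun h2 => by
    have := h.sq_vel_ge 0
    rw [h2] at this hE
    norm_num at this
    linarith
  have hp := h.vel_pos_of_rotation hE (lt_of_le_of_ne h0 h1.symm)
  exact fun t ht => ⟨le_of_hasDerivAt_nonneg ht.1 (fun t _ => h.pos t) (fun t _ => (hp t).le),
    le_of_hasDerivAt_nonneg ht.2 (fun t _ => h.pos t) (fun t _ => (hp t).le)⟩

/-! #### From the top to the bottom -/

/-- The largest angle reached up to time `T`. -/
noncomputable def maxPos (a T v : ℝ) : ℝ := sSup (flowPos a v '' Icc 0 T)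

lemma continuous_maxPos (a T : ℝ) : Continuous (maxPos a T) :=
  isCompact_Icc.continuous_sSup (f := fun v t => flowPos a v t)
    (continuous_flowPos.comp (f := fun z : ℝ × ℝ => ((a, z.1, z.2) : ℝ × ℝ × ℝ)) (by fun_prop))

lemma le_maxPos {a T v t : ℝ} (ht : t ∈ Icc 0 T) : flowPos a v t ≤ maxPos a T v :=
  le_csSup (isCompact_Icc.bddAbove_image (traj_flow a v).continuous.continuousOn)
    (mem_image_of_mem _ ht)

lemma exists_eq_maxPos {a T v : ℝ} (hT : 0 ≤ T) : ∃ t ∈ Icc 0 T, flowPos a v t = maxPos a T v := by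
  obtain ⟨t, ht, h⟩ := isCompact_Icc.exists_sSup_image_eq (nonempty_Icc.2 hT)
    (traj_flow a v).continuous.continuousOn
  exact ⟨t, ht, h.symm⟩

/-- The initial velocities for which the maximal angle up to time `T` is `b` belong to the confined
motions that arrive at `b` at time `T`. -/
lemma topDown_of_maxPos {a b T v : ℝ} (hT : 0 < T) (ha : |a| ≤ 1) (hb : |b - π| ≤ 1)
    (h : maxPos a T v = b) : flowPos a v T = b ∧
      (∀ t ∈ Icc 0 T, flowPos a v t ∈ Icc (min a 0) b) ∧
      ∀ t ∈ Icc 0 T, flowPos a v t = b → t = T := by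
  have hy := traj_flow a v
  have hb' := abs_le.1 hb
  have ha' := abs_le.1 ha
  have hb1 : 1 < b := by linarith [pi_gt_three]
  have hmax : ∀ t ∈ Icc 0 T, flowPos a v t ≤ b := fun t ht => h ▸ le_maxPos ht
  have hend : ∀ t ∈ Icc 0 T, flowPos a v t = b → t = T := fun t ht htb => by
    by_contra hne
    have ht0 : 0 < t := lt_of_le_of_ne ht.1 (by
      rintro rfl
      rw [flowPos_zero] at htb
      linarith)
    have hloc : IsLocalMax (flowPos a v) t :=
      IsMaxOn.isLocalMax (s := Icc 0 T) (fun x hx => by simpa [htb] using hmax x hx)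
        (Icc_mem_nhds ht0 (lt_of_le_of_ne ht.2 hne))
    exact hy.vel_ne_zero (by simpa using ha) (by rw [htb]; exact hb1) (by rw [htb]; linarith)
      (hloc.hasDerivAt_eq_zero (hy.pos t))
  obtain ⟨t, ht, htb⟩ := exists_eq_maxPos (a := a) (v := v) hT.le
  rw [h] at htb
  have hTb : flowPos a v T = b := by rwa [← hend t ht htb]
  refine ⟨hTb, fun t ht => ⟨?_, hmax t ht⟩, hend⟩
  obtain ⟨r, hr, hmin⟩ := isCompact_Icc.exists_isMinOn (nonempty_Icc.2 hT.le)
    hy.continuous.continuousOn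
  refine le_trans ?_ (show flowPos a v r ≤ flowPos a v t from hmin ht)
  by_contra! hlt
  have hr0 : flowPos a v r < 0 := hlt.trans_le (min_le_right _ _)
  have hra : flowPos a v r < a := hlt.trans_le (min_le_left _ _)
  -- at an interior minimum the energy is nonpositive, but the motion still has to cross the top
  have hr1 : 0 < r := lt_of_le_of_ne hr.1 (by rintro rfl; simp at hra)
  have hr2 : r < T := lt_of_le_of_ne hr.2 (by rintro rfl; linarith)
  have hp := (hmin.isLocalMin (Icc_mem_nhds hr1 hr2)).hasDerivAt_eq_zero (hy.pos r)
  obtain ⟨q, hq⟩ := hy.exists_mem (s := r) (t := T) (c := 0)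
    (mem_uIcc.2 (Or.inl ⟨hr0.le, by linarith⟩))
  have := hy.energy_pos_of_mem (s := r) (t := T) (r := q) (by linarith) (by rw [hq, cos_zero])
  rw [hy.energy_eq 0 r, hp, energy] at this
  linarith [cos_le_one (flowPos a v r)]

lemma TopDown.maxPos_eq {a b T v : ℝ} (h : TopDown (flowPos a v) (flowVel a v) T)
    (hb : flowPos a v T = b) : maxPos a T v = b := by
  have hT := h.time_pos.le
  refine le_antisymm ?_ (hb ▸ le_maxPos ⟨hT, le_rfl⟩)
  obtain ⟨t, ht, htm⟩ := exists_eq_maxPos (a := a) (v := v) hT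
  rw [← htm, ← hb]
  rcases le_or_gt (flowPos a v t) 1 with h1 | h1
  · linarith [h.stop_gt]
  · exact (h.isMax ht.1 ht.2 le_rfl h1).1

lemma topDown_flow {a b T v : ℝ} (hT : 0 < T) (ha : |a| ≤ 1) (hb : |b - π| ≤ 1)
    (h : maxPos a T v = b) : TopDown (flowPos a v) (flowVel a v) T := by
  obtain ⟨h1, h2, -⟩ := topDown_of_maxPos hT ha hb h
  refine ⟨traj_flow a v, hT, by simpa using ha, by rwa [h1], fun t ht => ?_⟩
  have := h2 t ht
  have ha' := abs_le.1 ha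
  have hb' := abs_le.1 hb
  refine ⟨le_trans (le_min (by linarith) (by norm_num)) this.1, this.2.trans (by linarith)⟩

/-- The maximal angle crosses each level near the bottom upwards as the initial velocity grows: only
the times near `T` matter, and there the angle increases in the velocity and in the time. -/
lemma maxPos_upcrossing {a b T v : ℝ} (hT : 0 < T) (ha : |a| ≤ 1) (hb : |b - π| ≤ 1)
    (h : maxPos a T v = b) :
    (∀ᶠ v' in 𝓝[>] v, b < maxPos a T v') ∧ ∀ᶠ v' in 𝓝[<] v, maxPos a T v' < b := by
  have hTD := topDown_flow hT ha hb h
  obtain ⟨h1, -, h3⟩ := topDown_of_maxPos hT ha hb h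
  obtain ⟨φ, φ₁, hφ⟩ := exists_jacVel (traj_flow a v).continuous
  obtain ⟨ψ, ψ₁, hψ⟩ := exists_jacPos (traj_flow a v).continuous
  have hφT := hTD.goodPath.jac_pos φ φ₁ hφ
  have hpT := hTD.vel_pos_end
  constructor
  · have := (upcrossing_of_hasDerivAt ((hasDerivAt_flowPos_vel hT hφ).sub_const b) hφT
      (by simp [h1])).1
    filter_upwards [this] with v' hv'
    have := le_maxPos (a := a) (v := v') (t := T) ⟨hT.le, le_rfl⟩
    linarith
  · -- near `(v, T)` the angle increases both with the velocity and with the time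
    set m := min (φ T) (flowVel a v T) with hm
    have hm0 : 0 < m := lt_min hφT hpT
    have hD := (hasFDerivAt_iff_isLittleO_nhds_zero.1 (hasFDerivAt_flowPos hT hφ hψ)).def
      (half_pos hm0)
    have hnear : ∀ᶠ z : ℝ × ℝ in 𝓝 (v, T), |flowPos a z.1 z.2 - b -
        (φ T * (z.1 - v) + flowVel a v T * (z.2 - T))| ≤ m / 2 * max |z.1 - v| |z.2 - T| := by
      have ht : Tendsto (fun z : ℝ × ℝ => ((0, z.1 - v, z.2 - T) : ℝ × ℝ × ℝ)) (𝓝 (v, T))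
          (𝓝 0) := by
        have : Continuous fun z : ℝ × ℝ => ((0, z.1 - v, z.2 - T) : ℝ × ℝ × ℝ) := by fun_prop
        have h0 : ((0, v - v, T - T) : ℝ × ℝ × ℝ) = 0 := by simp
        have := this.tendsto (v, T)
        rwa [h0] at this
      filter_upwards [ht.eventually hD] with z hz
      simpa [h1, Prod.norm_def, Real.norm_eq_abs] using hz
    obtain ⟨U, hU, W, hW, hUW⟩ := mem_nhds_prod_iff.1 hnear
    have hfar : ∀ᶠ v' in 𝓝 v, ∀ t ∈ Icc 0 T \ interior W, flowPos a v' t < b := by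
      refine (isCompact_Icc.diff isOpen_interior).eventually_forall_of_forall_eventually
        fun t ht => ?_
      have hlt : flowPos a v t < b := by
        refine lt_of_le_of_ne (h ▸ le_maxPos ht.1) fun htb => ht.2 ?_
        rw [h3 t ht.1 htb]
        exact mem_interior_iff_mem_nhds.2 hW
      have hc : Continuous fun z : ℝ × ℝ => flowPos a z.1 z.2 :=
        continuous_flowPos.comp (f := fun z : ℝ × ℝ => ((a, z.1, z.2) : ℝ × ℝ × ℝ)) (by fun_prop)
      exact (hc.tendsto (v, t)).eventually (gt_mem_nhds hlt)
    filter_upwards [eventually_nhdsWithin_of_eventually_nhds hfar, mem_nhdsWithin_of_mem_nhds hU,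
      self_mem_nhdsWithin] with v' hv' hvU hlt
    have hlt : v' < v := hlt
    obtain ⟨t, ht, htm⟩ := exists_eq_maxPos (a := a) (v := v') hT.le
    rw [← htm]
    by_cases htW : t ∈ interior W
    · have h4 : |flowPos a v' t - b - (φ T * (v' - v) + flowVel a v T * (t - T))| ≤
        m / 2 * max |v' - v| |t - T| := hUW (mk_mem_prod hvU (interior_subset htW))
      have h5 := (abs_le.1 h4).2
      rw [abs_of_neg (by linarith), abs_of_nonpos (by linarith [ht.2])] at h5
      have h6 : φ T * (v' - v) ≤ m * (v' - v) :=
        mul_le_mul_of_nonpos_right (min_le_left _ _) (by linarith)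
      have h7 : flowVel a v T * (t - T) ≤ m * (t - T) :=
        mul_le_mul_of_nonpos_right (min_le_right _ _) (by linarith [ht.2])
      have h8 : max (-(v' - v)) (-(t - T)) ≤ (v - v') + (T - t) :=
        max_le (by linarith [ht.2]) (by linarith)
      have h9 := mul_le_mul_of_nonneg_left h8 (half_pos hm0).le
      have h10 : 0 < m * (v - v') := mul_pos hm0 (by linarith)
      have h11 : 0 ≤ m * (T - t) := mul_nonneg hm0.le (by linarith [ht.2])
      linarith
    · exact hv' t ⟨ht, htW⟩

/-- Confined motions are detected by `maxPos`, whose level sets are single points. -/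
lemma TopDown.vel_unique {a T v v' : ℝ} (h : TopDown (flowPos a v) (flowVel a v) T)
    (h' : TopDown (flowPos a v') (flowVel a v') T) (he : flowPos a v T = flowPos a v' T) :
    v = v' := by
  have ha : |a| ≤ 1 := by simpa using h.start
  have hb := h.finish
  have hv := h.maxPos_eq rfl
  have hv' := h'.maxPos_eq he.symm
  set b := flowPos a v T
  have key : ∀ v v', maxPos a T v = b → maxPos a T v' = b → ¬v < v' := fun v v' hv hv' hlt => by
    refine no_two_upcrossings (g := fun v => maxPos a T v - b) hlt
      ((continuous_maxPos a T).sub continuous_const).continuousOn (by simp [hv])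
      (by simp [hv']) fun x _ hx => ?_
    have := maxPos_upcrossing h.time_pos ha hb (sub_eq_zero.1 hx)
    exact ⟨this.1.mono fun z hz => sub_pos.2 hz, this.2.mono fun z hz => sub_neg.2 hz⟩
  exact le_antisymm (not_lt.1 (key _ _ hv' hv)) (not_lt.1 (key _ _ hv hv'))

/-- The connection stays in the smaller interval `[min a 0, b]`. -/
lemma exists_topDown {a b T : ℝ} (hT : 0 < T) (ha : |a| ≤ 1) (hb : |b - π| ≤ 1) :
    ∃ y p, Traj y p ∧ y 0 = a ∧ y T = b ∧ ∀ t ∈ Icc 0 T, y t ∈ Icc (min a 0) b := by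
  have hb' := abs_le.1 hb
  have ha' := abs_le.1 ha
  -- the separatrix `ẏ = -2 sin (y / 2)` does not go beyond `b`
  have h1 : maxPos a T (-2 * sin (a / 2)) ≤ b := by
    have hy := traj_flow a (-2 * sin (a / 2))
    set y := flowPos a (-2 * sin (a / 2)) with hyd
    set p := flowVel a (-2 * sin (a / 2)) with hpd
    have hu : ∀ t, p t + 2 * sin (y t / 2) = 0 := fun t => by
      obtain ⟨I, hI0, hI⟩ := exists_antideriv (f := fun t => cos (y t / 2))
        (continuous_cos.comp (hy.continuous.div_const 2))
      rw [hy.exp_eq hI0 hI t, hyd, hpd, flowPos_zero, flowVel_zero]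
      ring
    obtain ⟨t, ht, htm⟩ := exists_eq_maxPos (a := a) (v := -2 * sin (a / 2)) hT.le
    rw [← htm]
    refine image_le_of_deriv_right_lt_deriv_boundary (f := y) (f' := p) (B := fun _ => b)
      (B' := fun _ => 0) hy.continuous.continuousOn (fun x _ => (hy.pos x).hasDerivWithinAt)
      (by rw [hyd, flowPos_zero]; linarith [pi_gt_three]) (fun x => hasDerivAt_const _ _)
      (fun x _ hx => ?_) ht
    have := hu x
    have h3 : 0 < sin (y x / 2) := by
      rw [hx]
      exact sin_pos_of_pos_of_lt_pi (by linarith [pi_gt_three]) (by linarith [pi_gt_three])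
    linarith
  have h2 : b ≤ maxPos a T ((b - a + T ^ 2) / T) := by
    have := ((traj_flow a ((b - a + T ^ 2) / T)).pos_ge hT.le).1
    rw [flowPos_zero, flowVel_zero, div_mul_cancel₀ _ hT.ne'] at this
    have := le_maxPos (a := a) (v := (b - a + T ^ 2) / T) (t := T) ⟨hT.le, le_rfl⟩
    linarith
  obtain ⟨v, -, hv⟩ := intermediate_value_uIcc (continuous_maxPos a T).continuousOn
    (mem_uIcc.2 (Or.inl ⟨h1, h2⟩))
  obtain ⟨h3, h4, -⟩ := topDown_of_maxPos hT ha hb hv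
  exact ⟨_, _, traj_flow a v, flowPos_zero a v, h3, h4⟩

/-! #### Near the top -/

/-- Maximum principle: a motion whose force points outwards beyond `1` and whose end points lie
below `1` stays below `1`. -/
lemma le_one_of_force_pos {x p g : ℝ → ℝ} {T : ℝ} (hT : 0 ≤ T) (hx : ∀ t, HasDerivAt x (p t) t)
    (hp : ∀ t, HasDerivAt p (g t) t) (hg : ∀ t, 1 < x t → 0 < g t) (h0 : x 0 ≤ 1) (h1 : x T ≤ 1) :
    ∀ t ∈ Icc 0 T, x t ≤ 1 := by
  have hc : Continuous x := continuous_iff_continuousAt.2 fun t => (hx t).continuousAt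
  obtain ⟨r, hr, hmax⟩ := isCompact_Icc.exists_isMaxOn (nonempty_Icc.2 hT) hc.continuousOn
  intro t ht
  refine le_trans (hmax ht) ?_
  by_contra! hlt
  have hr0 : 0 < r := lt_of_le_of_ne hr.1 (by rintro rfl; linarith)
  have hrT : r < T := lt_of_le_of_ne hr.2 (by rintro rfl; linarith)
  have hpr := (hmax.isLocalMax (Icc_mem_nhds hr0 hrT)).hasDerivAt_eq_zero (hx r)
  obtain ⟨d, hd, hball⟩ := Metric.mem_nhds_iff.1 ((hc.tendsto r).eventually (lt_mem_nhds hlt))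
  have hgt : ∀ s, r ≤ s → s < r + d → 1 < x s := fun s h1 h2 =>
    hball (by rw [Metric.mem_ball, Real.dist_eq, abs_of_nonneg (by linarith)]; linarith)
  set q := min T (r + d / 2) with hq
  have hq1 : r < q := lt_min hrT (by linarith)
  have hq2 : q < r + d := (min_le_right _ _).trans_lt (by linarith)
  have hpos : ∀ s ∈ Ioo r q, 0 < p s := fun s hs => by
    have := lt_of_hasDerivAt_pos (f := p) hs.1 (fun t _ => hp t) (fun t ht =>
      hg t (hgt t ht.1.le (ht.2.trans (hs.2.trans hq2))))
    linarith
  have h2 := lt_of_hasDerivAt_pos (f := x) hq1 (fun t _ => hx t) hpos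
  have h3 : x q ≤ x r := hmax ⟨hr.1.trans hq1.le, min_le_left _ _⟩
  linarith

/-- The confinement is automatic for the equation with the force frozen outside `[-1, 1]`, which is
solved by shooting. -/
lemma exists_near_top {a b T : ℝ} (hT : 0 < T) (ha : |a| ≤ 1) (hb : |b| ≤ 1) :
    ∃ y p, Traj y p ∧ y 0 = a ∧ y T = b ∧ ∀ t ∈ Icc 0 T, |y t| ≤ 1 := by
  -- shoot with the force frozen outside `[-1, 1]`
  set g : ℝ → ℝ → ℝ := fun _ x => sin (clamp 1 x) with hgd
  have hL : ∀ t x y, |g t x - g t y| ≤ |x - y| := fun t x y =>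
    (abs_sin_sub_le _ _).trans (abs_clamp_sub_le 1 x y)
  have hg1 : ∀ t x, |g t x| ≤ 1 := fun t x => abs_sin_le_one _
  have hex := fun v => exists_secondOrder (g := g) (fun x => continuous_const) hL
    (fun t => hg1 t 0) a v
  choose x p hx0 hp0 hx hp using hex
  have hcont : Continuous fun v => x v T := by
    refine (LipschitzWith.of_dist_le_mul (K := ⟨exp T, (exp_pos T).le⟩) fun v w => ?_).continuous
    have := (secondOrder_dist_le hL (hx v) (hp v) (hx w) (hp w) hT.le).1
    rw [hx0, hx0, hp0, hp0, sub_self, abs_zero, max_eq_right (abs_nonneg _)] at this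
    rw [Real.dist_eq, Real.dist_eq, mul_comm]
    exact this
  have hlow : ∀ v, a + v * T - T ^ 2 ≤ x v T ∧ x v T ≤ a + v * T + T ^ 2 := fun v => by
    have hpv : ∀ s ∈ Ioo 0 T, v - T ≤ p v s ∧ p v s ≤ v + T := fun s hs => by
      have h1 := mul_sub_le_of_le_deriv (f := p v) (c := -1) hs.1.le (fun t _ => hp v t)
        (fun t _ => (abs_le.1 (hg1 t _)).1)
      have h2 := sub_le_mul_of_deriv_le (f := p v) (c := 1) hs.1.le (fun t _ => hp v t)
        (fun t _ => (abs_le.1 (hg1 t _)).2)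
      rw [hp0] at h1 h2
      constructor <;> linarith [hs.2]
    have h1 := mul_sub_le_of_le_deriv (f := x v) (c := v - T) hT.le (fun t _ => hx v t)
      (fun t ht => (hpv t ht).1)
    have h2 := sub_le_mul_of_deriv_le (f := x v) (c := v + T) hT.le (fun t _ => hx v t)
      (fun t ht => (hpv t ht).2)
    rw [hx0] at h1 h2
    constructor <;> nlinarith
  have h1 : x ((b - a - T ^ 2) / T) T ≤ b := by
    have := (hlow ((b - a - T ^ 2) / T)).2
    rw [div_mul_cancel₀ _ hT.ne'] at this
    linarith
  have h2 : b ≤ x ((b - a + T ^ 2) / T) T := by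
    have := (hlow ((b - a + T ^ 2) / T)).1
    rw [div_mul_cancel₀ _ hT.ne'] at this
    linarith
  obtain ⟨v, -, hv⟩ := intermediate_value_uIcc hcont.continuousOn
    (mem_uIcc.2 (Or.inl ⟨h1, h2⟩))
  have hv : x v T = b := hv
  have ha' := abs_le.1 ha
  have hb' := abs_le.1 hb
  have hs1 : 0 < sin 1 := by linarith [sin_one_ge]
  have hup := le_one_of_force_pos hT.le (hx v) (hp v) (fun t ht => by
    have : clamp 1 (x v t) = 1 := by
      unfold clamp
      rw [min_eq_right ht.le, max_eq_right (by norm_num)]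
    rw [hgd]
    simp only [this, hs1]) (by rw [hx0]; exact ha'.2) (by rw [hv]; exact hb'.2)
  have hdown := le_one_of_force_pos hT.le (fun t => (hx v t).neg) (fun t => (hp v t).neg)
    (fun t ht => by
    have : clamp 1 (x v t) = -1 := by
      unfold clamp
      simp only [Pi.neg_apply] at ht
      rw [min_eq_left (by linarith), max_eq_left (by linarith)]
    rw [hgd]
    simp only [this, sin_neg, neg_neg, hs1]) (by simp [hx0]; linarith) (by simp [hv]; linarith)
  have habs : ∀ t ∈ Icc 0 T, |x v t| ≤ 1 := fun t ht =>
    abs_le.2 ⟨by have := hdown t ht; simp only [Pi.neg_apply] at this; linarith, hup t ht⟩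
  have hy := traj_flow a v
  have heq : ∀ t ∈ Icc 0 T, x v t = flowPos a v t := fun t ht =>
    secondOrder_eqOn (g := fun _ x => sin x) (fun _ => abs_sin_sub_le) (fun t _ => hx v t)
      (fun t ht => by
        have := hp v t
        rw [hgd] at this
        simp only [clamp_eq_self (habs t ht)] at this
        exact this) (fun t _ => hy.pos t) (fun t _ => hy.vel t) (by simp [hx0]) (by simp [hp0]) ht
  refine ⟨_, _, hy, flowPos_zero a v, ?_, fun t ht => ?_⟩
  · rw [← heq T ⟨hT.le, le_rfl⟩, hv]
  · rw [← heq t ht]; exact habs t ht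

/-- Near the top the distance of two motions is convex. -/
lemma near_top_unique {y p y' p' : ℝ → ℝ} {T : ℝ} (hT : 0 < T) (h : Traj y p) (h' : Traj y' p')
    (hy : ∀ t ∈ Icc 0 T, |y t| ≤ 1) (hy' : ∀ t ∈ Icc 0 T, |y' t| ≤ 1) (h0 : y 0 = y' 0)
    (h1 : y T = y' T) : y = y' ∧ p = p' := by
  have hder : ∀ t, HasDerivAt (fun t => (y t - y' t) * (p t - p' t))
      ((p t - p' t) ^ 2 + (y t - y' t) * (sin (y t) - sin (y' t))) t := fun t =>
    (((h.pos t).sub (h'.pos t)).mul ((h.vel t).sub (h'.vel t))).congr_deriv (by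
      simp only [Pi.sub_apply]; ring)
  have hmono : ∀ t ∈ Icc 0 T, 0 ≤ (y t - y' t) * (sin (y t) - sin (y' t)) := fun t ht => by
    have a1 := abs_le.1 (hy t ht)
    have a2 := abs_le.1 (hy' t ht)
    have hπ := pi_gt_three
    rcases le_total (y t) (y' t) with hle | hle
    · have := sin_le_sin_of_le_of_le_pi_div_two (by linarith) (by linarith) hle
      exact mul_nonneg_of_nonpos_of_nonpos (by linarith) (by linarith)
    · have := sin_le_sin_of_le_of_le_pi_div_two (by linarith) (by linarith) hle
      exact mul_nonneg (by linarith) (by linarith)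
  have hf : ∀ t ∈ Icc 0 T, 0 ≤ (y t - y' t) * (p t - p' t) := fun t ht => by
    have := le_of_hasDerivAt_nonneg ht.1 (fun s _ => hder s) (fun s hs => by
      have := hmono s ⟨hs.1.le, hs.2.le.trans ht.2⟩
      positivity)
    rwa [h0, sub_self, zero_mul] at this
  have hd : ∀ t ∈ Icc 0 T, y t = y' t := fun t ht => by
    have := le_of_hasDerivAt_nonneg (f := fun t => (y t - y' t) ^ 2) ht.2
      (fun s _ => ((h.pos s).sub (h'.pos s)).pow 2) (fun s hs => by
        have := hf s ⟨ht.1.trans hs.1.le, hs.2.le⟩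
        simp only [Nat.cast_ofNat, Nat.add_one_sub_one, pow_one, Pi.sub_apply]
        linarith)
    rw [h1, sub_self] at this
    have h2 : (y t - y' t) ^ 2 = 0 := le_antisymm (by linarith) (sq_nonneg _)
    exact sub_eq_zero.1 (pow_eq_zero_iff two_ne_zero |>.1 h2)
  have hT2 : T / 2 ∈ Icc 0 T := ⟨by linarith, by linarith⟩
  refine h.unique h' (hd _ hT2) ?_
  have hev : y =ᶠ[𝓝 (T / 2)] y' := by
    filter_upwards [Icc_mem_nhds (show 0 < T / 2 by linarith)
      (show T / 2 < T by linarith)] with t ht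
    exact hd t ht
  exact ((h.pos (T / 2)).congr_of_eventuallyEq hev.symm).unique (h'.pos (T / 2))

/-! ### The classes of end points -/

/-- `Way α β J`: in the angle measured from the top, the pair `(α, β)` of end points belongs to one
of the classes of connections, and `J` is the interval used to confine the motion: none for the
rotations (at least a full turn, or between the neighbourhoods of the two bottoms next to a top),
and the hull of the neighbourhoods of both end points otherwise. The multiples `mπ` and `nπ` are the
equilibria next to `α` and `β`; the even ones are the tops. -/
def Way (α β : ℝ) (J : Set ℝ) : Prop :=
  (J = univ ∧ (2 * π ≤ |β - α| ∨ ∃ m n : ℤ, |α - m * π| ≤ 1 ∧ |β - n * π| ≤ 1 ∧ Odd m ∧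
    (n = m + 2 ∨ n = m - 2))) ∨
  ∃ m n : ℤ, |α - m * π| ≤ 1 ∧ |β - n * π| ≤ 1 ∧ ((n = m ∧ Even m) ∨ n = m + 1 ∨ n = m - 1) ∧
    J = Icc (((min m n : ℤ) : ℝ) * π - 1) (((max m n : ℤ) : ℝ) * π + 1)

lemma int_eq_of_near {m n : ℤ} {x y : ℝ} (hm : |x - m * π| ≤ 1) (hn : |y - n * π| ≤ 1)
    (h : |y - x| ≤ 1 / 10) : n = m := by
  have h1 := abs_le.1 hm
  have h2 := abs_le.1 hn
  have h3 := abs_le.1 h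
  have hπ := pi_gt_three
  by_contra hne
  rcases lt_or_gt_of_ne hne with hlt | hlt
  · have : (n : ℝ) + 1 ≤ m := by exact_mod_cast hlt
    nlinarith
  · have : (m : ℝ) + 1 ≤ n := by exact_mod_cast hlt
    nlinarith

lemma abs_sub_le_of_near {m n : ℤ} {α β : ℝ} (hm : |α - m * π| ≤ 1) (hn : |β - n * π| ≤ 1)
    (h : (n = m ∧ Even m) ∨ n = m + 1 ∨ n = m - 1) : |β - α| ≤ π + 2 := by
  have h1 := abs_le.1 hm
  have h2 := abs_le.1 hn
  have hπ := pi_gt_three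
  rcases h with ⟨h, -⟩ | h | h <;> rw [h] at h2 <;> push_cast at h2 <;> rw [abs_le] <;>
    constructor <;> linarith

/-- The class of a pair of end points is locally constant. -/
lemma Way.eq_of_near {α α' β : ℝ} {J J' : Set ℝ} (h : Way α β J) (h' : Way α' β J')
    (hα : |α' - α| ≤ 1 / 10) : J' = J := by
  have hα' := abs_le.1 hα
  have hπ := pi_gt_d2
  have far : ∀ {x y : ℝ}, |y - x| ≤ 1 / 10 → 2 * π ≤ |β - x| → |β - y| ≤ π + 2 → False :=
    fun {x y} h1 h2 h3 => by
    have := abs_sub_le β y x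
    linarith
  have hββ : ∀ {m n : ℤ}, |β - m * π| ≤ 1 → |β - n * π| ≤ 1 → n = m := fun h1 h2 =>
    int_eq_of_near h1 h2 (by norm_num)
  rcases h with ⟨rfl, h⟩ | ⟨m, n, hm, hn, hmn, rfl⟩
  · rcases h' with ⟨rfl, -⟩ | ⟨m', n', hm', hn', hmn', rfl⟩
    · rfl
    · exfalso
      rcases h with h | ⟨m, n, hm, hn, -, hmn⟩
      · exact far hα h (abs_sub_le_of_near hm' hn' hmn')
      · have h1 := int_eq_of_near hm hm' hα
        have h2 := hββ hn hn'
        omega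
  · rcases h' with ⟨rfl, h'⟩ | ⟨m', n', hm', hn', hmn', rfl⟩
    · exfalso
      rcases h' with h' | ⟨m', n', hm', hn', -, hmn'⟩
      · exact far (by rwa [abs_sub_comm]) h' (abs_sub_le_of_near hm hn hmn)
      · have h1 := int_eq_of_near hm hm' hα
        have h2 := hββ hn hn'
        omega
    · rw [int_eq_of_near hm hm' hα, hββ hn hn']

lemma Way.eq {α β : ℝ} {J J' : Set ℝ} (h : Way α β J) (h' : Way α β J') : J' = J :=
  h.eq_of_near h' (by norm_num)

lemma Way.isClosed {α β : ℝ} {J : Set ℝ} (h : Way α β J) : IsClosed J := by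
  rcases h with ⟨rfl, -⟩ | ⟨m, n, -, -, -, rfl⟩
  · exact isClosed_univ
  · exact isClosed_Icc

/-- Motions with end points in the second class of rotations have positive energy and start fast. -/
lemma energy_pos_of_near_bottoms {y p : ℝ → ℝ} {T : ℝ} (h : Traj y p) {m n : ℤ}
    (hm : |y 0 - m * π| ≤ 1) (hn : |y T - n * π| ≤ 1) (hodd : Odd m)
    (hmn : n = m + 2 ∨ n = m - 2) : 0 < energy (y 0) (p 0) ∧ 1 ≤ |p 0| := by
  have h1 := abs_le.1 hm
  have h2 := abs_le.1 hn
  have hπ := pi_gt_three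
  obtain ⟨j, hj⟩ := hodd
  have hE : 0 < energy (y 0) (p 0) := by
    rcases hmn with h3 | h3
    · obtain ⟨r, hr⟩ := h.exists_mem (s := 0) (t := T) (c := ((j + 1 : ℤ) : ℝ) * (2 * π))
        (mem_uIcc.2 (Or.inl (by
          rw [hj] at h1; rw [h3, hj] at h2; push_cast at h1 h2 ⊢; constructor <;> linarith)))
      exact h.energy_pos_of_mem (s := 0) (t := T) (r := r) (by
          intro he; rw [h3] at h2; push_cast at h2; linarith)
        (by rw [hr, cos_int_mul_two_pi])
    · obtain ⟨r, hr⟩ := h.exists_mem (s := 0) (t := T) (c := (j : ℝ) * (2 * π))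
        (mem_uIcc.2 (Or.inr (by
          rw [hj] at h1; rw [h3, hj] at h2; push_cast at h1 h2 ⊢; constructor <;> linarith)))
      exact h.energy_pos_of_mem (s := 0) (t := T) (r := r) (by
          intro he; rw [h3] at h2; push_cast at h2; linarith)
        (by rw [hr, cos_int_mul_two_pi])
  refine ⟨hE, ?_⟩
  have h3 := h.sq_vel' 0 0
  have h4 : cos (y 0) ≤ 0 := by
    have h5 : cos (y 0) = -cos (y 0 - m * π) := by
      have : y 0 - m * π = y 0 - π - j * (2 * π) := by rw [hj]; push_cast; ring
      rw [this, cos_sub_int_mul_two_pi, cos_sub_pi, neg_neg]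
    have := cos_ge_cos_one hm
    linarith
  refine (abs_le_of_sq_le_sq' (a := 1) (b := |p 0|) ?_ (abs_nonneg _)).2
  rw [sq_abs]
  linarith

/-- The normal forms of the classes of connections, up to the symmetries. -/
lemma Way.cases {α β : ℝ} {J : Set ℝ} (h : Way α β J) :
    (2 * π ≤ |β - α| ∨ ∃ m n : ℤ, |α - m * π| ≤ 1 ∧ |β - n * π| ≤ 1 ∧ Odd m ∧
      (n = m + 2 ∨ n = m - 2)) ∨
    ∃ (s : ℝ) (k : ℤ), (s = 1 ∨ s = -1) ∧
      ((|s * α + 2 * π * k| ≤ 1 ∧ |s * β + 2 * π * k - π| ≤ 1 ∧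
        ∀ y ∈ J, s * y + 2 * π * k ∈ Icc (-1) (π + 1)) ∨
      (|s * β + 2 * π * k| ≤ 1 ∧ |s * α + 2 * π * k - π| ≤ 1 ∧
        ∀ y ∈ J, s * y + 2 * π * k ∈ Icc (-1) (π + 1)) ∨
      ∀ y ∈ J, |s * y + 2 * π * k| ≤ 1) := by
  rcases h with ⟨-, h⟩ | ⟨m, n, hm, hn, h, rfl⟩
  · exact Or.inl h
  right
  rcases h with ⟨h, j, hj⟩ | h | h
  · refine ⟨1, -j, Or.inl rfl, Or.inr (Or.inr fun y hy => ?_)⟩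
    rw [h, min_self, max_self, hj] at hy
    push_cast at hy ⊢
    rw [abs_le]
    constructor <;> linarith [hy.1, hy.2]
  · have hmin : min m n = m := by omega
    have hmax : max m n = n := by omega
    rw [hmin, hmax]
    rcases Int.even_or_odd' m with ⟨j, hj | hj⟩
    · refine ⟨1, -j, Or.inl rfl, Or.inl ⟨?_, ?_, fun y hy => ?_⟩⟩
      · rw [hj] at hm; push_cast at hm ⊢; convert hm using 2; ring
      · rw [h, hj] at hn; push_cast at hn ⊢; convert hn using 2; ring
      · rw [h, hj] at hy; push_cast at hy ⊢; constructor <;> linarith [hy.1, hy.2]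
    · refine ⟨-1, j + 1, Or.inr rfl, Or.inr (Or.inl ⟨?_, ?_, fun y hy => ?_⟩)⟩
      · rw [h, hj] at hn; push_cast at hn ⊢; rw [← abs_neg]; convert hn using 2; ring
      · rw [hj] at hm; push_cast at hm ⊢; rw [← abs_neg]; convert hm using 2; ring
      · rw [h, hj] at hy; push_cast at hy ⊢; constructor <;> linarith [hy.1, hy.2]
  · have hmin : min m n = n := by omega
    have hmax : max m n = m := by omega
    rw [hmin, hmax]
    rcases Int.even_or_odd' m with ⟨j, hj | hj⟩
    · refine ⟨-1, j, Or.inr rfl, Or.inl ⟨?_, ?_, fun y hy => ?_⟩⟩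
      · rw [hj] at hm; push_cast at hm ⊢; rw [← abs_neg]; convert hm using 2; ring
      · rw [h, hj] at hn; push_cast at hn ⊢; rw [← abs_neg]; convert hn using 2; ring
      · rw [h, hj] at hy; push_cast at hy ⊢; constructor <;> linarith [hy.1, hy.2]
    · refine ⟨1, -j, Or.inl rfl, Or.inr (Or.inl ⟨?_, ?_, fun y hy => ?_⟩)⟩
      · rw [h, hj] at hn; push_cast at hn ⊢; convert hn using 2; ring
      · rw [hj] at hm; push_cast at hm ⊢; convert hm using 2; ring
      · rw [h, hj] at hy; push_cast at hy ⊢; constructor <;> linarith [hy.1, hy.2]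

lemma Traj.symm {y p : ℝ → ℝ} (h : Traj y p) {s : ℝ} (hs : s = 1 ∨ s = -1) (k : ℤ) :
    Traj (fun t => s * y t + 2 * π * k) (fun t => s * p t) := by
  rcases hs with rfl | rfl
  · simpa using h.shift k
  · simpa using h.neg.shift k

lemma GoodPath.of_symm {y p : ℝ → ℝ} {T : ℝ} {s : ℝ} (hs : s = 1 ∨ s = -1) {k : ℤ}
    (h : GoodPath (fun t => s * y t + 2 * π * k) (fun t => s * p t) T) : GoodPath y p T := by
  rcases hs with rfl | rfl
  · simpa using h.shift (-k)
  · simpa using (h.shift (-k)).neg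

theorem Way.goodPath {y p : ℝ → ℝ} {T : ℝ} {J : Set ℝ} (hw : Way (y 0) (y T) J) (h : Traj y p)
    (hT : 0 < T) (hJ : ∀ t ∈ Icc 0 T, y t ∈ J) : GoodPath y p T := by
  rcases hw.cases with (hw | ⟨m, n, hm, hn, hodd, hmn⟩) |
    ⟨s, k, hs, ⟨h1, h2, h3⟩ | ⟨h1, h2, h3⟩ | h3⟩
  · exact goodPath_of_turn h hT (h.energy_pos_of_turn hw) (Or.inl hw)
  · have := energy_pos_of_near_bottoms h hm hn hodd hmn
    exact goodPath_of_turn h hT this.1 (Or.inr this.2)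
  · exact GoodPath.of_symm hs (k := k) (TopDown.goodPath ⟨h.symm hs k, hT, h1, h2, fun t ht =>
      h3 _ (hJ t ht)⟩)
  · refine GoodPath.of_symm hs (k := k) (goodPath_of_rev (h.symm hs k)
      ⟨(h.symm hs k).rev T, hT, by simpa using h1, by simpa using h2, fun t ht =>
      h3 _ (hJ _ ⟨by linarith [ht.2], by linarith [ht.1]⟩)⟩)
  · exact GoodPath.of_symm hs (k := k) (goodPath_near_top (h.symm hs k) hT fun t ht =>
      h3 _ (hJ t ht))

lemma TopDown.unique {y p y' p' : ℝ → ℝ} {T : ℝ} (h : TopDown y p T) (h' : TopDown y' p' T)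
    (h0 : y 0 = y' 0) (h1 : y T = y' T) : p 0 = p' 0 := by
  obtain ⟨e1, e2⟩ := h.traj.eq_flow
  obtain ⟨e1', e2'⟩ := h'.traj.eq_flow
  rw [← h0] at e1' e2'
  have h2 : TopDown (flowPos (y 0) (p 0)) (flowVel (y 0) (p 0)) T := by
    convert h using 1
    exacts [e1.symm, e2.symm]
  have h3 : TopDown (flowPos (y 0) (p' 0)) (flowVel (y 0) (p' 0)) T := by
    convert h' using 1
    exacts [e1'.symm, e2'.symm]
  refine h2.vel_unique h3 ?_
  rw [← e1, ← e1', h1]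

theorem Way.unique {y p y' p' : ℝ → ℝ} {T : ℝ} {J : Set ℝ} (hw : Way (y 0) (y T) J) (h : Traj y p)
    (h' : Traj y' p') (hT : 0 < T) (hJ : ∀ t ∈ Icc 0 T, y t ∈ J) (hJ' : ∀ t ∈ Icc 0 T, y' t ∈ J)
    (h0 : y 0 = y' 0) (h1 : y T = y' T) : y = y' ∧ p = p' := by
  have hs0 : ∀ {s : ℝ}, (s = 1 ∨ s = -1) → s ≠ 0 := fun hs => by
    rcases hs with rfl | rfl <;> norm_num
  have rot : (∀ v, flowPos (y 0) v T = y T → GoodPath (flowPos (y 0) v) (flowVel (y 0) v) T) →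
      y = y' ∧ p = p' := fun hg => by
    refine h.unique h' (t₀ := 0) h0 (vel_unique_of_goodPath hT hg ?_ ?_)
    · rw [← h.eq_flow.1]
    · rw [h0, ← h'.eq_flow.1, h1]
  rcases hw.cases with (hw | ⟨m, n, hm, hn, hodd, hmn⟩) |
    ⟨s, k, hs, ⟨h4, h5, h6⟩ | ⟨h4, h5, h6⟩ | h6⟩
  · refine rot fun v hv => ?_
    have hD : 2 * π ≤ |flowPos (y 0) v T - flowPos (y 0) v 0| := by rwa [hv, flowPos_zero]
    exact goodPath_of_turn (traj_flow _ v) hT ((traj_flow _ v).energy_pos_of_turn hD) (Or.inl hD)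
  · refine rot fun v hv => ?_
    have := energy_pos_of_near_bottoms (T := T) (traj_flow (y 0) v) (by rwa [flowPos_zero])
      (by rwa [hv]) hodd hmn
    exact goodPath_of_turn (traj_flow _ v) hT this.1 (Or.inr this.2)
  · have a1 : TopDown _ _ T := ⟨h.symm hs k, hT, h4, h5, fun t ht => h6 _ (hJ t ht)⟩
    have a2 : TopDown _ _ T := ⟨h'.symm hs k, hT, by rwa [← h0], by rwa [← h1],
      fun t ht => h6 _ (hJ' t ht)⟩
    have := a1.unique a2 (by simp only [h0]) (by simp only [h1])
    exact h.unique h' h0 (mul_left_cancel₀ (hs0 hs) this)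
  · have a1 : TopDown _ _ T := ⟨(h.symm hs k).rev T, hT, by simpa using h4, by simpa using h5,
      fun t ht => h6 _ (hJ _ ⟨by linarith [ht.2], by linarith [ht.1]⟩)⟩
    have a2 : TopDown _ _ T := ⟨(h'.symm hs k).rev T, hT, by simpa [← h1] using h4,
      by simpa [← h0] using h5,
      fun t ht => h6 _ (hJ' _ ⟨by linarith [ht.2], by linarith [ht.1]⟩)⟩
    have := a1.unique a2 (by simp [h1]) (by simp [h0])
    simp only [sub_zero, neg_inj] at this
    exact h.unique h' h1 (mul_left_cancel₀ (hs0 hs) this)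
  · have := near_top_unique hT (h.symm hs k) (h'.symm hs k) (fun t ht => h6 _ (hJ t ht))
      (fun t ht => h6 _ (hJ' t ht)) (by simp only [h0]) (by simp only [h1])
    refine h.unique h' h0 (t₀ := 0) (mul_left_cancel₀ (hs0 hs) (congrFun this.2 0))

/-- Every endpoint condition places the pair in a class; the interval of the class is
the larger one. -/
lemma way_of_route {a b : ℝ} {I : Set ℝ} (h : Route a b I) :
    ∃ J, Way (a - π) (b - π) J ∧ ∀ x ∈ I, x - π ∈ J := by
  obtain ⟨k, s, α, β, I₀, hs, hB, rfl, rfl, rfl⟩ := h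
  have hπ := pi_gt_three
  rcases hB with ⟨h1, h2, rfl⟩ | ⟨h1, h2, rfl⟩ | ⟨h1, h2, rfl⟩ | ⟨h1, rfl⟩ | ⟨h1, h2, rfl⟩
  · have h1' := abs_le.1 h1
    have h2' := abs_le.1 h2
    have hmax : max β π ≤ π + 1 := max_le (by linarith) (by linarith)
    rcases hs with rfl | rfl
    · refine ⟨_, Or.inr ⟨2 * k - 1, 2 * k, ?_, ?_, Or.inr (Or.inl (by ring)), rfl⟩, ?_⟩
      · push_cast; convert h1 using 2; ring
      · push_cast; convert h2 using 2; ring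
      · rintro _ ⟨x, hx, rfl⟩
        rw [min_eq_left (by omega), max_eq_right (by omega)]
        push_cast
        constructor <;> linarith [hx.1, hx.2]
    · refine ⟨_, Or.inr ⟨2 * k - 1, 2 * k - 2, ?_, ?_, Or.inr (Or.inr (by ring)), rfl⟩, ?_⟩
      · push_cast; rw [← abs_neg]; convert h1 using 2; ring
      · push_cast; rw [← abs_neg]; convert h2 using 2; ring
      · rintro _ ⟨x, hx, rfl⟩
        rw [min_eq_right (by omega), max_eq_left (by omega)]
        push_cast
        constructor <;> linarith [hx.1, hx.2]
  · have h1' := abs_le.1 h1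
    have h2' := abs_le.1 h2
    rcases hs with rfl | rfl
    · refine ⟨_, Or.inr ⟨2 * k - 2, 2 * k - 1, ?_, ?_, Or.inr (Or.inl (by ring)), rfl⟩, ?_⟩
      · push_cast; convert h1 using 2; ring
      · push_cast; convert h2 using 2; ring
      · rintro _ ⟨x, hx, rfl⟩
        rw [min_eq_left (by omega), max_eq_right (by omega)]
        push_cast
        constructor <;> linarith [hx.1, hx.2]
    · refine ⟨_, Or.inr ⟨2 * k, 2 * k - 1, ?_, ?_, Or.inr (Or.inr (by ring)), rfl⟩, ?_⟩
      · push_cast; rw [← abs_neg]; convert h1 using 2; ring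
      · push_cast; rw [← abs_neg]; convert h2 using 2; ring
      · rintro _ ⟨x, hx, rfl⟩
        rw [min_eq_right (by omega), max_eq_left (by omega)]
        push_cast
        constructor <;> linarith [hx.1, hx.2]
  · refine ⟨univ, Or.inl ⟨rfl, Or.inr ?_⟩, fun _ _ => mem_univ _⟩
    rcases hs with rfl | rfl
    · refine ⟨2 * k - 1, 2 * k + 1, ?_, ?_, ⟨k - 1, by ring⟩, Or.inl (by ring)⟩
      · push_cast; convert h1 using 2; ring
      · push_cast; convert h2 using 2; ring
    · refine ⟨2 * k - 1, 2 * k - 3, ?_, ?_, ⟨k - 1, by ring⟩, Or.inr (by ring)⟩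
      · push_cast; rw [← abs_neg]; convert h1 using 2; ring
      · push_cast; rw [← abs_neg]; convert h2 using 2; ring
  · refine ⟨univ, Or.inl ⟨rfl, Or.inl ?_⟩, fun _ _ => mem_univ _⟩
    rcases hs with rfl | rfl
    · exact le_abs.2 (Or.inl (by linarith))
    · exact le_abs.2 (Or.inr (by linarith))
  · rcases hs with rfl | rfl
    · refine ⟨_, Or.inr ⟨2 * k, 2 * k, ?_, ?_, Or.inl ⟨rfl, even_two_mul k⟩, rfl⟩, ?_⟩
      · push_cast; convert h1 using 2; ring
      · push_cast; convert h2 using 2; ring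
      · rintro _ ⟨x, hx, rfl⟩
        rw [min_self, max_self]
        push_cast
        constructor <;> linarith [hx.1, hx.2]
    · refine ⟨_, Or.inr ⟨2 * (k - 1), 2 * (k - 1), ?_, ?_, Or.inl ⟨rfl, even_two_mul _⟩, rfl⟩, ?_⟩
      · push_cast; rw [← abs_neg]; convert h1 using 2; ring
      · push_cast; rw [← abs_neg]; convert h2 using 2; ring
      · rintro _ ⟨x, hx, rfl⟩
        rw [min_self, max_self]
        push_cast
        constructor <;> linarith [hx.1, hx.2]

lemma exists_traj_of_baseRoute {a b T : ℝ} {I : Set ℝ} (h : BaseRoute a b I) (hT : 0 < T) :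
    ∃ y p, Traj y p ∧ y 0 = a - π ∧ y T = b - π ∧ ∀ t ∈ Icc 0 T, y t + π ∈ I := by
  have hπ := pi_gt_three
  have rot : a ≤ b → (∀ v, flowPos (a - π) v T = b - π →
      0 < energy (flowPos (a - π) v 0) (flowVel (a - π) v 0)) →
      ∃ y p, Traj y p ∧ y 0 = a - π ∧ y T = b - π ∧ ∀ t ∈ Icc 0 T, y t + π ∈ Icc a b :=
    fun hab hE => by
    obtain ⟨v, hv⟩ := exists_flowPos_eq (a - π) (b - π) hT
    refine ⟨_, _, traj_flow (a - π) v, flowPos_zero _ _, hv, fun t ht => ?_⟩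
    have := (traj_flow (a - π) v).mem_of_energy_pos (hE v hv) (by rw [flowPos_zero, hv]; linarith)
      hT t ht
    rw [hv, flowPos_zero] at this
    constructor <;> linarith [this.1, this.2]
  rcases h with ⟨h1, h2, rfl⟩ | ⟨h1, h2, rfl⟩ | ⟨h1, h2, rfl⟩ | ⟨h1, rfl⟩ | ⟨h1, h2, rfl⟩
  · obtain ⟨z, p, hz, h3, h4, h5⟩ := exists_topDown (a := π - b) (b := π - a) hT
      (by rwa [abs_sub_comm]) (by rw [abs_sub_comm]; simpa using h1)
    refine ⟨_, _, (hz.rev T).neg, by simp [h4], by simp [h3], fun t ht => ?_⟩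
    have := h5 (T - t) ⟨by linarith [ht.2], by linarith [ht.1]⟩
    refine ⟨by linarith [this.2], ?_⟩
    rcases min_le_iff.1 this.1 with h | h
    · exact le_max_of_le_left (by linarith)
    · exact le_max_of_le_right (by linarith)
  · obtain ⟨z, p, hz, h3, h4, h5⟩ := exists_topDown (a := a + π) (b := b + π) hT h1
      (by simpa using h2)
    refine ⟨_, _, hz.shift (-1), by rw [h3]; push_cast; ring, by rw [h4]; push_cast; ring,
      fun t ht => ?_⟩
    have := h5 t ht
    have h1' := abs_le.1 h1
    have h2' := abs_le.1 h2
    have : -1 ≤ min (a + π) 0 := le_min h1'.1 (by norm_num)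
    push_cast
    constructor <;> linarith [(h5 t ht).1, (h5 t ht).2]
  · have h1' := abs_le.1 h1
    have h2' := abs_le.1 h2
    obtain ⟨y, p, hy, h3, h4, h5⟩ := rot (by linarith) (fun v hv =>
      (energy_pos_of_near_bottoms (T := T) (m := -1) (n := 1) (traj_flow (a - π) v)
        (by rw [flowPos_zero]; push_cast; convert h1 using 2; ring)
        (by rw [hv]; push_cast; convert h2 using 2; ring) ⟨-1, by norm_num⟩
        (Or.inl (by norm_num))).1)
    exact ⟨y, p, hy, h3, h4, fun t ht => ⟨by linarith [(h5 t ht).1], by linarith [(h5 t ht).2]⟩⟩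
  · exact rot (by linarith) fun v hv => (traj_flow (a - π) v).energy_pos_of_turn (s := 0) (t := T)
      (by rw [hv, flowPos_zero]; exact le_abs.2 (Or.inl (by linarith)))
  · obtain ⟨y, p, hy, h3, h4, h5⟩ := exists_near_top hT h1 h2
    refine ⟨y, p, hy, h3, h4, fun t ht => ?_⟩
    have := abs_le.1 (h5 t ht)
    constructor <;> linarith [this.1, this.2]

/-- For every endpoint condition and every travel time there is a motion confined to the prescribed
interval. -/
lemma exists_traj_of_route {a b T : ℝ} {I : Set ℝ} (h : Route a b I) (hT : 0 < T) :
    ∃ y p, Traj y p ∧ y 0 = a - π ∧ y T = b - π ∧ ∀ t ∈ Icc 0 T, y t + π ∈ I := by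
  obtain ⟨k, s, α, β, I₀, hs, hB, rfl, rfl, rfl⟩ := h
  obtain ⟨y, p, hy, h1, h2, h3⟩ := exists_traj_of_baseRoute hB hT
  rcases hs with rfl | rfl
  · refine ⟨_, _, hy.shift k, by rw [h1]; ring, by rw [h2]; ring, fun t ht => ?_⟩
    exact ⟨_, h3 t ht, by ring⟩
  · refine ⟨_, _, hy.neg.shift (k - 1), by rw [h1]; push_cast; ring, by rw [h2]; push_cast; ring,
      fun t ht => ?_⟩
    exact ⟨_, h3 t ht, by push_cast; ring⟩

/-! ### The initial velocity as a function of the initial position and the travel time -/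

/-- The end points, as angles from the top, satisfy one of the endpoint conditions. -/
def Linked (α β : ℝ) : Prop := ∃ I, Route (α + π) (β + π) I

/-- The initial velocity `v` leads from `α` to `β` in time `T` inside the interval of the class. -/
def IsConnVel (α β T v : ℝ) : Prop :=
  ∃ J, Way α β J ∧ flowPos α v T = β ∧ ∀ t ∈ Icc 0 T, flowPos α v t ∈ J

/-- The initial velocity of the connection from `α` to `β` in time `T`. -/
noncomputable def connVel (α β T : ℝ) : ℝ := Classical.epsilon (IsConnVel α β T)

lemma IsConnVel.unique {α β T v v' : ℝ} (hT : 0 < T) (h : IsConnVel α β T v)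
    (h' : IsConnVel α β T v') : v = v' := by
  obtain ⟨J, h1, h2, h3⟩ := h
  obtain ⟨J', h1', h2', h3'⟩ := h'
  obtain rfl := h1.eq h1'
  have := Way.unique (y := flowPos α v) (y' := flowPos α v') (by rwa [flowPos_zero, h2])
    (traj_flow α v) (traj_flow α v') hT h3 h3' (by simp) (by rw [h2, h2'])
  simpa using congrFun this.2 0

lemma IsConnVel.goodPath {α β T v : ℝ} (hT : 0 < T) (h : IsConnVel α β T v) :
    GoodPath (flowPos α v) (flowVel α v) T := by
  obtain ⟨J, h1, h2, h3⟩ := h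
  exact Way.goodPath (by rwa [flowPos_zero, h2]) (traj_flow α v) hT h3

/-- The connection in the narrower interval of the endpoint conditions. -/
lemma Linked.exists_conn {α β T : ℝ} (h : Linked α β) (hT : 0 < T) :
    ∃ v, IsConnVel α β T v ∧ ∃ I, Route (α + π) (β + π) I ∧
      ∀ t ∈ Icc 0 T, flowPos α v t + π ∈ I := by
  obtain ⟨I, hI⟩ := h
  obtain ⟨y, p, hy, h0, h1, h2⟩ := exists_traj_of_route hI hT
  obtain ⟨J, hJ, hIJ⟩ := way_of_route hI
  rw [add_sub_cancel_right] at h0 h1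
  simp only [add_sub_cancel_right] at hJ
  have he := hy.eq_flow.1
  rw [h0] at he
  have hJ' : ∀ t ∈ Icc 0 T, y t ∈ J := fun t ht => by simpa using hIJ _ (h2 t ht)
  rw [he] at h1 h2 hJ'
  exact ⟨p 0, ⟨J, hJ, h1, hJ'⟩, I, hI, h2⟩

lemma Linked.isConnVel {α β T : ℝ} (h : Linked α β) (hT : 0 < T) :
    IsConnVel α β T (connVel α β T) :=
  Classical.epsilon_spec (h.exists_conn hT |>.imp fun _ h => h.1)

lemma Linked.flowPos_connVel {α β T : ℝ} (h : Linked α β) (hT : 0 < T) :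
    flowPos α (connVel α β T) T = β := by
  obtain ⟨J, -, h, -⟩ := h.isConnVel hT
  exact h

lemma Linked.exists_route {α β T : ℝ} (h : Linked α β) (hT : 0 < T) :
    ∃ I, Route (α + π) (β + π) I ∧ ∀ t ∈ Icc 0 T, flowPos α (connVel α β T) t + π ∈ I := by
  obtain ⟨v, hv, h'⟩ := h.exists_conn hT
  rwa [(h.isConnVel hT).unique hT hv]

lemma Linked.abs_connVel_le {α β T : ℝ} (h : Linked α β) (hT : 0 < T) :
    |connVel α β T| ≤ |β - α| / T + T := by
  have h1 := (traj_flow α (connVel α β T)).pos_ge hT.le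
  rw [h.flowPos_connVel hT, flowPos_zero, flowVel_zero] at h1
  have h2 : |connVel α β T * T| ≤ |β - α| + T ^ 2 := by
    have := abs_le.1 (le_refl |β - α|)
    rw [abs_le]
    constructor <;> linarith
  rw [abs_mul, abs_of_pos hT] at h2
  have : |β - α| / T + T = (|β - α| + T ^ 2) / T := by field_simp
  rw [this, le_div_iff₀ hT]
  exact h2

/-- Limits of connections are connections; by uniqueness the initial velocity is continuous. -/
lemma continuousWithinAt_connVel {α β T : ℝ} (h : Linked α β) (hT : 0 < T) :
    ContinuousWithinAt (fun z : ℝ × ℝ => connVel z.1 β z.2) ({α | Linked α β} ×ˢ Ioi 0) (α, T) := by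
  set S : Set (ℝ × ℝ) := {α | Linked α β} ×ˢ Ioi 0
  have hbound : ∀ᶠ z in 𝓝[S] (α, T), connVel z.1 β z.2 ∈
      Metric.closedBall (0 : ℝ) (|β - α| / T + T + 1) := by
    have hc : ContinuousAt (fun z : ℝ × ℝ => |β - z.1| / z.2 + z.2) (α, T) := by
      have := hT.ne'
      refine ContinuousAt.add (ContinuousAt.div (by fun_prop) (by fun_prop) this) (by fun_prop)
    have h1 := hc.eventually (gt_mem_nhds (show |β - α| / T + T < |β - α| / T + T + 1 by linarith))
    filter_upwards [eventually_nhdsWithin_of_eventually_nhds h1, self_mem_nhdsWithin] with z hz hzS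
    rw [mem_closedBall_zero_iff, Real.norm_eq_abs]
    exact (Linked.abs_connVel_le hzS.1 hzS.2).trans hz.le
  refine (isCompact_closedBall _ _).tendsto_nhds_of_unique_mapClusterPt hbound fun v _ hv => ?_
  obtain ⟨U, hU, hUv⟩ := mapClusterPt_iff_ultrafilter.1 hv
  refine IsConnVel.unique hT ?_ (h.isConnVel hT)
  obtain ⟨J, hJ, -, -⟩ := h.isConnVel hT
  have hid : Tendsto (fun z : ℝ × ℝ => z) U (𝓝 (α, T)) := hU.trans nhdsWithin_le_nhds
  have hS : ∀ᶠ z in (U : Filter (ℝ × ℝ)), z ∈ S := hU self_mem_nhdsWithin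
  have h1 : Tendsto (fun z : ℝ × ℝ => z.1) U (𝓝 α) := hid.fst_nhds
  have h2 : Tendsto (fun z : ℝ × ℝ => z.2) U (𝓝 T) := hid.snd_nhds
  have hflow : ∀ θ : ℝ, Tendsto (fun z : ℝ × ℝ => flowPos z.1 (connVel z.1 β z.2) (θ * z.2)) U
      (𝓝 (flowPos α v (θ * T))) := fun θ =>
    (continuous_flowPos.tendsto (α, v, θ * T)).comp
      (h1.prodMk_nhds (hUv.prodMk_nhds (h2.const_mul θ)))
  have hJev : ∀ᶠ z in (U : Filter (ℝ × ℝ)), ∀ t ∈ Icc 0 z.2,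
      flowPos z.1 (connVel z.1 β z.2) t ∈ J := by
    filter_upwards [hS, h1.eventually (Metric.closedBall_mem_nhds α (show (0 : ℝ) < 1 / 10 by
      norm_num))] with z hz hzα
    obtain ⟨J', hJ', -, h3⟩ := hz.1.isConnVel hz.2
    rwa [hJ.eq_of_near hJ' (by simpa [Real.dist_eq] using hzα)] at h3
  refine ⟨J, hJ, ?_, fun t ht => ?_⟩
  · have h3 := hflow 1
    simp only [one_mul] at h3
    refine tendsto_nhds_unique_of_eventuallyEq h3 tendsto_const_nhds ?_
    filter_upwards [hS] with z hz
    exact hz.1.flowPos_connVel hz.2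
  · have h3 := hflow (t / T)
    rw [div_mul_cancel₀ _ hT.ne'] at h3
    refine hJ.isClosed.mem_of_tendsto h3 ?_
    filter_upwards [hS, hJev] with z hz hzJ
    have hz2 : 0 < z.2 := hz.2
    refine hzJ _ ⟨mul_nonneg (div_nonneg ht.1 hT.le) hz2.le, ?_⟩
    exact mul_le_of_le_one_left hz2.le ((div_le_one hT).2 ht.2)

/-- Implicit differentiation of a continuous function. -/
lemma hasFDerivWithinAt_implicit {E : Type*} [NormedAddCommGroup E] [NormedSpace ℝ E] {v : E → ℝ}
    {S : Set E} {z₀ : E} {F : E × ℝ → ℝ} {U : Set (E × ℝ)} {A : E →L[ℝ] ℝ} {d : ℝ}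
    (hv : ContinuousWithinAt v S z₀)
    (hF : HasFDerivWithinAt F (A.comp (ContinuousLinearMap.fst ℝ E ℝ) +
      d • ContinuousLinearMap.snd ℝ E ℝ) U (z₀, v z₀)) (hd : d ≠ 0)
    (h : ∀ z ∈ S, (z, v z) ∈ U ∧ F (z, v z) = F (z₀, v z₀)) :
    HasFDerivWithinAt v (-(d⁻¹ • A)) S z₀ := by
  have htend : Tendsto (fun z => (z, v z)) (𝓝[S] z₀) (𝓝[U] (z₀, v z₀)) :=
    tendsto_nhdsWithin_iff.2 ⟨(tendsto_nhdsWithin_of_tendsto_nhds tendsto_id).prodMk_nhds hv,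
      eventually_nhdsWithin_of_forall fun z hz => (h z hz).1⟩
  have h1 := (hasFDerivWithinAt_iff_isLittleO.1 hF).comp_tendsto htend
  -- the error of the linearization, relative to the increments of both variables
  have h2 : ∀ c : ℝ, 0 < c → ∀ᶠ z in 𝓝[S] z₀,
      |v z - v z₀ + d⁻¹ * A (z - z₀)| ≤ c * (‖z - z₀‖ + |v z - v z₀|) := fun c hc => by
    have hc' : 0 < c * |d| := mul_pos hc (abs_pos.2 hd)
    filter_upwards [h1.def hc', self_mem_nhdsWithin] with z hz hzS
    simp only [Function.comp_apply, (h z hzS).2, sub_self, zero_sub, norm_neg, Prod.mk_sub_mk,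
      add_apply, ContinuousLinearMap.comp_apply, smul_apply,
      ContinuousLinearMap.coe_fst', ContinuousLinearMap.coe_snd',
      smul_eq_mul, Real.norm_eq_abs, Prod.norm_def] at hz
    have h3 : A (z - z₀) + d * (v z - v z₀) = d * (v z - v z₀ + d⁻¹ * A (z - z₀)) := by
      field_simp
      ring
    rw [h3, abs_mul] at hz
    have h4 : max ‖z - z₀‖ |v z - v z₀| ≤ ‖z - z₀‖ + |v z - v z₀| :=
      max_le (by linarith [abs_nonneg (v z - v z₀)]) (by linarith [norm_nonneg (z - z₀)])
    have h5 := mul_le_mul_of_nonneg_left h4 hc'.le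
    have h6 : |d| * |v z - v z₀ + d⁻¹ * A (z - z₀)| ≤
      |d| * (c * (‖z - z₀‖ + |v z - v z₀|)) := by linarith
    exact le_of_mul_le_mul_left h6 (abs_pos.2 hd)
  rw [hasFDerivWithinAt_iff_isLittleO]
  refine Asymptotics.isLittleO_iff.2 fun c hc => ?_
  set K := 2 * (‖d⁻¹ • A‖ + 1) + 1 with hK
  have hK0 : 0 < K := by positivity
  filter_upwards [h2 (1 / 2) (by norm_num), h2 (c / K) (by positivity)] with z h3 h4
  have h5 : |d⁻¹ * A (z - z₀)| ≤ ‖d⁻¹ • A‖ * ‖z - z₀‖ := by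
    simpa using (d⁻¹ • A).le_opNorm (z - z₀)
  have h6 : |v z - v z₀| ≤ 2 * (‖d⁻¹ • A‖ + 1) * ‖z - z₀‖ := by
    have := abs_sub (v z - v z₀ + d⁻¹ * A (z - z₀)) (d⁻¹ * A (z - z₀))
    rw [add_sub_cancel_right] at this
    linarith [norm_nonneg (z - z₀)]
  have h7 : ‖z - z₀‖ + |v z - v z₀| ≤ K * ‖z - z₀‖ := by rw [hK]; linarith
  have h8 : c / K * (‖z - z₀‖ + |v z - v z₀|) ≤ c * ‖z - z₀‖ := by
    calc c / K * (‖z - z₀‖ + |v z - v z₀|) ≤ c / K * (K * ‖z - z₀‖) :=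
          mul_le_mul_of_nonneg_left h7 (by positivity)
      _ = c * ‖z - z₀‖ := by field_simp
  simpa [Real.norm_eq_abs] using h4.trans h8

lemma hasFDerivWithinAt_connVel {α β T : ℝ} (h : Linked α β) (hT : 0 < T)
    {φ φ₁ ψ ψ₁ : ℝ → ℝ} (hφ : JacVel (flowPos α (connVel α β T)) φ φ₁)
    (hψ : JacPos (flowPos α (connVel α β T)) ψ ψ₁) :
    HasFDerivWithinAt (fun z : ℝ × ℝ => connVel z.1 β z.2)
      (-((φ T)⁻¹ • (ψ T • ContinuousLinearMap.fst ℝ ℝ ℝ +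
        flowVel α (connVel α β T) T • ContinuousLinearMap.snd ℝ ℝ ℝ)))
      ({α | Linked α β} ×ˢ Ioi 0) (α, T) := by
  have hpos := ((h.isConnVel hT).goodPath hT).jac_pos φ φ₁ hφ
  have h1 := hasFDerivAt_flowPos hT hφ hψ
  have h2 : HasFDerivAt (fun w : (ℝ × ℝ) × ℝ => ((w.1.1, w.2, w.1.2) : ℝ × ℝ × ℝ))
      (((ContinuousLinearMap.fst ℝ ℝ ℝ).comp (ContinuousLinearMap.fst ℝ (ℝ × ℝ) ℝ)).prod
        ((ContinuousLinearMap.snd ℝ (ℝ × ℝ) ℝ).prod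
          ((ContinuousLinearMap.snd ℝ ℝ ℝ).comp (ContinuousLinearMap.fst ℝ (ℝ × ℝ) ℝ))))
      ((α, T), connVel α β T) :=
    (hasFDerivAt_fst.fst).prodMk (hasFDerivAt_snd.prodMk (hasFDerivAt_fst.snd))
  have h3 := HasFDerivAt.comp (f := fun w : (ℝ × ℝ) × ℝ => ((w.1.1, w.2, w.1.2) : ℝ × ℝ × ℝ))
    ((α, T), connVel α β T) h1 h2
  refine hasFDerivWithinAt_implicit (d := φ T) (U := univ) (continuousWithinAt_connVel h hT)
    ((h3.congr_fderiv ?_).hasFDerivWithinAt) hpos.ne' fun z hz => ⟨mem_univ _, ?_⟩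
  · ext <;> simp
  · simp only [Function.comp_apply]
    rw [hz.1.flowPos_connVel hz.2, h.flowPos_connVel hT]

/-! ### The energy of a connection as a function of its travel time -/

/-- The energy of the connection from `α` to `β` in time `T`. -/
noncomputable def connEnergy (α β T : ℝ) : ℝ := energy α (connVel α β T)

namespace Linked

variable {α β T : ℝ}

lemma goodPath (h : Linked α β) (hT : 0 < T) :
    GoodPath (flowPos α (connVel α β T)) (flowVel α (connVel α β T)) T :=
  (h.isConnVel hT).goodPath hT

lemma energy_ge (h : Linked α β) (hT : 0 < T) : -1 / 2 ≤ connEnergy α β T := by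
  have := (h.goodPath hT).energy_ge
  rwa [flowPos_zero, flowVel_zero] at this

/-- A fast connection has a large energy. -/
lemma le_energy (h : Linked α β) (hT : 0 < T) :
    (β - α) ^ 2 / (2 * T ^ 2) - 2 ≤ connEnergy α β T := by
  have hy := traj_flow α (connVel α β T)
  have hE := h.energy_ge hT
  set E := connEnergy α β T with hEdef
  have hp : ∀ t, |flowVel α (connVel α β T) t| ≤ √(2 * E + 4) := fun t => by
    apply Real.abs_le_sqrt
    have := hy.sq_vel_le t
    rwa [flowPos_zero, flowVel_zero] at this
  have h1 := mul_sub_le_of_le_deriv (f := flowPos α (connVel α β T)) hT.le (fun t _ => hy.pos t)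
    (fun t _ => (abs_le.1 (hp t)).1)
  have h2 := sub_le_mul_of_deriv_le (f := flowPos α (connVel α β T)) hT.le (fun t _ => hy.pos t)
    (fun t _ => (abs_le.1 (hp t)).2)
  rw [h.flowPos_connVel hT, flowPos_zero, sub_zero] at h1 h2
  have h3 : (β - α) ^ 2 ≤ (√(2 * E + 4) * T) ^ 2 := sq_le_sq' (by linarith) h2
  rw [mul_pow, Real.sq_sqrt (by linarith)] at h3
  rw [sub_le_iff_le_add, div_le_iff₀ (by positivity)]
  linarith

/-- A slow connection has a small energy. -/
lemma energy_le (h : Linked α β) (hT : 0 < T) :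
    connEnergy α β T ≤ (β - α) ^ 2 / (2 * T ^ 2) := by
  rcases le_or_gt (connEnergy α β T) 0 with hE | hE
  · exact hE.trans (by positivity)
  have h1 := (h.goodPath hT).time_eq
  rw [flowPos_zero, flowVel_zero, h.flowPos_connVel hT] at h1
  have h2 := h1 hE
  set E := connEnergy α β T with hEdef
  have h3 : |∫ x in α..β, slowness E x| ≤ (√(2 * E))⁻¹ * |β - α| := by
    have := intervalIntegral.norm_integral_le_of_norm_le_const (a := α) (b := β)
      (f := slowness E) (C := (√(2 * E))⁻¹) (fun x _ => by
        rw [Real.norm_eq_abs, abs_of_pos (slowness_pos hE x)]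
        exact slowness_le hE x)
    rwa [Real.norm_eq_abs] at this
  have h4 : T ≤ (√(2 * E))⁻¹ * |β - α| := h2.le.trans h3
  have h5 : 0 < √(2 * E) := Real.sqrt_pos.2 (by linarith)
  rw [inv_mul_eq_div, le_div_iff₀ h5] at h4
  have h6 : (T * √(2 * E)) ^ 2 ≤ (β - α) ^ 2 := by
    rw [← sq_abs (β - α)]
    gcongr
  rw [mul_pow, Real.sq_sqrt (by linarith)] at h6
  rw [le_div_iff₀ (by positivity)]
  linarith

/-- The partial derivatives of the initial velocity, with their a priori bounds. -/
lemma exists_deriv (h : Linked α β) (hT : 0 < T) : ∃ A B : ℝ,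
    HasFDerivWithinAt (fun z : ℝ × ℝ => connVel z.1 β z.2)
      (A • ContinuousLinearMap.fst ℝ ℝ ℝ + B • ContinuousLinearMap.snd ℝ ℝ ℝ)
      ({α | Linked α β} ×ˢ Ioi 0) (α, T) ∧
    T * (connVel α β T * B) ≤ -2 * connEnergy α β T + 13 / 20 ∧
    (0 < connEnergy α β T → T * (connVel α β T * B) ≤ -2 * connEnergy α β T) ∧
    (1 / 5 ≤ T → connEnergy α β T ≤ 5 / 2 → |A| ≤ 100 ∧ T * |B| ≤ 100) := by
  have hg := h.goodPath hT
  have hy := traj_flow α (connVel α β T)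
  obtain ⟨φ, φ₁, hφ⟩ := exists_jacVel hy.continuous
  obtain ⟨ψ, ψ₁, hψ⟩ := exists_jacPos hy.continuous
  have hpos := hg.jac_pos φ φ₁ hφ
  have hs := hg.energy_slope_le φ φ₁ hφ
  have hs' := fun hE => hg.energy_slope_le_of_pos hE φ φ₁ hφ
  have hb := fun h5 hE => hg.time_mul_vel_le h5 hE φ φ₁ hφ
  have hb' := fun h5 hE => hg.jacPos_le h5 hE φ φ₁ ψ ψ₁ hφ hψ
  rw [flowPos_zero, flowVel_zero] at hs hs' hb hb'
  have hmul : ∀ P : ℝ, T * (connVel α β T * -(P / φ T)) = -(T * (connVel α β T * P)) / φ T :=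
    fun P => by ring
  refine ⟨-(ψ T / φ T), -(flowVel α (connVel α β T) T / φ T), ?_, ?_, fun hE => ?_,
    fun h5 hE => ⟨?_, ?_⟩⟩
  · refine (hasFDerivWithinAt_connVel h hT hφ hψ).congr_fderiv ?_
    ext <;> simp <;> ring
  · rw [hmul, div_le_iff₀ hpos]
    exact hs
  · rw [hmul, div_le_iff₀ hpos]
    exact hs' hE
  · rw [abs_neg, abs_div, abs_of_pos hpos, div_le_iff₀ hpos]
    exact hb' h5 hE
  · rw [abs_neg, abs_div, abs_of_pos hpos, ← mul_div_assoc, div_le_iff₀ hpos]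
    exact hb h5 hE

end Linked

lemma hasFDerivWithinAt_connEnergy {α β T A B : ℝ} {S : Set (ℝ × ℝ)}
    (h : HasFDerivWithinAt (fun z : ℝ × ℝ => connVel z.1 β z.2)
      (A • ContinuousLinearMap.fst ℝ ℝ ℝ + B • ContinuousLinearMap.snd ℝ ℝ ℝ) S (α, T)) :
    HasFDerivWithinAt (fun z : ℝ × ℝ => connEnergy z.1 β z.2)
      ((connVel α β T * A - sin α) • ContinuousLinearMap.fst ℝ ℝ ℝ +
        (connVel α β T * B) • ContinuousLinearMap.snd ℝ ℝ ℝ) S (α, T) := by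
  have h1 := (((h.pow 2).mul_const (1 / 2 : ℝ)).add
    (hasFDerivWithinAt_fst (s := S) (p := (α, T))).cos).sub_const 1
  have h2 : (fun z : ℝ × ℝ => connEnergy z.1 β z.2) =
      fun z : ℝ × ℝ => connVel z.1 β z.2 ^ 2 * (1 / 2) + cos z.1 - 1 := by
    ext z; unfold connEnergy energy; ring
  rw [h2]
  refine h1.congr_fderiv ?_
  ext <;> simp <;> ring

/-! ### The travel time -/

/-- The total energy of the connection from `q` to `q'` in time `T`. -/
noncomputable def totalEnergy (q q' : Config) (T : ℝ) : ℝ :=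
  ∑ i, connEnergy (q i - π) (q' i - π) T

lemma linked_of_admissible {q q' : Config} (h : Admissible q q') (i : Fin 4) :
    Linked (q i - π) (q' i - π) := by
  obtain ⟨I, hI⟩ := h i
  exact ⟨I, by simpa using hI⟩

lemma sum_sq_eq (q q' : Config) : ∑ i, ((q' i - π) - (q i - π)) ^ 2 = ‖q' - q‖ ^ 2 := by
  rw [EuclideanSpace.real_norm_sq_eq]
  simp

/-- If the total energy is one, not all four energies are nonpositive, and at most three of them
can increase with the travel time. -/
lemma sum_slope_le {E e : Fin 4 → ℝ} (hE : ∑ i, E i = 1) (h1 : ∀ i, e i ≤ -2 * E i + 13 / 20)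
    (h2 : ∀ i, 0 < E i → e i ≤ -2 * E i) : ∑ i, e i ≤ -1 / 20 := by
  have h3 : ∃ i, 0 < E i := by
    by_contra! hle
    have := Finset.sum_nonpos (s := Finset.univ) fun i _ => hle i
    linarith
  obtain ⟨j, hj⟩ := h3
  rw [← Finset.add_sum_erase _ _ (Finset.mem_univ j)] at hE ⊢
  have h4 : ∑ i ∈ Finset.univ.erase j, e i ≤ ∑ i ∈ Finset.univ.erase j, (-2 * E i + 13 / 20) :=
    Finset.sum_le_sum fun i _ => h1 i
  rw [Finset.sum_add_distrib, ← Finset.mul_sum, Finset.sum_const,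
    Finset.card_erase_of_mem (Finset.mem_univ j), Finset.card_fin, nsmul_eq_mul,
    show ((4 - 1 : ℕ) : ℝ) = 3 by norm_num] at h4
  linarith [h2 j hj]

lemma exists_hasDerivAt_totalEnergy {q q' : Config} (h : Admissible q q') {T : ℝ} (hT : 0 < T) :
    ∃ d, HasDerivAt (totalEnergy q q') d T ∧ (totalEnergy q q' T = 1 → T * d ≤ -1 / 20) := by
  choose A B hAB h1 h2 h3 using fun i => (linked_of_admissible h i).exists_deriv hT
  refine ⟨∑ i, connVel (q i - π) (q' i - π) T * B i, HasDerivAt.fun_sum fun i _ => ?_,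
    fun hE => ?_⟩
  · have h4 := hasFDerivWithinAt_connEnergy (hAB i)
    have h5 : HasDerivWithinAt (fun t : ℝ => (q i - π, t)) ((0, 1) : ℝ × ℝ) (Ioi 0) T :=
      ((hasDerivAt_const T (q i - π)).prodMk (hasDerivAt_id T)).hasDerivWithinAt
    have h6 := h4.comp_hasDerivWithinAt T h5 (fun t ht => ⟨linked_of_admissible h i, ht⟩)
    refine (h6.hasDerivAt (Ioi_mem_nhds hT)).congr_deriv ?_
    simp
  · rw [Finset.mul_sum]
    exact sum_slope_le hE h1 h2

lemma totalEnergy_time_unique {q q' : Config} (h : Admissible q q') {T T' : ℝ} (hT : 0 < T)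
    (hT' : 0 < T') (hE : totalEnergy q q' T = 1) (hE' : totalEnergy q q' T' = 1) : T = T' := by
  have key : ∀ T T' : ℝ, 0 < T → totalEnergy q q' T = 1 → totalEnergy q q' T' = 1 → ¬T < T' :=
    fun T T' hT hE hE' hlt => by
    refine no_two_upcrossings (g := fun t => 1 - totalEnergy q q' t) hlt (fun t ht => ?_)
      (by simp [hE]) (by simp [hE']) fun t ht h0 => ?_
    · obtain ⟨d, hd, -⟩ := exists_hasDerivAt_totalEnergy h (hT.trans_le ht.1)
      exact (hd.const_sub 1).continuousAt.continuousWithinAt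
    · have ht0 := hT.trans_le ht.1
      obtain ⟨d, hd, hd'⟩ := exists_hasDerivAt_totalEnergy h ht0
      have h1 := hd' (by linarith)
      exact upcrossing_of_hasDerivAt (hd.const_sub 1) (by nlinarith) h0
  exact le_antisymm (not_lt.1 (key _ _ hT' hE' hE)) (not_lt.1 (key _ _ hT hE hE'))

lemma le_totalEnergy {q q' : Config} (h : Admissible q q') {T : ℝ} (hT : 0 < T) :
    ‖q' - q‖ ^ 2 / (2 * T ^ 2) - 8 ≤ totalEnergy q q' T := by
  have := Finset.sum_le_sum (s := Finset.univ) fun i _ => (linked_of_admissible h i).le_energy hT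
  rw [Finset.sum_sub_distrib, ← Finset.sum_div, sum_sq_eq] at this
  norm_num at this
  unfold totalEnergy
  linarith

lemma totalEnergy_le {q q' : Config} (h : Admissible q q') {T : ℝ} (hT : 0 < T) :
    totalEnergy q q' T ≤ ‖q' - q‖ ^ 2 / (2 * T ^ 2) := by
  have := Finset.sum_le_sum (s := Finset.univ) fun i _ => (linked_of_admissible h i).energy_le hT
  rwa [← Finset.sum_div, sum_sq_eq] at this

lemma exists_time {q q' : Config} (h : Admissible q q') (hne : q ≠ q') :
    ∃ T, 0 < T ∧ totalEnergy q q' T = 1 := by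
  set D := ‖q' - q‖ with hD
  have hD0 : 0 < D := norm_pos_iff.2 (sub_ne_zero.2 hne.symm)
  have h1 := le_totalEnergy h (show 0 < D / 5 by positivity)
  have h2 := totalEnergy_le h hD0
  rw [show ‖q' - q‖ ^ 2 / (2 * (D / 5) ^ 2) = 25 / 2 by rw [← hD]; field_simp; norm_num] at h1
  rw [show ‖q' - q‖ ^ 2 / (2 * D ^ 2) = 1 / 2 by rw [← hD]; field_simp] at h2
  obtain ⟨T, hT, hE⟩ := intermediate_value_Icc' (f := totalEnergy q q') (a := D / 5) (b := D)
    (by linarith) (fun t ht => by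
      obtain ⟨d, hd, -⟩ := exists_hasDerivAt_totalEnergy h (show 0 < t by linarith [ht.1])
      exact hd.continuousAt.continuousWithinAt)
    (show (1 : ℝ) ∈ Icc _ _ from ⟨by linarith, by linarith⟩)
  exact ⟨T, by linarith [hT.1], hE⟩

lemma time_bounds {q q' : Config} (h : Admissible q q') {T : ℝ} (hT : 0 < T)
    (hE : totalEnergy q q' T = 1) : ‖q' - q‖ ≤ 5 * T ∧ T ≤ ‖q' - q‖ := by
  have h1 := le_totalEnergy h hT
  have h2 := totalEnergy_le h hT
  rw [hE] at h1 h2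
  have hD := norm_nonneg (q' - q)
  rw [sub_le_iff_le_add, div_le_iff₀ (by positivity)] at h1
  rw [le_div_iff₀ (by positivity)] at h2
  constructor
  · exact (abs_le_of_sq_le_sq' (b := 5 * T) (by nlinarith) (by positivity)).2
  · exact (abs_le_of_sq_le_sq' (b := ‖q' - q‖) (by nlinarith) hD).2

lemma connEnergy_le {q q' : Config} (h : Admissible q q') {T : ℝ} (hT : 0 < T)
    (hE : totalEnergy q q' T = 1) (i : Fin 4) : connEnergy (q i - π) (q' i - π) T ≤ 5 / 2 := by
  have h1 := Finset.add_sum_erase Finset.univ (fun i => connEnergy (q i - π) (q' i - π) T)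
    (Finset.mem_univ i)
  have h2 : ∑ i ∈ Finset.univ.erase i, (-1 / 2 : ℝ) ≤
      ∑ i ∈ Finset.univ.erase i, connEnergy (q i - π) (q' i - π) T :=
    Finset.sum_le_sum fun j _ => (linked_of_admissible h j).energy_ge hT
  rw [Finset.sum_const, Finset.card_erase_of_mem (Finset.mem_univ i), Finset.card_fin] at h2
  norm_num at h2
  unfold totalEnergy at hE
  linarith

/-! ### Connections of energy one -/

lemma hasDerivAt_coord {X : ℝ → Config} {v : Config} {t : ℝ} (h : HasDerivAt X v t) (i : Fin 4) :
    HasDerivAt (fun t => X t i) (v i) t :=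
  (EuclideanSpace.proj (𝕜 := ℝ) i).hasFDerivAt.comp_hasDerivAt t h

lemma hasDerivAt_toLp {f : ℝ → Fin 4 → ℝ} {v : Fin 4 → ℝ} {t : ℝ}
    (h : ∀ i, HasDerivAt (fun t => f t i) (v i) t) :
    HasDerivAt (fun t => (WithLp.toLp 2 (f t) : Config)) (WithLp.toLp 2 v) t :=
  (EuclideanSpace.equiv (Fin 4) ℝ).symm.toContinuousLinearMap.hasFDerivAt.comp_hasDerivAt t
    (hasDerivAt_pi.2 h)

/-- The curve all of whose coordinates are the connections in time `T`. -/
noncomputable def connPath (q q' : Config) (T t : ℝ) : Config :=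
  WithLp.toLp 2 fun i => flowPos (q i - π) (connVel (q i - π) (q' i - π) T) t + π

lemma hasDerivAt_connPath (q q' : Config) (T t : ℝ) : HasDerivAt (connPath q q' T)
    (WithLp.toLp 2 fun i => flowVel (q i - π) (connVel (q i - π) (q' i - π) T) t) t :=
  hasDerivAt_toLp fun _ => ((traj_flow _ _).pos t).add_const π

lemma deriv_connPath (q q' : Config) (T : ℝ) : deriv (connPath q q' T) = fun t =>
    WithLp.toLp 2 fun i => flowVel (q i - π) (connVel (q i - π) (q' i - π) T) t :=
  funext fun t => (hasDerivAt_connPath q q' T t).deriv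

lemma siteEnergy_eq (X : ℝ → Config) (i : Fin 4) (t : ℝ) :
    siteEnergy X i t = energy (X t i - π) (deriv X t i) := by
  unfold siteEnergy pendulumPotential energy
  rw [cos_sub_pi]
  ring

lemma siteEnergy_connPath (q q' : Config) (T : ℝ) (i : Fin 4) (t : ℝ) :
    siteEnergy (connPath q q' T) i t = connEnergy (q i - π) (q' i - π) T := by
  rw [siteEnergy_eq, deriv_connPath]
  have := (traj_flow (q i - π) (connVel (q i - π) (q' i - π) T)).energy_eq t 0
  rw [flowPos_zero, flowVel_zero] at this
  simpa [connPath, connEnergy] using this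

lemma isConnection_connPath {q q' : Config} (h : Admissible q q') {T : ℝ} (hT : 0 < T) :
    IsConnection q q' T (connPath q q' T) := by
  refine ⟨hT, fun t => ⟨?_, ?_⟩, ?_, ?_, fun i => ?_⟩
  · rw [deriv_connPath]
    exact hasDerivAt_connPath q q' T t
  · rw [deriv_connPath]
    refine hasDerivAt_toLp fun i => ((traj_flow _ _).vel t).congr_deriv ?_
    simp [connPath, sin_add_pi]
  · ext i
    simp [connPath]
  · ext i
    simp [connPath, (linked_of_admissible h i).flowPos_connVel hT]
  · obtain ⟨I, h1, h2⟩ := (linked_of_admissible h i).exists_route hT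
    exact ⟨I, by simpa using h1, h2⟩

lemma eq_connPath {q q' : Config} {T : ℝ} {X : ℝ → Config} (hX : IsConnection q q' T X) :
    X = connPath q q' T := by
  obtain ⟨hT, hsol, h0, h1, hI⟩ := hX
  have hadm : Admissible q q' := fun i => (hI i).imp fun _ h => h.1
  have hcoord : ∀ i, (fun t => X t i - π) = flowPos (q i - π) (connVel (q i - π) (q' i - π) T) :=
    fun i => by
    have hy : Traj (fun t => X t i - π) (fun t => deriv X t i) :=
      ⟨fun t => (hasDerivAt_coord (hsol t).1 i).sub_const π, fun t => by
        rw [sin_sub_pi]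
        exact hasDerivAt_coord (hsol t).2 i⟩
    have he := hy.eq_flow.1
    simp only [h0] at he
    obtain ⟨I, hR, hXI⟩ := hI i
    obtain ⟨J, hJ, hIJ⟩ := way_of_route hR
    rw [he]
    congr 1
    refine IsConnVel.unique hT ⟨J, hJ, ?_, fun t ht => ?_⟩
      ((linked_of_admissible hadm i).isConnVel hT)
    · rw [← he]
      simp only [h1]
    · rw [← he]
      exact hIJ _ (hXI t ht)
  ext t i
  have := congrFun (hcoord i) t
  simp only [connPath]
  linarith

lemma isEnergyOneConnection_iff {q q' : Config} (h : Admissible q q') {T : ℝ} {X : ℝ → Config} :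
    IsEnergyOneConnection q q' T X ↔ 0 < T ∧ totalEnergy q q' T = 1 ∧ X = connPath q q' T := by
  constructor
  · rintro ⟨h1, h2⟩
    have h3 := eq_connPath h1
    refine ⟨h1.1, ?_, h3⟩
    have := h2 0
    rw [h3] at this
    simp only [siteEnergy_connPath] at this
    exact this
  · rintro ⟨hT, hE, rfl⟩
    exact ⟨isConnection_connPath h hT, fun t => by
      simp only [siteEnergy_connPath]
      exact hE⟩

theorem existsUnique_connection {q q' : Config} (h : Admissible q q') (hne : q ≠ q') :
    ∃! p : ℝ × (ℝ → Config), IsEnergyOneConnection q q' p.1 p.2 := by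
  obtain ⟨T, hT, hE⟩ := exists_time h hne
  refine ⟨(T, connPath q q' T), (isEnergyOneConnection_iff h).2 ⟨hT, hE, rfl⟩, ?_⟩
  rintro ⟨T', X⟩ hX
  obtain ⟨hT', hE', hX'⟩ := (isEnergyOneConnection_iff h).1 hX
  have hTT : T' = T := totalEnergy_time_unique h hT' hT hE' hE
  simp only at hX'
  rw [hX', hTT]

lemma travelTime_spec {q q' : Config} (h : Admissible q q') (hne : q ≠ q') :
    0 < travelTime q q' ∧ totalEnergy q q' (travelTime q q') = 1 := by
  obtain ⟨T, hT, hE⟩ := exists_time h hne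
  obtain ⟨X, hX⟩ := Classical.epsilon_spec
    (p := fun T : ℝ => ∃ X : ℝ → Config, IsEnergyOneConnection q q' T X)
    ⟨T, connPath q q' T, (isEnergyOneConnection_iff h).2 ⟨hT, hE, rfl⟩⟩
  have := (isEnergyOneConnection_iff h).1 hX
  exact ⟨this.1, this.2.1⟩

lemma energyOneConnection_eq {q q' : Config} (h : Admissible q q') (hne : q ≠ q') :
    energyOneConnection q q' = connPath q q' (travelTime q q') := by
  obtain ⟨hT, hE⟩ := travelTime_spec h hne
  have := Classical.epsilon_spec
    (p := fun X : ℝ → Config => IsEnergyOneConnection q q' (travelTime q q') X)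
    ⟨connPath q q' (travelTime q q'), (isEnergyOneConnection_iff h).2 ⟨hT, hE, rfl⟩⟩
  exact ((isEnergyOneConnection_iff h).1 this).2.2

lemma initialVelocity_eq {q q' : Config} (h : Admissible q q') (hne : q ≠ q') :
    initialVelocity q q' =
      WithLp.toLp 2 fun i => connVel (q i - π) (q' i - π) (travelTime q q') := by
  unfold initialVelocity
  rw [energyOneConnection_eq h hne, deriv_connPath]
  simp

lemma energyVector_eq {q q' : Config} (h : Admissible q q') (hne : q ≠ q') :
    energyVector q q' =
      WithLp.toLp 2 fun i => connEnergy (q i - π) (q' i - π) (travelTime q q') := by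
  unfold energyVector
  rw [energyOneConnection_eq h hne]
  simp only [siteEnergy_connPath]

/-! ### Differentiability in the initial position -/

/-- Dependence on a coordinate of the initial position and on the time. -/
lemma hasFDerivWithinAt_comp_coord {q q' : Config} {T a b : ℝ} {f : ℝ × ℝ → ℝ} {i : Fin 4}
    (hf : HasFDerivWithinAt f
      (a • ContinuousLinearMap.fst ℝ ℝ ℝ + b • ContinuousLinearMap.snd ℝ ℝ ℝ)
      ({α | Linked α (q' i - π)} ×ˢ Ioi 0) (q i - π, T)) :
    HasFDerivWithinAt (fun w : Config × ℝ => f (w.1 i - π, w.2))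
      ((a • EuclideanSpace.proj (𝕜 := ℝ) i).comp (ContinuousLinearMap.fst ℝ Config ℝ) +
        b • ContinuousLinearMap.snd ℝ Config ℝ) ({p | Admissible p q'} ×ˢ Ioi 0) (q, T) := by
  have h1 : HasFDerivWithinAt (fun w : Config × ℝ => ((w.1 i - π, w.2) : ℝ × ℝ))
      (((EuclideanSpace.proj (𝕜 := ℝ) i).comp (ContinuousLinearMap.fst ℝ Config ℝ)).prod
        (ContinuousLinearMap.snd ℝ Config ℝ)) ({p | Admissible p q'} ×ˢ Ioi 0) (q, T) :=
    ((((EuclideanSpace.proj (𝕜 := ℝ) i).comp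
      (ContinuousLinearMap.fst ℝ Config ℝ)).hasFDerivAt.sub_const π).prodMk
      hasFDerivAt_snd).hasFDerivWithinAt
  have h2 := HasFDerivWithinAt.comp (f := fun w : Config × ℝ => ((w.1 i - π, w.2) : ℝ × ℝ))
    (q, T) hf h1 fun w hw => ⟨linked_of_admissible hw.1 i, hw.2⟩
  refine h2.congr_fderiv ?_
  ext <;> simp

lemma hasFDerivWithinAt_totalEnergy {q q' : Config} {T : ℝ} {A B : Fin 4 → ℝ}
    (hAB : ∀ i, HasFDerivWithinAt (fun z : ℝ × ℝ => connVel z.1 (q' i - π) z.2)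
      (A i • ContinuousLinearMap.fst ℝ ℝ ℝ + B i • ContinuousLinearMap.snd ℝ ℝ ℝ)
      ({α | Linked α (q' i - π)} ×ˢ Ioi 0) (q i - π, T)) :
    HasFDerivWithinAt (fun w : Config × ℝ => totalEnergy w.1 q' w.2)
      ((∑ i, (connVel (q i - π) (q' i - π) T * A i - sin (q i - π)) •
        EuclideanSpace.proj (𝕜 := ℝ) i).comp (ContinuousLinearMap.fst ℝ Config ℝ) +
        (∑ i, connVel (q i - π) (q' i - π) T * B i) • ContinuousLinearMap.snd ℝ Config ℝ)
      ({p | Admissible p q'} ×ˢ Ioi 0) (q, T) := by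
  have h := HasFDerivWithinAt.fun_sum (u := Finset.univ) fun i _ =>
    hasFDerivWithinAt_comp_coord (hasFDerivWithinAt_connEnergy (hAB i))
  refine h.congr_fderiv ?_
  rw [Finset.sum_add_distrib, Finset.sum_smul, ContinuousLinearMap.finsetSum_comp]

/-- The travel time is locally bounded, and every cluster value is again a time of total
energy one. -/
lemma continuousWithinAt_travelTime {q q' : Config} (h : Admissible q q') (hne : q ≠ q') :
    ContinuousWithinAt (fun p => travelTime p q') ({p | Admissible p q'} ∩ {q'}ᶜ) q := by
  set S : Set Config := {p | Admissible p q'} ∩ {q'}ᶜ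
  have hD0 : 0 < ‖q' - q‖ := norm_pos_iff.2 (sub_ne_zero.2 hne.symm)
  have hspec : ∀ p ∈ S, 0 < travelTime p q' ∧ totalEnergy p q' (travelTime p q') = 1 :=
    fun p hp => travelTime_spec hp.1 hp.2
  have hbound : ∀ᶠ p in 𝓝[S] q, travelTime p q' ∈ Icc (‖q' - q‖ / 10) (2 * ‖q' - q‖) := by
    have hc : ContinuousAt (fun p : Config => ‖q' - p‖) q := by fun_prop
    have h1 := hc.eventually (Ioo_mem_nhds (show ‖q' - q‖ / 2 < ‖q' - q‖ by linarith)
      (show ‖q' - q‖ < 2 * ‖q' - q‖ by linarith))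
    filter_upwards [eventually_nhdsWithin_of_eventually_nhds h1, self_mem_nhdsWithin] with p hp hpS
    obtain ⟨hT, hE⟩ := hspec p hpS
    have := time_bounds hpS.1 hT hE
    constructor <;> linarith [hp.1, hp.2]
  refine isCompact_Icc.tendsto_nhds_of_unique_mapClusterPt hbound fun T hTI hT => ?_
  have hT0 : 0 < T := by linarith [hTI.1]
  obtain ⟨U, hU, hUT⟩ := mapClusterPt_iff_ultrafilter.1 hT
  refine totalEnergy_time_unique h hT0 (travelTime_spec h hne).1 ?_ (travelTime_spec h hne).2
  choose A B hAB _ using fun i => (linked_of_admissible h i).exists_deriv hT0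
  have hcont := (hasFDerivWithinAt_totalEnergy hAB).continuousWithinAt
  have hS : ∀ᶠ p in (U : Filter Config), p ∈ S := hU self_mem_nhdsWithin
  have hid : Tendsto (fun p : Config => p) U (𝓝 q) := hU.trans nhdsWithin_le_nhds
  have htend : Tendsto (fun p => (p, travelTime p q')) U
      (𝓝[{p | Admissible p q'} ×ˢ Ioi 0] (q, T)) :=
    tendsto_nhdsWithin_iff.2 ⟨hid.prodMk_nhds hUT, hS.mono fun p hp => ⟨hp.1, (hspec p hp).1⟩⟩
  refine tendsto_nhds_unique_of_eventuallyEq (hcont.tendsto.comp htend) tendsto_const_nhds ?_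
  filter_upwards [hS] with p hp
  exact (hspec p hp).2

/-- The derivative of the initial velocity in the initial position exists and is bounded: the
derivative of the total energy in the time is at least `1 / (20 T)` in absolute value, which
compensates the derivative of the initial velocity in the time, at most `100 / T`. -/
lemma exists_hasFDerivWithinAt_initialVelocity {q q' : Config} (h : Admissible q q')
    (h1 : 1 ≤ ‖q' - q‖) : ∃ L : Config →L[ℝ] Config,
    HasFDerivWithinAt (fun p => initialVelocity p q') L {p | Admissible p q'} q ∧
      ‖L‖ ≤ 10 ^ 8 := by
  have hne : q ≠ q' := by
    rintro rfl
    simp at h1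
    linarith
  obtain ⟨hT, hE⟩ := travelTime_spec h hne
  set T := travelTime q q' with hTdef
  choose A B hAB hs hs' hb using fun i => (linked_of_admissible h i).exists_deriv hT
  have hT5 : 1 / 5 ≤ T := by linarith [(time_bounds h hT hE).1]
  have hA : ∀ i, |A i| ≤ 100 := fun i => (hb i hT5 (connEnergy_le h hT hE i)).1
  have hB : ∀ i, T * |B i| ≤ 100 := fun i => (hb i hT5 (connEnergy_le h hT hE i)).2
  set v := fun i => connVel (q i - π) (q' i - π) T with hv
  have hv3 : ∀ i, |v i| ≤ 3 := fun i => by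
    have := (traj_flow (q i - π) (v i)).abs_vel_le_three (by
      rw [flowPos_zero, flowVel_zero]; exact connEnergy_le h hT hE i) 0
    rwa [flowVel_zero] at this
  set d := ∑ i, v i * B i with hd
  have hdT : T * d ≤ -1 / 20 := by
    rw [hd, Finset.mul_sum]
    exact sum_slope_le hE hs hs'
  have hd0 : d ≠ 0 := fun h0 => by rw [h0] at hdT; norm_num at hdT
  set G : Config →L[ℝ] ℝ :=
    ∑ i, (v i * A i - sin (q i - π)) • EuclideanSpace.proj (𝕜 := ℝ) i with hG
  set S : Set Config := {p | Admissible p q'} ∩ {q'}ᶜ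
  -- the derivative of the travel time
  have htime : HasFDerivWithinAt (fun p => travelTime p q') (-(d⁻¹ • G)) S q :=
    hasFDerivWithinAt_implicit (continuousWithinAt_travelTime h hne)
      (hasFDerivWithinAt_totalEnergy hAB) hd0 fun p hp => by
        have := travelTime_spec hp.1 hp.2
        refine ⟨⟨hp.1, this.1⟩, ?_⟩
        simp only [this.2]
        exact hE.symm
  have hcoord : ∀ i, HasFDerivWithinAt
      (fun p : Config => connVel (p i - π) (q' i - π) (travelTime p q'))
      (A i • EuclideanSpace.proj (𝕜 := ℝ) i + B i • -(d⁻¹ • G)) S q := fun i => by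
    have h2 := HasFDerivWithinAt.comp (f := fun p => (p, travelTime p q')) q
      (hasFDerivWithinAt_comp_coord (hAB i)) ((hasFDerivWithinAt_id q S).prodMk htime)
      fun p hp => ⟨hp.1, (travelTime_spec hp.1 hp.2).1⟩
    refine h2.congr_fderiv ?_
    ext x
    simp
  set L : Config →L[ℝ] Config := (EuclideanSpace.equiv (Fin 4) ℝ).symm.toContinuousLinearMap.comp
    (ContinuousLinearMap.pi fun i => A i • EuclideanSpace.proj (𝕜 := ℝ) i + B i • -(d⁻¹ • G))
    with hL
  have hLi : ∀ x i, L x i = A i * x i + B i * -(d⁻¹ * G x) := fun x i => by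
    simp [hL, EuclideanSpace.equiv]
  refine ⟨L, ?_, L.opNorm_le_bound (by positivity) fun x => ?_⟩
  · have h2 : HasFDerivWithinAt (fun p => initialVelocity p q') L S q := by
      rw [hasFDerivWithinAt_euclidean]
      intro i
      refine ((hcoord i).congr (fun p hp => ?_) ?_).congr_fderiv ?_
      · rw [initialVelocity_eq hp.1 hp.2]
      · rw [initialVelocity_eq h hne]
      · ext x
        simp [hLi]
    refine h2.mono_of_mem_nhdsWithin ?_
    exact inter_mem self_mem_nhdsWithin (mem_nhdsWithin_of_mem_nhds
      (isOpen_compl_singleton.mem_nhds hne))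
  · have hx : ∀ i, |x i| ≤ ‖x‖ := fun i => by simpa using PiLp.norm_apply_le x i
    have hGx : |G x| ≤ 1204 * ‖x‖ := by
      have h3 : G x = ∑ i, (v i * A i - sin (q i - π)) * x i := by
        simp [hG]
      have h4 : ∀ i, |(v i * A i - sin (q i - π)) * x i| ≤ 301 * ‖x‖ := fun i => by
        rw [abs_mul]
        refine mul_le_mul ?_ (hx i) (abs_nonneg _) (by norm_num)
        have h5 : |v i * A i| ≤ 3 * 100 := by
          rw [abs_mul]
          exact mul_le_mul (hv3 i) (hA i) (abs_nonneg _) (by norm_num)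
        have := abs_sub (v i * A i) (sin (q i - π))
        linarith [abs_sin_le_one (q i - π)]
      rw [h3]
      refine (Finset.abs_sum_le_sum_abs _ _).trans ((Finset.sum_le_sum fun i _ => h4 i).trans ?_)
      rw [Finset.sum_const, Finset.card_univ, Fintype.card_fin, nsmul_eq_mul]
      norm_num
      linarith [norm_nonneg x]
    have hBd : ∀ i, |B i * d⁻¹| ≤ 2000 := fun i => by
      have h3 : 1 / 20 ≤ T * |d| := by
        have : T * |d| = |T * d| := by rw [abs_mul, abs_of_pos hT]
        rw [this]
        exact le_abs.2 (Or.inr (by linarith))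
      have hd' : 0 < |d| := abs_pos.2 hd0
      rw [abs_mul, abs_inv, ← div_eq_mul_inv, div_le_iff₀ hd']
      have h4 : T * |B i| ≤ T * (2000 * |d|) := by linarith [hB i]
      exact le_of_mul_le_mul_left h4 hT
    have hLx : ∀ i, |L x i| ≤ 10 ^ 7 * ‖x‖ := fun i => by
      rw [hLi]
      have h3 : |A i * x i| ≤ 100 * ‖x‖ := by
        rw [abs_mul]
        exact mul_le_mul (hA i) (hx i) (abs_nonneg _) (by norm_num)
      have h4 : |B i * -(d⁻¹ * G x)| ≤ 2000 * (1204 * ‖x‖) := by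
        rw [show B i * -(d⁻¹ * G x) = -(B i * d⁻¹ * G x) by ring, abs_neg, abs_mul]
        exact mul_le_mul (hBd i) hGx (abs_nonneg _) (by norm_num)
      have := abs_add_le (A i * x i) (B i * -(d⁻¹ * G x))
      linarith [norm_nonneg x]
    rw [EuclideanSpace.norm_eq]
    refine Real.sqrt_le_iff.2 ⟨by positivity, ?_⟩
    calc ∑ i, ‖L x i‖ ^ 2 ≤ ∑ i : Fin 4, (10 ^ 7 * ‖x‖) ^ 2 :=
          Finset.sum_le_sum fun i _ => by
            have := hLx i
            rw [Real.norm_eq_abs]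
            gcongr
      _ = 4 * (10 ^ 7 * ‖x‖) ^ 2 := by simp
      _ ≤ _ := by nlinarith [sq_nonneg ‖x‖]

/-- Each endpoint condition persists when the initial position varies in a nondegenerate
interval. -/
lemma exists_Icc_baseRoute {a b : ℝ} {I : Set ℝ} (h : BaseRoute a b I) :
    ∃ l u, l < u ∧ a ∈ Icc l u ∧ ∀ x ∈ Icc l u, ∃ I', BaseRoute x b I' := by
  have key : ∀ {x c : ℝ}, x ∈ Icc (c - 1) (c + 1) ↔ |x - c| ≤ 1 := fun {x c} => by
    rw [abs_le, mem_Icc]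
    constructor <;> rintro ⟨h1, h2⟩ <;> constructor <;> linarith
  rcases h with ⟨h1, h2, -⟩ | ⟨h1, h2, -⟩ | ⟨h1, h2, -⟩ | ⟨h1, -⟩ | ⟨h1, h2, -⟩
  · exact ⟨-1, 1, by norm_num, abs_le.1 h1, fun x hx => ⟨_, Or.inl ⟨abs_le.2 hx, h2, rfl⟩⟩⟩
  · refine ⟨-π - 1, -π + 1, by linarith, key.2 (by simpa using h1), fun x hx => ⟨_, Or.inr (Or.inl
      ⟨by simpa using key.1 hx, h2, rfl⟩)⟩⟩
  · exact ⟨-1, 1, by norm_num, abs_le.1 h1, fun x hx => ⟨_, Or.inr (Or.inr (Or.inl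
      ⟨abs_le.2 hx, h2, rfl⟩))⟩⟩
  · exact ⟨a - 1, a, by linarith, ⟨by linarith, le_rfl⟩, fun x hx => ⟨_, Or.inr (Or.inr (Or.inr
      (Or.inl ⟨by linarith [hx.2], rfl⟩)))⟩⟩
  · exact ⟨π - 1, π + 1, by linarith, key.2 h1, fun x hx => ⟨_, Or.inr (Or.inr (Or.inr
      (Or.inr ⟨key.1 hx, h2, rfl⟩)))⟩⟩

lemma exists_Icc_route {a b : ℝ} {I : Set ℝ} (h : Route a b I) :
    ∃ l u, l < u ∧ a ∈ Icc l u ∧ ∀ x ∈ Icc l u, ∃ I', Route x b I' := by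
  obtain ⟨k, s, α, β, I₀, hs, hB, rfl, rfl, -⟩ := h
  obtain ⟨l, u, hlu, hα, h⟩ := exists_Icc_baseRoute hB
  have hroute : ∀ x, x ∈ Icc l u → ∃ I', Route (s * x + 2 * π * k) (s * β + 2 * π * k) I' :=
    fun x hx => by
    obtain ⟨I', hI'⟩ := h x hx
    exact ⟨_, k, s, x, β, I', hs, hI', rfl, rfl, rfl⟩
  rcases hs with rfl | rfl
  · refine ⟨l + 2 * π * k, u + 2 * π * k, by linarith, ⟨by linarith [hα.1], by linarith [hα.2]⟩,
      fun x hx => ?_⟩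
    have := hroute (x - 2 * π * k) ⟨by linarith [hx.1], by linarith [hx.2]⟩
    rwa [show (1 : ℝ) * (x - 2 * π * k) + 2 * π * k = x by ring] at this
  · refine ⟨-u + 2 * π * k, -l + 2 * π * k, by linarith, ⟨by linarith [hα.2], by linarith [hα.1]⟩,
      fun x hx => ?_⟩
    have := hroute (2 * π * k - x) ⟨by linarith [hx.2], by linarith [hx.1]⟩
    rwa [show (-1 : ℝ) * (2 * π * k - x) + 2 * π * k = x by ring] at this

/-- The admissible initial positions form, near each of their points, a set that contains a box. -/
lemma uniqueDiffWithinAt_admissible {q q' : Config} (h : Admissible q q') :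
    UniqueDiffWithinAt ℝ {p : Config | Admissible p q'} q := by
  have hex : ∀ i, ∃ l u, l < u ∧ q i ∈ Icc l u ∧ ∀ x ∈ Icc l u, ∃ I', Route x (q' i) I' :=
    fun i => (h i).elim fun I hI => exists_Icc_route hI
  choose l u hlu hq hr using hex
  have hc : ∀ i, Continuous fun p : Config => p i := fun i =>
    (EuclideanSpace.proj (𝕜 := ℝ) i).continuous
  set box : Set Config := {p | ∀ i, p i ∈ Icc (l i) (u i)} with hbox
  have hconv : Convex ℝ box := by
    intro x hx y hy a b ha hb hab i
    have := (convex_Icc (l i) (u i)) (hx i) (hy i) ha hb hab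
    simpa using this
  have hint : (interior box).Nonempty := by
    refine ⟨WithLp.toLp 2 fun i => (l i + u i) / 2, mem_interior.2
      ⟨{p | ∀ i, p i ∈ Ioo (l i) (u i)}, fun p hp i => Ioo_subset_Icc_self (hp i), ?_, fun i => ?_⟩⟩
    · have : {p : Config | ∀ i, p i ∈ Ioo (l i) (u i)} =
          ⋂ i, (fun p : Config => p i) ⁻¹' Ioo (l i) (u i) := by
        ext p; simp
      rw [this]
      exact isOpen_iInter_of_finite fun i => isOpen_Ioo.preimage (hc i)
    · have := hlu i
      constructor <;> simp only <;> linarith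
  exact (uniqueDiffOn_convex hconv hint q hq).mono fun p hp i => hr i _ (hp i)

theorem initialVelocity_differentiable {q q' : Config} (h : Admissible q q')
    (h1 : 1 ≤ ‖q' - q‖) :
    DifferentiableWithinAt ℝ (fun p : Config => initialVelocity p q')
      {p : Config | Admissible p q'} q ∧
    ‖fderivWithin ℝ (fun p : Config => initialVelocity p q')
      {p : Config | Admissible p q'} q‖ ≤ 10 ^ 8 := by
  obtain ⟨L, hL, hn⟩ := exists_hasFDerivWithinAt_initialVelocity h h1
  refine ⟨hL.differentiableWithinAt, ?_⟩
  rwa [hL.fderivWithin (uniqueDiffWithinAt_admissible h)]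

/-! ### The rate of rotation as a function of the energy -/

/-- The time that a pendulum of energy `E > 0` needs for one turn. -/
noncomputable def turnTime (E : ℝ) : ℝ := ∫ x in (0 : ℝ)..2 * π, slowness E x

/-- The mean angular velocity of a pendulum of energy `E`; it is zero if the pendulum does not
rotate. -/
noncomputable def turnRate (E : ℝ) : ℝ := if 0 < E then 2 * π / turnTime E else 0

lemma turnTime_pos {E : ℝ} (hE : 0 < E) : 0 < turnTime E :=
  intervalIntegral.intervalIntegral_pos_of_pos ((slowness_continuous hE).intervalIntegrable _ _)
    (slowness_pos hE) (by positivity)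

lemma turnTime_le {E : ℝ} (hE : 0 < E) : turnTime E ≤ 2 * π / √(2 * E) := by
  have := intervalIntegral.integral_mono_on (μ := MeasureTheory.volume) (a := 0) (b := 2 * π)
    (by positivity) ((slowness_continuous hE).intervalIntegrable _ _) (g := fun _ => (√(2 * E))⁻¹)
    (continuous_const.intervalIntegrable _ _) (fun x _ => slowness_le hE x)
  rwa [intervalIntegral.integral_const, sub_zero, smul_eq_mul, ← div_eq_mul_inv] at this

lemma turnRate_of_pos {E : ℝ} (hE : 0 < E) : turnRate E = 2 * π / turnTime E := if_pos hE

lemma turnRate_of_nonpos {E : ℝ} (hE : E ≤ 0) : turnRate E = 0 := if_neg hE.not_gt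

lemma turnRate_max_zero (E : ℝ) : turnRate (max E 0) = turnRate E := by
  rcases le_total E 0 with h | h
  · rw [max_eq_right h, turnRate_of_nonpos h, turnRate_of_nonpos le_rfl]
  · rw [max_eq_left h]

lemma le_sqrt_two_mul {E : ℝ} (h0 : 0 ≤ E) (hE : E ≤ 5 / 2) : E / 3 ≤ √(2 * E) :=
  Real.le_sqrt_of_sq_le (by nlinarith)

lemma sqrt_le_turnRate {E : ℝ} (hE : 0 < E) : √(2 * E) ≤ turnRate E := by
  have h := turnTime_le hE
  have h0 := turnTime_pos hE
  have hs : 0 < √(2 * E) := Real.sqrt_pos.2 (by linarith)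
  rw [turnRate_of_pos hE, le_div_iff₀ h0]
  rw [le_div_iff₀ hs] at h
  linarith

/-- A lower bound for the loss of slowness: the difference quotient of the slowness in the energy is
at least the cube of the slowness, hence at least a third of its square, and the square is
bounded below by its tangent at `m`. -/
lemma slowness_sub_ge {E E' : ℝ} (hE : 0 < E) (h : E ≤ E') (hE' : E' ≤ 5 / 2) (m x : ℝ) :
    (E' - E) / 3 * (2 * m * slowness E' x - m ^ 2) ≤ slowness E x - slowness E' x := by
  have hc := cos_le_one x
  have hc' := neg_one_le_cos x
  have hu2 := Real.sq_sqrt (show 0 ≤ 2 * (E + 1 - cos x) by linarith)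
  have hv2 := Real.sq_sqrt (show 0 ≤ 2 * (E' + 1 - cos x) by linarith)
  have hu0 := Real.sqrt_pos.2 (show 0 < 2 * (E + 1 - cos x) by linarith)
  have hv0 := Real.sqrt_pos.2 (show 0 < 2 * (E' + 1 - cos x) by linarith)
  have huv := Real.sqrt_le_sqrt (show 2 * (E + 1 - cos x) ≤ 2 * (E' + 1 - cos x) by linarith)
  unfold slowness
  set u := √(2 * (E + 1 - cos x))
  set v := √(2 * (E' + 1 - cos x))
  have hv3 : v ≤ 3 := by nlinarith
  have h1 : (E' - E) / 3 * (2 * m * v⁻¹ - m ^ 2) ≤ (E' - E) / 3 * (v⁻¹ ^ 2) :=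
    mul_le_mul_of_nonneg_left (by nlinarith [sq_nonneg (v⁻¹ - m)]) (by linarith)
  refine h1.trans ?_
  have h2 : u⁻¹ - v⁻¹ = 2 * (E' - E) / (u * v * (u + v)) := by
    field_simp
    linarith
  rw [h2, inv_pow, ← div_eq_mul_inv, div_div, div_le_div_iff₀ (by positivity) (by positivity)]
  have h3 : u * v * (u + v) ≤ 2 * v ^ 2 * 3 := by
    have h4 : u * v ≤ v ^ 2 := by nlinarith
    have h5 : u * v * (u + v) ≤ v ^ 2 * (u + v) := by gcongr
    nlinarith [sq_nonneg v]
  nlinarith [mul_le_mul_of_nonneg_left h3 (show 0 ≤ E' - E by linarith)]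

lemma turnTime_sub_ge {E E' : ℝ} (hE : 0 < E) (h : E ≤ E') (hE' : E' ≤ 5 / 2) :
    (E' - E) * turnTime E' ^ 2 / (6 * π) ≤ turnTime E - turnTime E' := by
  have hE'0 := hE.trans_le h
  have hi := (slowness_continuous hE).intervalIntegrable (μ := MeasureTheory.volume) 0 (2 * π)
  have hi' := (slowness_continuous hE'0).intervalIntegrable (μ := MeasureTheory.volume) 0 (2 * π)
  set m := turnTime E' / (2 * π) with hm
  have hmono := intervalIntegral.integral_mono_on (μ := MeasureTheory.volume) (a := 0) (b := 2 * π)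
    (by positivity)
    (((hi'.const_mul (2 * m)).sub (intervalIntegrable_const (c := m ^ 2))).const_mul ((E' - E) / 3))
    (hi.sub hi') (fun x _ => slowness_sub_ge hE h hE' m x)
  rw [intervalIntegral.integral_const_mul,
    intervalIntegral.integral_sub (hi'.const_mul (2 * m)) intervalIntegrable_const,
    intervalIntegral.integral_const_mul, intervalIntegral.integral_sub hi hi',
    intervalIntegral.integral_const] at hmono
  change (E' - E) / 3 * (2 * m * turnTime E' - _) ≤ turnTime E - turnTime E' at hmono
  refine le_trans (le_of_eq ?_) hmono
  rw [hm, smul_eq_mul]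
  field_simp
  ring

/-- The rate of rotation determines the energy in a Lipschitz way. -/
lemma energy_sub_le_turnRate {E E' : ℝ} (hE : 0 ≤ E) (h : E ≤ E') (hE' : E' ≤ 5 / 2) :
    E' - E ≤ 6 * (turnRate E' - turnRate E) := by
  rcases hE.eq_or_lt with rfl | hE
  · rw [turnRate_of_nonpos le_rfl]
    rcases h.eq_or_lt with rfl | h
    · rw [turnRate_of_nonpos le_rfl]; simp
    · linarith [sqrt_le_turnRate h, le_sqrt_two_mul h.le hE']
  have hE'0 := hE.trans_le h
  have hd := turnTime_sub_ge hE h hE'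
  have hP := turnTime_pos hE
  have hP' := turnTime_pos hE'0
  have hr := sqrt_le_turnRate hE'0
  have hs := le_sqrt_two_mul hE'0.le hE'
  rcases le_total (turnTime E) (2 * turnTime E') with hc | hc
  · rw [turnRate_of_pos hE, turnRate_of_pos hE'0,
      div_sub_div _ _ hP'.ne' hP.ne', ← mul_div_assoc, le_div_iff₀ (by positivity)]
    rw [div_le_iff₀ (by positivity)] at hd
    have h1 : turnTime E' * turnTime E ≤ 2 * turnTime E' ^ 2 := by nlinarith
    nlinarith [mul_le_mul_of_nonneg_left h1 (show 0 ≤ E' - E by linarith)]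
  · have h1 : turnRate E ≤ turnRate E' / 2 := by
      rw [turnRate_of_pos hE, turnRate_of_pos hE'0, div_div]
      exact div_le_div_of_nonneg_left (by positivity) (by positivity) (by linarith)
    linarith

lemma abs_turnRate_mul_sub_le_of_le {E a b : ℝ} (hE : 0 < E) (h : a ≤ b) :
    |turnRate E * (∫ x in a..b, slowness E x) - (b - a)| ≤ 2 * π := by
  have hP := turnTime_pos hE
  have hd0 : 0 ≤ (b - a) / (2 * π) := div_nonneg (by linarith) (by positivity)
  have hn := Nat.floor_le hd0
  have hn' := (Nat.lt_floor_add_one ((b - a) / (2 * π))).le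
  set n := ⌊(b - a) / (2 * π)⌋₊
  rw [le_div_iff₀ (by positivity)] at hn
  rw [div_le_iff₀ (by positivity)] at hn'
  have h0 : ∀ x, 0 ≤ slowness E x := fun x => (slowness_pos hE x).le
  have h1 := le_integral_of_periodic (slowness_continuous hE) h0 (slowness_periodic E)
    (a := a) (b := b) n (by linarith)
  have h2 := integral_le_of_periodic (slowness_continuous hE) h0 (slowness_periodic E)
    (a := a) (b := b) (n + 1) h (by push_cast; linarith)
  change n * turnTime E ≤ _ at h1
  change _ ≤ ((n + 1 : ℕ) : ℝ) * turnTime E at h2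
  push_cast at h2
  set I := ∫ x in a..b, slowness E x
  have h3 : 2 * π * n ≤ turnRate E * I := by
    rw [turnRate_of_pos hE, div_mul_eq_mul_div, le_div_iff₀ hP]
    nlinarith [pi_pos]
  have h4 : turnRate E * I ≤ 2 * π * (n + 1) := by
    rw [turnRate_of_pos hE, div_mul_eq_mul_div, div_le_iff₀ hP]
    nlinarith [pi_pos]
  rw [abs_le]
  constructor <;> linarith

/-- Up to one turn, the distance covered is the rate of rotation times the time. -/
lemma GoodPath.abs_turnRate_mul_sub_le {y p : ℝ → ℝ} {T : ℝ} (h : GoodPath y p T) :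
    |turnRate (energy (y 0) (p 0)) * T - (|y T - y 0|)| ≤ 2 * π := by
  rcases le_or_gt (energy (y 0) (p 0)) 0 with hE | hE
  · rw [turnRate_of_nonpos hE, zero_mul, zero_sub, abs_neg, abs_abs]
    exact h.dist_le hE
  have hT := h.time_eq hE
  set E := energy (y 0) (p 0)
  have h0 : ∀ x, 0 ≤ slowness E x := fun x => (slowness_pos hE x).le
  rcases le_total (y 0) (y T) with hy | hy
  · rw [abs_of_nonneg (intervalIntegral.integral_nonneg hy fun x _ => h0 x)] at hT
    rw [abs_of_nonneg (sub_nonneg.2 hy)]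
    have := abs_turnRate_mul_sub_le_of_le hE hy
    rwa [← hT] at this
  · rw [intervalIntegral.integral_symm, abs_neg,
      abs_of_nonneg (intervalIntegral.integral_nonneg hy fun x _ => h0 x)] at hT
    rw [abs_sub_comm (y T), abs_of_nonneg (sub_nonneg.2 hy)]
    have := abs_turnRate_mul_sub_le_of_le hE hy
    rwa [← hT] at this

/-! ### The energies of long connections -/

lemma Linked.abs_turnRate_mul_sub_le {α β T : ℝ} (h : Linked α β) (hT : 0 < T) :
    |turnRate (connEnergy α β T) * T - (|β - α|)| ≤ 2 * π := by
  have := (h.goodPath hT).abs_turnRate_mul_sub_le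
  rw [flowPos_zero, flowVel_zero, h.flowPos_connVel hT] at this
  exact this

lemma Linked.neg_connEnergy_mul_le {α β T : ℝ} (h : Linked α β) (hT : 0 < T) :
    -(connEnergy α β T * T) ≤ 100 := by
  have := (h.goodPath hT).neg_energy_mul_le
  rw [flowPos_zero, flowVel_zero] at this
  exact this

lemma abs_coord_eq {q q' : Config} (hne : q ≠ q') (i : Fin 4) :
    |q' i - q i| = ‖q' - q‖ * |displacementDirection q q' i| := by
  have hD : 0 < ‖q' - q‖ := norm_pos_iff.2 (sub_ne_zero.2 hne.symm)
  simp only [displacementDirection, PiLp.smul_apply, PiLp.sub_apply, smul_eq_mul, abs_mul,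
    abs_inv, abs_norm]
  rw [mul_inv_cancel_left₀ hD.ne']

/-- The energies of two long connections in nearby directions are close. The connection of the
larger mean speed rotates at least as fast in every coordinate, up to a small error, so that its
energies are at least those of the other one; as the sums agree, they all nearly agree. -/
lemma abs_connEnergy_sub_le {q₁ q₁' q₂ q₂' : Config} {δ : ℝ} (h₁ : Admissible q₁ q₁')
    (h₂ : Admissible q₂ q₂') (hδ : 0 < δ) (hD₁ : δ⁻¹ ≤ ‖q₁' - q₁‖) (hD₂ : δ⁻¹ ≤ ‖q₂' - q₂‖)
    (he : ‖displacementDirection q₂ q₂' - displacementDirection q₁ q₁'‖ < δ) {T₁ T₂ : ℝ}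
    (hT₁ : 0 < T₁) (hT₂ : 0 < T₂) (hE₁ : totalEnergy q₁ q₁' T₁ = 1)
    (hE₂ : totalEnergy q₂ q₂' T₂ = 1) (i : Fin 4) :
    |connEnergy (q₂ i - π) (q₂' i - π) T₂ - connEnergy (q₁ i - π) (q₁' i - π) T₁| ≤ 4000 * δ := by
  wlog hs : ‖q₂' - q₂‖ / T₂ ≤ ‖q₁' - q₁‖ / T₁ generalizing q₁ q₁' q₂ q₂' T₁ T₂
  · rw [abs_sub_comm]
    exact this h₂ h₁ hD₂ hD₁ (by rwa [norm_sub_rev]) hT₂ hT₁ hE₂ hE₁ (not_le.1 hs).le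
  have hinv : 0 < δ⁻¹ := inv_pos.2 hδ
  have hne₁ : q₁ ≠ q₁' := fun h => by simp [h] at hD₁; linarith
  have hne₂ : q₂ ≠ q₂' := fun h => by simp [h] at hD₂; linarith
  have htime : ∀ {q q' : Config} {T : ℝ}, Admissible q q' → 0 < T → totalEnergy q q' T = 1 →
      δ⁻¹ ≤ ‖q' - q‖ → 1 / T ≤ 5 * δ := fun h hT hE hD => by
    have h1 := (time_bounds h hT hE).1
    rw [div_le_iff₀ hT]
    have h2 := mul_le_mul_of_nonneg_left (hD.trans h1) hδ.le
    rw [mul_inv_cancel₀ hδ.ne'] at h2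
    linarith
  have hlow : ∀ {q q' : Config} {T : ℝ}, Admissible q q' → 0 < T → totalEnergy q q' T = 1 →
      δ⁻¹ ≤ ‖q' - q‖ → ∀ j, max (connEnergy (q j - π) (q' j - π) T) 0 ≤
        connEnergy (q j - π) (q' j - π) T + 500 * δ := fun {q q' T} h hT hE hD j => by
    have h1 := (linked_of_admissible h j).neg_connEnergy_mul_le hT
    have h2 := htime h hT hE hD
    rw [div_le_iff₀ hT] at h2
    refine max_le (by linarith) ?_
    have h3 : 0 ≤ (connEnergy (q j - π) (q' j - π) T + 500 * δ) * T := by linarith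
    exact nonneg_of_mul_nonneg_left h3 hT
  have hrate : ∀ {q q' : Config} {T : ℝ}, Admissible q q' → 0 < T → totalEnergy q q' T = 1 →
      q ≠ q' → δ⁻¹ ≤ ‖q' - q‖ → ∀ j, |turnRate (connEnergy (q j - π) (q' j - π) T) -
        ‖q' - q‖ / T * (|displacementDirection q q' j|)| ≤ 32 * δ :=
    fun {q q' T} h hT hE hne hD j => by
    have h1 := (linked_of_admissible h j).abs_turnRate_mul_sub_le hT
    rw [sub_sub_sub_cancel_right, abs_coord_eq hne] at h1
    set r := turnRate (connEnergy (q j - π) (q' j - π) T)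
    have h2 : r - ‖q' - q‖ / T * |displacementDirection q q' j| =
        (r * T - ‖q' - q‖ * |displacementDirection q q' j|) * (1 / T) := by
      field_simp
    rw [h2, abs_mul, abs_of_pos (one_div_pos.2 hT)]
    calc _ ≤ 2 * π * (5 * δ) := mul_le_mul h1 (htime h hT hE hD) (one_div_pos.2 hT).le
          (by positivity)
      _ ≤ 32 * δ := by nlinarith [pi_lt_d2]
  set E₁ : Fin 4 → ℝ := fun j => connEnergy (q₁ j - π) (q₁' j - π) T₁ with hE₁def
  set E₂ : Fin 4 → ℝ := fun j => connEnergy (q₂ j - π) (q₂' j - π) T₂ with hE₂def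
  have hl₁ : ∀ j, max (E₁ j) 0 ≤ E₁ j + 500 * δ := hlow h₁ hT₁ hE₁ hD₁
  have hl₂ : ∀ j, max (E₂ j) 0 ≤ E₂ j + 500 * δ := hlow h₂ hT₂ hE₂ hD₂
  have hspeed : ‖q₂' - q₂‖ / T₂ ≤ 5 := by
    rw [div_le_iff₀ hT₂]; exact (time_bounds h₂ hT₂ hE₂).1
  have hcmp : ∀ j, max (E₂ j) 0 - 420 * δ ≤ max (E₁ j) 0 := fun j => by
    by_contra! hc
    have h1 := energy_sub_le_turnRate (le_max_right (E₁ j) 0) (by linarith)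
      (max_le (connEnergy_le h₂ hT₂ hE₂ j) (by norm_num))
    change max (E₂ j) 0 - _ ≤ _ at h1
    change _ ≤ 6 * (turnRate (max (E₂ j) 0) - _) at h1
    rw [turnRate_max_zero, turnRate_max_zero] at h1
    have h2 := (abs_le.1 (hrate h₁ hT₁ hE₁ hne₁ hD₁ j)).1
    have h3 := (abs_le.1 (hrate h₂ hT₂ hE₂ hne₂ hD₂ j)).2
    change -_ ≤ turnRate (E₁ j) - _ at h2
    change turnRate (E₂ j) - _ ≤ _ at h3
    have h4 : |displacementDirection q₂ q₂' j| ≤ |displacementDirection q₁ q₁' j| + δ := by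
      have h5 : |displacementDirection q₂ q₂' j - displacementDirection q₁ q₁' j| ≤ δ :=
        (PiLp.norm_apply_le (displacementDirection q₂ q₂' - displacementDirection q₁ q₁') j).trans
          he.le
      have := abs_sub_abs_le_abs_sub (displacementDirection q₂ q₂' j)
        (displacementDirection q₁ q₁' j)
      linarith
    have h0 : 0 ≤ ‖q₂' - q₂‖ / T₂ := by positivity
    have h6 : ‖q₂' - q₂‖ / T₂ * |displacementDirection q₂ q₂' j| ≤
        ‖q₁' - q₁‖ / T₁ * |displacementDirection q₁ q₁' j| + 5 * δ := by
      have h7 := mul_le_mul_of_nonneg_left h4 h0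
      have h8 := mul_le_mul_of_nonneg_right hs (abs_nonneg (displacementDirection q₁ q₁' j))
      have h9 := mul_le_mul_of_nonneg_right hspeed hδ.le
      linarith
    linarith
  have hsum₁ : E₁ 0 + E₁ 1 + E₁ 2 + E₁ 3 = 1 := by
    rw [← Fin.sum_univ_four]; exact hE₁
  have hsum₂ : E₂ 0 + E₂ 1 + E₂ 2 + E₂ 3 = 1 := by
    rw [← Fin.sum_univ_four]; exact hE₂
  have hm₁ := fun j => le_max_left (E₁ j) 0
  have hm₂ := fun j => le_max_left (E₂ j) 0
  have hmain : |E₂ i - E₁ i| ≤ 4000 * δ := by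
    rw [abs_le]
    fin_cases i <;> simp only [Fin.zero_eta, Fin.mk_one, Fin.reduceFinMk] <;>
    constructor <;>
    linarith [hl₁ 0, hl₁ 1, hl₁ 2, hl₁ 3, hl₂ 0, hl₂ 1, hl₂ 2, hl₂ 3, hcmp 0, hcmp 1, hcmp 2,
      hcmp 3, hm₁ 0, hm₁ 1, hm₁ 2, hm₁ 3, hm₂ 0, hm₂ 1, hm₂ 2, hm₂ 3]
  exact hmain

theorem norm_energyVector_sub_le {q₁ q₁' q₂ q₂' : Config} {δ : ℝ} (h₁ : Admissible q₁ q₁')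
    (h₂ : Admissible q₂ q₂') (hδ : 0 < δ) (hD₁ : δ⁻¹ ≤ ‖q₁' - q₁‖) (hD₂ : δ⁻¹ ≤ ‖q₂' - q₂‖)
    (he : ‖displacementDirection q₂ q₂' - displacementDirection q₁ q₁'‖ < δ) :
    ‖energyVector q₂ q₂' - energyVector q₁ q₁'‖ ≤ 8000 * δ := by
  have hinv : 0 < δ⁻¹ := inv_pos.2 hδ
  have hne₁ : q₁ ≠ q₁' := fun h => by simp [h] at hD₁; linarith
  have hne₂ : q₂ ≠ q₂' := fun h => by simp [h] at hD₂; linarith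
  obtain ⟨hT₁, hE₁⟩ := travelTime_spec h₁ hne₁
  obtain ⟨hT₂, hE₂⟩ := travelTime_spec h₂ hne₂
  have h := abs_connEnergy_sub_le h₁ h₂ hδ hD₁ hD₂ he hT₁ hT₂ hE₁ hE₂
  rw [energyVector_eq h₁ hne₁, energyVector_eq h₂ hne₂, EuclideanSpace.norm_eq]
  refine Real.sqrt_le_iff.2 ⟨by positivity, ?_⟩
  calc _ ≤ ∑ _i : Fin 4, (4000 * δ) ^ 2 := Finset.sum_le_sum fun i _ => by
        rw [Real.norm_eq_abs]
        exact pow_le_pow_left₀ (abs_nonneg _) (h i) 2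
    _ = (8000 * δ) ^ 2 := by simp; ring

end Pendula

theorem lemma2 :
    (∀ q q' : Config, Admissible q q' → q ≠ q' →
      ∃! p : ℝ × (ℝ → Config), IsEnergyOneConnection q q' p.1 p.2) ∧
    ∃ C : ℝ,
      (∀ (r : ℕ) (ε : ℝ), 3 ≤ r → 0 < ε → ε < 1 →
        ∀ q₁ q₁' q₂ q₂' : Config, Admissible q₁ q₁' → Admissible q₂ q₂' →
          (ε ^ (2 * r + 5))⁻¹ ≤ ‖q₁' - q₁‖ → (ε ^ (2 * r + 5))⁻¹ ≤ ‖q₂' - q₂‖ →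
          ‖displacementDirection q₂ q₂' - displacementDirection q₁ q₁'‖ < ε ^ (2 * r + 5) →
          ‖energyVector q₂ q₂' - energyVector q₁ q₁'‖ < C * ε ^ (2 * r + 5)) ∧
      (∀ q q' : Config, Admissible q q' → 1 ≤ ‖q' - q‖ →
        DifferentiableWithinAt ℝ (fun p : Config => initialVelocity p q')
          {p : Config | Admissible p q'} q ∧
        ‖fderivWithin ℝ (fun p : Config => initialVelocity p q')
          {p : Config | Admissible p q'} q‖ < C) := by
  refine ⟨fun q q' h hne => Pendula.existsUnique_connection h hne, 10 ^ 9, ?_, ?_⟩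
  · intro r ε _ hε _ q₁ q₁' q₂ q₂' h₁ h₂ hD₁ hD₂ he
    have hδ : 0 < ε ^ (2 * r + 5) := pow_pos hε _
    refine (Pendula.norm_energyVector_sub_le h₁ h₂ hδ hD₁ hD₂ he).trans_lt ?_
    exact mul_lt_mul_of_pos_right (by norm_num) hδ
  · intro q q' h h1
    obtain ⟨hd, hb⟩ := Pendula.initialVelocity_differentiable h h1
    exact ⟨hd, hb.trans_lt (by norm_num)⟩
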